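/- For $k\in\mathbb Z$ let $f_k(\theta)=e^{\mathrm ik\theta}/\sqrt{2\pi}$, the Fourier basis of $L^2([0,2\pi],\mathbb C)$ (inner product conjugate-linear in the first variable), and let $\Theta$ be the completion of $L^2([0,2\pi],\mathbb C)$ for the norm $\|f\|_\Theta^2=\sum_{k\in\mathbb Z}\frac{|\langle f_k,f\rangle|^2}{1+k^2}$. A white noise on $L^2([0,2\pi],\mathbb C)$ associated with $(f_k)$ is a random variable $\xi$ in $\Theta$ of the form $\xi=\sum_{k\in\mathbb Z}\xi_kf_k$, the series converging almost surely in $\Theta$, with $(\xi_k)_{k\in\mathbb Z}$ i.i.d. $N_{\mathbb C}(0,1)$ (the law of $(X+\mathrm iY)/\sqrt2$ with $X,Y$ i.i.d. real standard Gaussian). Let $\mathbb D$ be the open unit disc and $\mathcal A(\mathbb D)$ the space of analytic functions on $\mathbb D$ with the topology of locally uniform convergence. For $N\in\mathbb N=\{0,1,2,\dots\}$, $f\in L^2([0,2\pi],\mathbb C)$ and $z\in\mathbb D$ put $$\mathcal L^{\mathsf{per}}_{\mathbb D,N}f(z)=\frac1{\sqrt{2\pi}}\int_0^{2\pi}\overline{f(\theta)}\,\frac{e^{\mathrm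 iN\theta}}{1-ze^{\mathrm i\theta}}\,d\theta .$$ **Theorem.** For every $N\in\mathbb N$: 1. for all $k\in\mathbb Z$ and $z\in\mathbb D$, $\mathcal L^{\mathsf{per}}_{\mathbb D,N}f_k(z)=z^{k-N}$ if $k\ge N$, and $\mathcal L^{\mathsf{per}}_{\mathbb D,N}f_k(z)=0$ if $k<N$; 2. $\mathcal L^{\mathsf{per}}_{\mathbb D,N}$ has a unique continuous extension $\Theta\to\mathcal A(\mathbb D)$, denoted by the same symbol; 3. if $\xi$ is a white noise on $L^2([0,2\pi],\mathbb C)$ associated with the Fourier basis, then $\mathcal L^{\mathsf{per}}_{\mathbb D,N}\xi$ is a hyperbolic Gaussian analytic function of parameter $\alpha=0$, that is, almost surely $\mathcal L^{\mathsf{per}}_{\mathbb D,N}\xi(z)=\sum_{k\ge0}\zeta_kz^k$ for all $z\in\mathbb D$, for some i.i.d. $N_{\mathbb C}(0,1)$ random variables $\zeta_k$; and, as a random variable in $\mathcal A(\mathbb D)$, it has the same law as every random analytic function of that form: $\mathcal L^{\mathsf{per}}_{\mathbb D,N}\xi\overset{\mathrm{law}}{=}\mathsf{GAF}^{(0)}_{\mathbb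 D}$; 4. for such $\xi$, the zeros of $\mathcal L^{\mathsf{per}}_{\mathbb D,N}\xi$ form a determinantal point process on $\mathbb D$ with Lebesgue reference measure and kernel the Bergman kernel $K_{\mathbb D}(z,w)=\frac1{\pi(1-z\overline w)^2}$: the set $Z$ of zeros is a random, almost surely locally finite, subset of $\mathbb D$, and for every $n\ge1$ and every bounded measurable $\psi:\mathbb D^n\to\mathbb R$ with compact support in $\mathbb D^n$, the sum below is integrable and $$\mathbb E\Big[\sum_{\substack{x_1,\dots,x_n\in Z\\ \text{pairwise distinct}}}\psi(x_1,\dots,x_n)\Big]=\int_{\mathbb D^n}\psi(z_1,\dots,z_n)\det\big[K_{\mathbb D}(z_i,z_j)\big]_{i,j=1}^n\,d^2z_1\cdots d^2z_n .$$ -/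

import Mathlib

open MeasureTheory ProbabilityTheory Set
open scoped ComplexConjugate ENNReal

noncomputable section

namespace PerGAF

/-! ### The signal space and its Fourier basis -/

/-- Lebesgue measure on `[0, 2π]`. -/
abbrev perMeasure : Measure ℝ := volume.restrict (Icc 0 (2 * Real.pi))

/-- The Hilbert space `L²([0, 2π], ℂ)`. -/
abbrev L2per : Type := Lp ℂ 2 perMeasure

/-- The Fourier functions `f_k(θ) = e^{ikθ} / √(2π)`, for `k ∈ ℤ`. -/
def fourierFun (k : ℤ) (θ : ℝ) : ℂ :=
  Complex.exp (Complex.I * k * θ) / (Real.sqrt (2 * Real.pi) : ℂ)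

theorem norm_fourierFun_le (k : ℤ) (θ : ℝ) :
    ‖fourierFun k θ‖ ≤ 1 / Real.sqrt (2 * Real.pi) := by
  have h : Complex.I * (k : ℂ) * (θ : ℂ) = ((k * θ : ℝ) : ℂ) * Complex.I := by
    push_cast; ring
  rw [fourierFun, h, norm_div, Complex.norm_exp_ofReal_mul_I, Complex.norm_real,
    Real.norm_of_nonneg (Real.sqrt_nonneg _)]

theorem memLp_fourierFun (k : ℤ) : MemLp (fourierFun k) 2 perMeasure := by
  refine MemLp.of_bound (C := 1 / Real.sqrt (2 * Real.pi)) ?_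
    (Filter.Eventually.of_forall (norm_fourierFun_le k))
  refine Continuous.aestronglyMeasurable ?_
  unfold fourierFun
  fun_prop

/-- The element `f_k` of `L²([0, 2π], ℂ)`. -/
def fourierVec (k : ℤ) : L2per := (memLp_fourierFun k).toLp (fourierFun k)

/-- The transform `L^{per}_{𝔻,N} f (z) = (2π)^{-1/2} ∫₀^{2π} conj (f θ) e^{iNθ} / (1 - z e^{iθ}) dθ`
of a signal `f ∈ L²([0, 2π], ℂ)`. -/
def perTransform (N : ℕ) (f : L2per) (z : ℂ) : ℂ :=
  1 / (Real.sqrt (2 * Real.pi) : ℂ) *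
    ∫ θ : ℝ in Icc 0 (2 * Real.pi),
      conj (f θ) * (Complex.exp (Complex.I * N * θ) / (1 - z * Complex.exp (Complex.I * θ)))

/-! ### The space in which the white noise lives

`Theta` is the completion of `L²([0, 2π], ℂ)` for the norm
`‖f‖² = ∑_{k ∈ ℤ} |⟨f_k, f⟩|² / (1 + k²)`. -/

/-- The weighted Fourier coefficients `⟨f_k, f⟩ / √(1 + k²)`. -/
def weightedCoeff (f : L2per) (k : ℤ) : ℂ :=
  inner ℂ (fourierVec k) f / (Real.sqrt (1 + (k : ℝ) ^ 2) : ℂ)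

theorem norm_weightedCoeff_sq (f : L2per) (k : ℤ) :
    ‖weightedCoeff f k‖ ^ 2 = ‖inner ℂ (fourierVec k) f‖ ^ 2 / (1 + (k : ℝ) ^ 2) := by
  rw [weightedCoeff, norm_div, Complex.norm_real, Real.norm_of_nonneg (Real.sqrt_nonneg _),
    div_pow, Real.sq_sqrt (by positivity)]

theorem exists_norm_fourierVec_le : ∃ C : ℝ, ∀ k : ℤ, ‖fourierVec k‖ ≤ C := by
  refine ⟨_, fun k => Lp.norm_le_of_ae_bound (μ := perMeasure) (p := 2) (f := fourierVec k)
    (C := 1 / Real.sqrt (2 * Real.pi)) (by positivity) ?_⟩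
  filter_upwards [(memLp_fourierFun k).coeFn_toLp] with θ hθ
  rw [fourierVec, hθ]
  exact norm_fourierFun_le k θ

theorem memlp_weightedCoeff (f : L2per) :
    Memℓp (E := fun _ : ℤ => ℂ) (weightedCoeff f) 2 := by
  obtain ⟨C, hC⟩ := exists_norm_fourierVec_le
  have h0 : Summable fun k : ℤ => 1 / (1 + (k : ℝ) ^ 2) := by
    refine Summable.of_norm_bounded_eventually
      ((Real.summable_one_div_int_pow (p := 2)).2 (by norm_num)) ?_
    filter_upwards [(Set.finite_singleton (0 : ℤ)).compl_mem_cofinite] with k hk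
    have hk0 : (k : ℝ) ≠ 0 := by exact_mod_cast hk
    have h1 : (0 : ℝ) < (k : ℝ) ^ 2 := by positivity
    rw [Real.norm_of_nonneg (by positivity)]
    exact one_div_le_one_div_of_le h1 (by linarith)
  rw [memℓp_gen_iff (by norm_num)]
  refine Summable.of_nonneg_of_le (fun k => by positivity) (fun k => ?_)
    (h0.mul_left ((C * ‖f‖) ^ 2))
  have h1 : ‖inner ℂ (fourierVec k) f‖ ≤ C * ‖f‖ :=
    (norm_inner_le_norm _ _).trans (by gcongr; exact hC k)
  have h2 := norm_weightedCoeff_sq f k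
  rw [ENNReal.toReal_ofNat, Real.rpow_ofNat, h2, mul_one_div]
  gcongr

/-- The map `f ↦ (⟨f_k, f⟩ / √(1 + k²))_k` into `ℓ²(ℤ)`, which induces the norm of `Theta`. -/
def weightedMap : L2per →ₗ[ℂ] lp (fun _ : ℤ => ℂ) 2 where
  toFun f := ⟨weightedCoeff f, memlp_weightedCoeff f⟩
  map_add' f g := by
    ext k
    exact (by simp [weightedCoeff, inner_add_right, add_div] :
      weightedCoeff (f + g) k = weightedCoeff f k + weightedCoeff g k)
  map_smul' c f := by
    ext k
    exact (by simp [weightedCoeff, inner_smul_right, mul_div_assoc] :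
      weightedCoeff (c • f) k = c • weightedCoeff f k)

/-- `L²([0, 2π], ℂ)`, to be endowed with the weaker norm. -/
def PreTheta : Type := L2per

instance : AddCommGroup PreTheta := inferInstanceAs (AddCommGroup L2per)

instance : Module ℂ PreTheta := inferInstanceAs (Module ℂ L2per)

/-- The identity map from `L²([0, 2π], ℂ)` to the same space with the weaker norm. -/
def toPreTheta : L2per ≃ₗ[ℂ] PreTheta := LinearEquiv.refl ℂ L2per

instance : SeminormedAddCommGroup PreTheta :=
  SeminormedAddCommGroup.induced PreTheta (lp (fun _ : ℤ => ℂ) 2)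
    (weightedMap ∘ₗ toPreTheta.symm.toLinearMap)

instance : NormedSpace ℂ PreTheta :=
  NormedSpace.induced ℂ PreTheta (lp (fun _ : ℤ => ℂ) 2)
    (weightedMap ∘ₗ toPreTheta.symm.toLinearMap)

theorem norm_toPreTheta_sq (f : L2per) :
    ‖toPreTheta f‖ ^ 2 = ∑' k : ℤ, ‖inner ℂ (fourierVec k) f‖ ^ 2 / (1 + (k : ℝ) ^ 2) := by
  have h : ‖toPreTheta f‖ = ‖weightedMap f‖ := rfl
  have h2 := lp.norm_rpow_eq_tsum (p := 2) (by norm_num) (weightedMap f)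
  rw [ENNReal.toReal_ofNat, Real.rpow_ofNat] at h2
  rw [h, h2]
  refine tsum_congr fun k => ?_
  rw [Real.rpow_ofNat]
  exact norm_weightedCoeff_sq f k

/-- The completion of `L²([0, 2π], ℂ)` for the weaker norm. -/
abbrev Theta : Type := UniformSpace.Completion PreTheta

instance : MeasurableSpace Theta := borel Theta

instance : BorelSpace Theta := ⟨rfl⟩

/-- The canonical embedding of `L²([0, 2π], ℂ)` in `Theta`. -/
def toTheta (f : L2per) : Theta := ((toPreTheta f : PreTheta) : Theta)

/-! ### Complex Gaussian variables and white noise -/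

/-- The law `N_ℂ(0, 1)`, that is the law of `(X + iY) / √2` with `X`, `Y` i.i.d. `N(0, 1)`. -/
def stdComplexGaussian : Measure ℂ :=
  ((gaussianReal 0 1).prod (gaussianReal 0 1)).map
    (fun p : ℝ × ℝ => ((p.1 : ℂ) + Complex.I * (p.2 : ℂ)) / (Real.sqrt 2 : ℂ))

/-- `(g i)` is a family of i.i.d. `N_ℂ(0, 1)` random variables. -/
structure IsIIDStdComplexGaussian {Ω ι : Type*} [MeasurableSpace Ω] (P : Measure Ω)
    (g : ι → Ω → ℂ) : Prop where
  measurable : ∀ i, Measurable (g i)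
  law : ∀ i, P.map (g i) = stdComplexGaussian
  indep : iIndepFun g P

/-- `ξ` is a white noise on `L²([0, 2π], ℂ)` associated with the Fourier basis: a random variable
in `Theta` which is the sum `∑_{k ∈ ℤ} ξ_k f_k`, almost surely convergent in `Theta`, where the
`ξ_k` are i.i.d. `N_ℂ(0, 1)`. -/
def IsWhiteNoise {Ω : Type*} [MeasurableSpace Ω] (P : Measure Ω) (ξ : Ω → Theta) : Prop :=
  Measurable ξ ∧ ∃ g : ℤ → Ω → ℂ, IsIIDStdComplexGaussian P g ∧
    ∀ᵐ ω ∂P, HasSum (fun k : ℤ => g k ω • toTheta (fourierVec k)) (ξ ω)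

/-! ### Random analytic functions -/

/-- The open unit disc. -/
abbrev disc : Set ℂ := Metric.ball (0 : ℂ) 1

/-- The space of analytic functions on `Λ ⊆ ℂ`, with the topology of uniform convergence on
compact subsets of `Λ` (the compact-open topology) and its Borel σ-algebra. -/
abbrev AnalyticFun (Λ : Set ℂ) : Type :=
  {f : C(Λ, ℂ) // ∃ F : ℂ → ℂ, AnalyticOnNhd ℂ F Λ ∧ ∀ z : Λ, F z = f z}

instance (Λ : Set ℂ) : MeasurableSpace (AnalyticFun Λ) := borel _

instance (Λ : Set ℂ) : BorelSpace (AnalyticFun Λ) := ⟨rfl⟩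

/-- The set of zeros in `Λ` of an analytic function on `Λ`. -/
def zeroSet {Λ : Set ℂ} (f : AnalyticFun Λ) : Set ℂ :=
  {z : ℂ | ∃ h : z ∈ Λ, f.1 ⟨z, h⟩ = 0}

/-- `G` is a hyperbolic Gaussian analytic function of parameter `α`:
`G(z) = ∑_{k ≥ 0} ξ_k √(Γ(k + α + 1) / k!) z^k` on the unit disc, almost surely, with `ξ_k`
i.i.d. `N_ℂ(0, 1)`. -/
def IsHyperbolicGAF {Ω : Type*} [MeasurableSpace Ω] (α : ℝ) (P : Measure Ω)
    (G : Ω → AnalyticFun disc) : Prop :=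
  Measurable G ∧ ∃ g : ℕ → Ω → ℂ, IsIIDStdComplexGaussian P g ∧
    ∀ᵐ ω ∂P, ∀ z : disc,
      HasSum (fun k : ℕ => g k ω *
        (Real.sqrt (Real.Gamma (k + α + 1) / (k.factorial : ℝ)) : ℂ) * (z : ℂ) ^ k) ((G ω).1 z)

/-- `L : Theta → 𝒜(𝔻)` is a continuous extension of the transform `L^{per}_{𝔻,N}`. -/
def IsExtensionOfPerTransform (N : ℕ) (L : Theta → AnalyticFun disc) : Prop :=
  Continuous L ∧ ∀ (f : L2per) (z : disc), (L (toTheta f)).1 z = perTransform N f z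

/-! ### Determinantal point processes -/

/-- The Bergman kernel of the unit disc. -/
def bergmanKernel (z w : ℂ) : ℂ := 1 / (Real.pi * (1 - z * conj w) ^ 2)

/-- The sum of `ψ (x₁, …, xₙ)` over the `n`-tuples of pairwise distinct points of `Z`. -/
def distinctSum (n : ℕ) (Z : Set ℂ) (ψ : (Fin n → ℂ) → ℝ) : ℝ :=
  ∑' x : {x : Fin n → ℂ // Function.Injective x ∧ ∀ i, x i ∈ Z}, ψ x.1

/-- The random set `Z` is a determinantal point process on `Λ ⊆ ℂ` with kernel `K` with respect to
Lebesgue measure: it is a (simple) point process, that is a random locally finite subset of `Λ`,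
and its joint intensities are `ρ_n(dz) = det [K(z_i, z_j)] dz₁ ⋯ dzₙ` for all `n ≥ 1`. -/
structure IsDeterminantalProcess {Ω : Type*} [MeasurableSpace Ω] (P : Measure Ω)
    (Λ : Set ℂ) (K : ℂ → ℂ → ℂ) (Z : Ω → Set ℂ) : Prop where
  subset : ∀ᵐ ω ∂P, Z ω ⊆ Λ
  locallyFinite : ∀ᵐ ω ∂P, ∀ C : Set ℂ, IsCompact C → C ⊆ Λ → (Z ω ∩ C).Finite
  measurable_count : ∀ B : Set ℂ, MeasurableSet B → AEMeasurable (fun ω => (Z ω ∩ B).encard) P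
  intensity : ∀ n : ℕ, 1 ≤ n → ∀ ψ : (Fin n → ℂ) → ℝ, Measurable ψ → (∃ M, ∀ x, |ψ x| ≤ M) →
    HasCompactSupport ψ → tsupport ψ ⊆ {x | ∀ i, x i ∈ Λ} →
    Integrable (fun ω => distinctSum n (Z ω) ψ) P ∧
      ((∫ ω, distinctSum n (Z ω) ψ ∂P : ℝ) : ℂ) =
        ∫ x in {x : Fin n → ℂ | ∀ i, x i ∈ Λ},
          (ψ x : ℂ) * Matrix.det (Matrix.of fun i j => K (x i) (x j))

end PerGAF

end

noncomputable section

namespace PerGAF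

/-! ### The transform in Fourier coordinates -/

/-! Expanding a geometric series under the integral turns the transform of f into the power series ∑
conj⟨f_{n+N}, f⟩ zⁿ. On `Theta` the coefficients may grow like √(1 + k²), which is harmless for |z|
< 1. The same series therefore defines the extension, and density of L² makes it unique. For white
noise the coefficients are conj ξ_{n+N}, again i.i.d. N_ℂ(0,1), so the transform is the Gaussian
analytic function F whose covariance is the Szegő kernel S(z,w) = 1/(1 − z w̄). That covariance
determines the law (`IsGAFLaw.eq`), because point evaluations generate the Borel σ-algebra of the
space of analytic functions.

The zeros are governed by one identity, `szego_eq_add`: S(z,w) = k_a(z) conj k_a(w) + φ_a(z) conj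
φ_a(w) S(z,w), with φ_a the disc automorphism vanishing at a and k_a the normalized Szegő kernel.
Hence ζ k_a + φ_a F has the law of F when ζ is N_ℂ(0,1) and independent of F
(`IsGAFLaw.map_affMap`). For a = 0, F is in law ζ + w g(w) with g a copy of F. Given g, the zeros
are the points where w g(w) = −ζ, and the area formula turns the average over ζ of a sum over zeros
into a Lebesgue integral over x. Decomposing g once more, now at a = x, and rescaling ζ gives the
Campbell formula `IsGAFLaw.lintegral_zeros`: E ∑_{F(x)=0} h(x, F) = ∫ (π(1 − |x|²))⁻¹ E[ |F(x)|²
h(x, φ_x F) ] dx.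

Since h may depend on F, the formula iterates over tuples of distinct zeros. The factors produced at
each step assemble, by a Schur complement, into π⁻ⁿ det S(z_i,z_j) · E ∏|F(z_i)|²
(`IsGAFLaw.lintegral_tupleSum`). Wick's formula identifies the expectation with the permanent of
S(z_i,z_j). Borchardt's identity says that determinant times permanent of a Cauchy matrix is the
determinant of the entrywise squares, and S²/π is the Bergman kernel. -/

theorem norm_fourierFun (k : ℤ) (θ : ℝ) :
    ‖fourierFun k θ‖ = 1 / Real.sqrt (2 * Real.pi) := by
  have h : Complex.I * (k : ℂ) * (θ : ℂ) = ((k * θ : ℝ) : ℂ) * Complex.I := by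
    push_cast; ring
  rw [fourierFun, h, norm_div, Complex.norm_exp_ofReal_mul_I, Complex.norm_real,
    Real.norm_of_nonneg (Real.sqrt_nonneg _)]

theorem continuous_fourierFun (k : ℤ) : Continuous (fourierFun k) := by
  unfold fourierFun
  fun_prop

theorem integrable_L2per (f : L2per) : Integrable f perMeasure :=
  (Lp.memLp f).integrable (by norm_num)

theorem conj_inner_fourierVec (f : L2per) (k : ℤ) :
    conj (inner ℂ (fourierVec k) f) = ∫ θ, conj (f θ) * fourierFun k θ ∂perMeasure := by
  rw [inner_conj_symm, L2.inner_def]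
  refine integral_congr_ae ?_
  filter_upwards [(memLp_fourierFun k).coeFn_toLp] with θ hθ
  rw [fourierVec, hθ, RCLike.inner_apply, mul_comm]

theorem integrable_conj_mul_fourierFun (f : L2per) (k : ℤ) :
    Integrable (fun θ => conj (f θ) * fourierFun k θ) perMeasure := by
  refine Integrable.mul_bdd (c := 1 / Real.sqrt (2 * Real.pi)) ?_
    (continuous_fourierFun k).aestronglyMeasurable
    (Filter.Eventually.of_forall (norm_fourierFun_le k))
  refine (integrable_L2per f).congr' ?_ ?_
  · exact Complex.continuous_conj.comp_aestronglyMeasurable (integrable_L2per f).1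
  · exact Filter.Eventually.of_forall fun θ => by simp

/-- Geometric expansion of 1/(1 − z e^{iθ}); the L¹ norms of the terms are summable for |z| < 1, so
sum and integral may be exchanged. -/
theorem hasSum_perTransform (N : ℕ) (f : L2per) {z : ℂ} (hz : z ∈ disc) :
    HasSum (fun n : ℕ => conj (inner ℂ (fourierVec (n + N)) f) * z ^ n) (perTransform N f z) := by
  have hz1 : ‖z‖ < 1 := by simpa using hz
  have h := hasSum_integral_of_summable_integral_norm (μ := perMeasure)
    (F := fun (n : ℕ) θ => conj (f θ) * fourierFun (n + N) θ * z ^ n)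
    (fun n => (integrable_conj_mul_fourierFun f _).mul_const _) (by
      have : (fun n : ℕ => ∫ θ, ‖conj (f θ) * fourierFun (n + N) θ * z ^ n‖ ∂perMeasure) =
          fun n : ℕ => (∫ θ, ‖f θ‖ * (1 / Real.sqrt (2 * Real.pi)) ∂perMeasure) * ‖z‖ ^ n := by
        funext n
        rw [← integral_mul_const]
        refine integral_congr_ae (Filter.Eventually.of_forall fun θ => ?_)
        simp only [norm_mul, norm_fourierFun, norm_pow, RCLike.norm_conj]
      rw [this]
      exact (summable_geometric_of_lt_one (norm_nonneg _) hz1).mul_left _)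
  convert! h using 1
  · funext n
    rw [conj_inner_fourierVec, integral_mul_const]
  · rw [perTransform, ← integral_const_mul]
    refine integral_congr_ae (Filter.Eventually.of_forall fun θ => ?_)
    have hw : ‖z * Complex.exp (Complex.I * θ)‖ < 1 := by
      rw [norm_mul, mul_comm Complex.I, Complex.norm_exp_ofReal_mul_I, mul_one]; exact hz1
    have h1 := (hasSum_geometric_of_norm_lt_one hw).mul_left
      (conj (f θ) * fourierFun N θ)
    have h2 : (fun n : ℕ => conj (f θ) * fourierFun (n + N) θ * z ^ n) =
        fun n : ℕ => conj (f θ) * fourierFun N θ * (z * Complex.exp (Complex.I * θ)) ^ n := by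
      funext n
      rw [fourierFun, fourierFun, mul_pow, ← Complex.exp_nat_mul]
      have : Complex.exp (Complex.I * ((n + N : ℤ) : ℂ) * θ) =
          Complex.exp (Complex.I * ((N : ℤ) : ℂ) * θ) *
            Complex.exp ((n : ℂ) * (Complex.I * θ)) := by
        rw [← Complex.exp_add]; congr 1; push_cast; ring
      rw [this]; ring
    simp only
    rw [h2, h1.tsum_eq, fourierFun]
    push_cast
    ring

theorem inner_fourierVec (j k : ℤ) :
    conj (inner ℂ (fourierVec j) (fourierVec k)) = if j = k then 1 else 0 := by
  rw [conj_inner_fourierVec]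
  have hpi : (0 : ℝ) ≤ 2 * Real.pi := by positivity
  have h1 : ∫ θ, conj (fourierVec k θ) * fourierFun j θ ∂perMeasure =
      ∫ θ in (0 : ℝ)..(2 * Real.pi),
        Complex.exp (((j - k : ℤ) : ℂ) * Complex.I * θ) / (2 * Real.pi) := by
    rw [intervalIntegral.integral_of_le hpi, ← integral_Icc_eq_integral_Ioc]
    refine integral_congr_ae ?_
    filter_upwards [(memLp_fourierFun k).coeFn_toLp] with θ hθ
    rw [fourierVec, hθ, fourierFun, fourierFun, map_div₀, ← Complex.exp_conj, Complex.conj_ofReal,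
      div_mul_div_comm, ← Complex.exp_add, ← Complex.ofReal_mul, Real.mul_self_sqrt hpi]
    push_cast
    congr 2
    simp only [map_mul, Complex.conj_I, Complex.conj_ofReal, map_intCast]
    ring
  rw [h1, intervalIntegral.integral_div]
  have hpi' : (2 * Real.pi : ℂ) ≠ 0 := by
    exact_mod_cast (by positivity : (2 * Real.pi : ℝ) ≠ 0)
  split_ifs with h
  · subst h
    simp [hpi']
  · have hne : ((j - k : ℤ) : ℂ) * Complex.I ≠ 0 := by
      refine mul_ne_zero ?_ Complex.I_ne_zero
      exact_mod_cast sub_ne_zero.2 h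
    rw [integral_exp_mul_complex hne]
    have : Complex.exp (((j - k : ℤ) : ℂ) * Complex.I * ((2 * Real.pi : ℝ) : ℂ)) = 1 := by
      rw [Complex.exp_eq_one_iff]
      exact ⟨j - k, by push_cast; ring⟩
    rw [this]; simp

/-- Orthonormality leaves at most one term of the power series, at n = k − N. -/
theorem perTransform_fourierVec (N : ℕ) (k : ℤ) {z : ℂ} (hz : z ∈ disc) :
    perTransform N (fourierVec k) z = if (N : ℤ) ≤ k then z ^ (k - N) else 0 := by
  have h := hasSum_perTransform N (fourierVec k) hz
  simp only [inner_fourierVec] at h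
  refine h.unique ?_
  split_ifs with hk
  · obtain ⟨m, hm⟩ := Int.eq_ofNat_of_zero_le (sub_nonneg.2 hk)
    have := hasSum_ite_eq m (z ^ m)
    rw [hm, zpow_natCast]
    convert this using 2 with n
    have : ((n : ℤ) + N = k) ↔ n = m := by omega
    by_cases hn : n = m
    · subst hn; simp [this]
    · simp [this, hn]
  · have : ∀ n : ℕ, ¬ ((n : ℤ) + N = k) := fun n => by omega
    simp [this, hasSum_zero]

/-! ### The continuous extension of the transform -/

/-- The weighted Fourier coefficients on `PreTheta`, as a continuous linear map. -/
def preThetaCoord : PreTheta →L[ℂ] lp (fun _ : ℤ => ℂ) 2 :=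
  LinearMap.mkContinuous (weightedMap ∘ₗ toPreTheta.symm.toLinearMap) 1
    (fun f => by rw [one_mul]; exact le_rfl)

/-- The weighted Fourier coefficients on `Theta`. -/
def thetaCoord : Theta →L[ℂ] lp (fun _ : ℤ => ℂ) 2 :=
  preThetaCoord.extend (UniformSpace.Completion.toComplL (𝕜 := ℂ) (E := PreTheta))

theorem thetaCoord_toTheta (f : L2per) : thetaCoord (toTheta f) = weightedMap f :=
  ContinuousLinearMap.extend_eq preThetaCoord (UniformSpace.Completion.denseRange_coe)
    (UniformSpace.Completion.isUniformInducing_coe _) (toPreTheta f)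

theorem denseRange_toTheta : DenseRange toTheta :=
  (UniformSpace.Completion.denseRange_coe (α := PreTheta)).comp
    toPreTheta.surjective.denseRange (UniformSpace.Completion.continuous_coe _)

/-- The weights in the power series of the extended transform. -/
def thetaWeight (N n : ℕ) : ℝ := Real.sqrt (1 + ((n + N : ℤ) : ℝ) ^ 2)

theorem thetaWeight_nonneg (N n : ℕ) : 0 ≤ thetaWeight N n := Real.sqrt_nonneg _

/-- Linear growth of the weights is all that the extension needs: the geometric factor absorbs it.
-/
theorem thetaWeight_le (N n : ℕ) : thetaWeight N n ≤ (n : ℝ) + (1 + N) := by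
  rw [thetaWeight, Real.sqrt_le_left (by positivity)]
  push_cast
  nlinarith [Nat.cast_nonneg (α := ℝ) n, Nat.cast_nonneg (α := ℝ) N]

theorem summable_thetaWeight (N : ℕ) {r : ℝ} (h0 : 0 ≤ r) (h1 : r < 1) :
    Summable fun n => thetaWeight N n * r ^ n := by
  have hr : ‖r‖ < 1 := by rwa [Real.norm_of_nonneg h0]
  refine Summable.of_nonneg_of_le
    (fun n => mul_nonneg (thetaWeight_nonneg _ _) (pow_nonneg h0 _))
    (fun n => mul_le_mul_of_nonneg_right (thetaWeight_le N n) (pow_nonneg h0 n)) ?_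
  have h2 : Summable fun n : ℕ => (n : ℝ) * r ^ n := by
    simpa only [pow_one] using summable_pow_mul_geometric_of_norm_lt_one (R := ℝ) 1 hr
  exact (h2.add ((summable_geometric_of_lt_one h0 h1).mul_left (1 + (N : ℝ)))).congr
    fun n => (add_mul _ _ _).symm

/-- The power series of the extended transform. -/
def extTransform (N : ℕ) (ξ : Theta) (z : ℂ) : ℂ :=
  ∑' n : ℕ, conj (thetaCoord ξ (n + N)) * thetaWeight N n * z ^ n

theorem norm_extTransform_term_le (N n : ℕ) (ξ : Theta) (z : ℂ) {R r : ℝ} (hξ : ‖thetaCoord ξ‖ ≤ R)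
    (hz : ‖z‖ ≤ r) :
    ‖conj (thetaCoord ξ (n + N)) * thetaWeight N n * z ^ n‖ ≤ R * (thetaWeight N n * r ^ n) := by
  have h1 : ‖thetaCoord ξ (n + N)‖ ≤ R :=
    (lp.norm_apply_le_norm (by norm_num) _ _).trans hξ
  rw [norm_mul, norm_mul, RCLike.norm_conj, norm_pow, Complex.norm_real,
    Real.norm_of_nonneg (thetaWeight_nonneg _ _), mul_assoc]
  have := thetaWeight_nonneg N n
  have hR : 0 ≤ R := (norm_nonneg _).trans hξ
  gcongr

theorem hasSum_extTransform (N : ℕ) (ξ : Theta) {z : ℂ} (hz : z ∈ disc) :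
    HasSum (fun n : ℕ => conj (thetaCoord ξ (n + N)) * thetaWeight N n * z ^ n)
      (extTransform N ξ z) := by
  have hz1 : ‖z‖ < 1 := by simpa using hz
  refine Summable.hasSum (Summable.of_norm_bounded
    ((summable_thetaWeight N (norm_nonneg z) hz1).mul_left ‖thetaCoord ξ‖) fun n => ?_)
  exact norm_extTransform_term_le N n ξ z le_rfl le_rfl

/-- Joint continuity is what currying converts into continuity for the compact-open topology. It is
a Weierstrass M-test on a neighbourhood where the `Theta` variable is bounded and |z| stays below
some r < 1. -/
theorem continuousAt_extTransform (N : ℕ) (ξ : Theta) {z : ℂ} (hz : z ∈ disc) :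
    ContinuousAt (fun p : Theta × ℂ => extTransform N p.1 p.2) (ξ, z) := by
  have hz1 : ‖z‖ < 1 := by simpa using hz
  obtain ⟨r, hr, hr1⟩ := exists_between hz1
  set U : Set (Theta × ℂ) := {p | ‖thetaCoord p.1‖ < ‖thetaCoord ξ‖ + 1 ∧ ‖p.2‖ < r}
  have hU : IsOpen U :=
    IsOpen.inter (s := {p : Theta × ℂ | ‖thetaCoord p.1‖ < ‖thetaCoord ξ‖ + 1})
      (t := {p : Theta × ℂ | ‖p.2‖ < r})
      (isOpen_lt (by fun_prop) continuous_const) (isOpen_lt (by fun_prop) continuous_const)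
  have hcoord : ∀ k : ℤ, Continuous fun ξ : Theta => thetaCoord ξ k := fun k =>
    ((lp.evalCLM ℂ (fun _ : ℤ => ℂ) 2 k).continuous.comp thetaCoord.continuous)
  have : ContinuousOn (fun p : Theta × ℂ => extTransform N p.1 p.2) U := by
    refine continuousOn_tsum (u := fun n => (‖thetaCoord ξ‖ + 1) * (thetaWeight N n * r ^ n))
      (fun n => ?_) ?_ ?_
    · have := (hcoord (n + N)).comp (continuous_fst (X := Theta) (Y := ℂ))
      refine Continuous.continuousOn ?_
      exact ((Complex.continuous_conj.comp this).mul continuous_const).mul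
        (continuous_snd.pow n)
    · exact (summable_thetaWeight N ((norm_nonneg z).trans hr.le) hr1).mul_left _
    · rintro n ⟨η, w⟩ ⟨h1, h2⟩
      exact norm_extTransform_term_le N n η w h1.le h2.le
  exact this.continuousAt (hU.mem_nhds ⟨by simp, hr⟩)

theorem differentiableOn_extTransform (N : ℕ) (ξ : Theta) :
    DifferentiableOn ℂ (extTransform N ξ) disc := by
  intro z hz
  have hz1 : ‖z‖ < 1 := by simpa using hz
  obtain ⟨r, hr, hr1⟩ := exists_between hz1
  have := Complex.differentiableOn_tsum_of_summable_norm
    (F := fun (n : ℕ) (z : ℂ) => conj (thetaCoord ξ (n + N)) * thetaWeight N n * z ^ n)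
    (U := Metric.ball 0 r)
    ((summable_thetaWeight N ((norm_nonneg z).trans hr.le) hr1).mul_left ‖thetaCoord ξ‖)
    (fun n => by fun_prop) Metric.isOpen_ball
    (fun n w hw => norm_extTransform_term_le N n ξ w le_rfl (mem_ball_zero_iff.1 hw).le)
  refine (this.differentiableAt (Metric.isOpen_ball.mem_nhds ?_)).differentiableWithinAt
  simpa using hr

/-- The continuous extension of the transform to `Theta`. -/
def extTransformMap (N : ℕ) (ξ : Theta) : AnalyticFun disc :=
  ⟨⟨fun z => extTransform N ξ z,
    ((differentiableOn_extTransform N ξ).continuousOn).domRestrict⟩,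
    extTransform N ξ, (differentiableOn_extTransform N ξ).analyticOnNhd Metric.isOpen_ball,
    fun _ => rfl⟩

theorem continuous_extTransformMap (N : ℕ) : Continuous (extTransformMap N) := by
  have h : Continuous fun p : Theta × disc => extTransform N p.1 p.2 := by
    rw [continuous_iff_continuousAt]
    rintro ⟨ξ, z⟩
    have h2 : Continuous fun p : Theta × disc => ((p.1, (p.2 : ℂ)) : Theta × ℂ) := by fun_prop
    exact ContinuousAt.comp (f := fun p : Theta × disc => ((p.1, (p.2 : ℂ)) : Theta × ℂ))
      (g := fun p : Theta × ℂ => extTransform N p.1 p.2) (x := (ξ, z))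
      (continuousAt_extTransform N ξ z.2) h2.continuousAt
  refine Continuous.subtype_mk ?_ _
  exact (ContinuousMap.curry ⟨_, h⟩).continuous

theorem isExtension_extTransformMap (N : ℕ) : IsExtensionOfPerTransform N (extTransformMap N) := by
  refine ⟨continuous_extTransformMap N, fun f z => ?_⟩
  refine (hasSum_extTransform N (toTheta f) z.2).unique ?_
  convert! hasSum_perTransform N f z.2 using 2 with n
  rw [thetaCoord_toTheta]
  change conj (weightedCoeff f (n + N)) * _ * _ = _
  have h0 : ((Real.sqrt (1 + (((n + N : ℤ)) : ℝ) ^ 2) : ℝ) : ℂ) ≠ 0 := by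
    exact_mod_cast (by positivity : Real.sqrt (1 + (((n + N : ℤ)) : ℝ) ^ 2) ≠ 0)
  rw [weightedCoeff, thetaWeight, map_div₀, Complex.conj_ofReal, div_mul_cancel₀ _ h0]

theorem IsExtensionOfPerTransform.eq {N : ℕ} {L : Theta → AnalyticFun disc}
    (hL : IsExtensionOfPerTransform N L) : L = extTransformMap N := by
  refine DenseRange.equalizer denseRange_toTheta hL.1 (continuous_extTransformMap N) ?_
  funext f
  refine Subtype.ext (ContinuousMap.ext fun z => ?_)
  exact (hL.2 f z).trans ((isExtension_extTransformMap N).2 f z).symm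

/-- Each coordinate of `thetaCoord` is continuous and linear, so it may be applied term by term to
the series of ξ; orthogonality leaves only the term k = n + N. -/
theorem hasSum_extTransformMap_of_hasSum (N : ℕ) {a : ℤ → ℂ} {ξ : Theta}
    (h : HasSum (fun k : ℤ => a k • toTheta (fourierVec k)) ξ) (z : disc) :
    HasSum (fun n : ℕ => conj (a (n + N)) * (z : ℂ) ^ n) ((extTransformMap N ξ).1 z) := by
  convert! hasSum_extTransform N ξ z.2 using 2 with n
  have h0 : ((Real.sqrt (1 + (((n + N : ℤ)) : ℝ) ^ 2) : ℝ) : ℂ) ≠ 0 := by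
    exact_mod_cast (by positivity : Real.sqrt (1 + (((n + N : ℤ)) : ℝ) ^ 2) ≠ 0)
  have h1 := ((lp.evalCLM ℂ (fun _ : ℤ => ℂ) 2 (n + N : ℤ)).comp thetaCoord).hasSum h
  have h2 := hasSum_single (f := fun k : ℤ => ((lp.evalCLM ℂ (fun _ : ℤ => ℂ) 2 (n + N : ℤ)).comp
    thetaCoord) (a k • toTheta (fourierVec k))) (n + N : ℤ) (fun k hk => by
      have : inner ℂ (fourierVec (n + N)) (fourierVec k) = 0 := by
        have := inner_fourierVec (n + N) k
        rw [if_neg hk.symm] at this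
        exact (map_eq_zero _).1 this
      rw [map_smul, ContinuousLinearMap.comp_apply, thetaCoord_toTheta]
      change a k • weightedCoeff (fourierVec k) (n + N) = 0
      rw [weightedCoeff, this, zero_div, smul_zero])
  have h3 := h1.unique h2
  have h4 : inner ℂ (fourierVec (n + N)) (fourierVec (n + N)) = (1 : ℂ) := by
    have := inner_fourierVec (n + N) (n + N)
    rw [if_pos rfl] at this
    simpa using congrArg conj this
  rw [map_smul, ContinuousLinearMap.comp_apply, ContinuousLinearMap.comp_apply,
    thetaCoord_toTheta] at h3
  change thetaCoord ξ (n + N) = a (n + N) • weightedCoeff (fourierVec (n + N)) (n + N) at h3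
  rw [h3, weightedCoeff, h4, thetaWeight, smul_eq_mul, map_mul, map_div₀, Complex.conj_ofReal,
    map_one, mul_assoc (conj (a _)), div_mul_cancel₀ _ h0, mul_one]

/-! ### The space of analytic functions as a measurable space -/

/-- By compactness f(K) ⊆ U holds with a uniform margin 1/(m+1). For a fixed margin the condition on
f(x) is closed, so it need only be tested on a countable dense subset of K. This expresses a
subbasic open set by countably many evaluations. -/
theorem borel_continuousMap_le_comap_eval {X Y : Type*} [TopologicalSpace X]
    [SecondCountableTopology X] [LocallyCompactSpace X] [PseudoMetricSpace Y]
    [SecondCountableTopology Y] [MeasurableSpace Y] [BorelSpace Y] :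
    borel C(X, Y) ≤ MeasurableSpace.comap (fun (f : C(X, Y)) (x : X) => f x) MeasurableSpace.pi := by
  rw [borel_eq_generateFrom_of_subbasis (ContinuousMap.compactOpen_eq (X := X) (Y := Y))]
  refine MeasurableSpace.generateFrom_le ?_
  rintro _ ⟨K, hK : IsCompact K, U, hU : IsOpen U, rfl⟩
  obtain ⟨s, hs, hsd⟩ := TopologicalSpace.exists_countable_dense K
  have hG : ∀ m : ℕ, IsClosed {y : Y | Metric.ball y (1 / ((m : ℝ) + 1)) ⊆ U} := by
    intro m
    have : {y : Y | Metric.ball y (1 / ((m : ℝ) + 1)) ⊆ U} =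
        (⋃ u ∈ Uᶜ, Metric.ball u (1 / ((m : ℝ) + 1)))ᶜ := by
      ext y
      simp only [mem_ofPred_eq, mem_compl_iff, mem_iUnion, not_exists, subset_def, Metric.mem_ball]
      refine forall_congr' fun u => ?_
      rw [dist_comm]
      tauto
    rw [this]
    exact (isOpen_biUnion fun _ _ => Metric.isOpen_ball).isClosed_compl
  have hset : {f : C(X, Y) | MapsTo f K U} = ⋃ m : ℕ, ⋂ d ∈ s,
      {f : C(X, Y) | f (d : K) ∈ {y : Y | Metric.ball y (1 / ((m : ℝ) + 1)) ⊆ U}} := by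
    ext f
    simp only [mem_ofPred_eq, mem_iUnion, mem_iInter]
    constructor
    · intro h
      obtain ⟨δ, hδ, hδU⟩ := (hK.image f.continuous).exists_cthickening_subset_open hU
        (image_subset_iff.2 h)
      obtain ⟨m, hm⟩ := exists_nat_one_div_lt hδ
      refine ⟨m, fun d _ y hy => hδU ?_⟩
      exact Metric.mem_cthickening_of_dist_le y (f d) δ _ (mem_image_of_mem f d.2)
        ((Metric.mem_ball.1 hy).le.trans hm.le)
    · rintro ⟨m, h⟩ x hx
      have hcl : IsClosed {d : K | f d ∈ {y : Y | Metric.ball y (1 / ((m : ℝ) + 1)) ⊆ U}} :=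
        (hG m).preimage (f.continuous.comp continuous_subtype_val)
      have : (⟨x, hx⟩ : K) ∈ closure s := hsd _
      exact (closure_minimal (fun d hd => h d hd) hcl this) (Metric.mem_ball_self (by positivity))
  let : MeasurableSpace C(X, Y) :=
    MeasurableSpace.comap (fun (f : C(X, Y)) (x : X) => f x) MeasurableSpace.pi
  change MeasurableSet {f : C(X, Y) | MapsTo f K U}
  rw [hset]
  have hev : ∀ x : X, Measurable fun f : C(X, Y) => f x := fun x =>
    (measurable_pi_apply x).comp (comap_measurable _)
  exact MeasurableSet.iUnion fun m => MeasurableSet.biInter hs fun d _ =>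
    hev d (hG m).measurableSet

instance : LocallyCompactSpace disc := (Metric.isOpen_ball).locallyCompactSpace

/-- Measurability of maps into the space of analytic functions, and equality of laws on it, can
therefore be checked on point evaluations. -/
theorem analyticFun_measurableSpace_le :
    (inferInstance : MeasurableSpace (AnalyticFun disc)) ≤
      MeasurableSpace.comap (fun (f : AnalyticFun disc) (z : disc) => f.1 z)
        MeasurableSpace.pi := by
  have h : (inferInstance : MeasurableSpace (AnalyticFun disc)) =
      MeasurableSpace.comap Subtype.val (borel C(disc, ℂ)) := by
    change borel (AnalyticFun disc) = _
    exact borel_comap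
  rw [h]
  refine (MeasurableSpace.comap_mono borel_continuousMap_le_comap_eval).trans ?_
  rw [MeasurableSpace.comap_comp]
  exact le_rfl

/-- An analytic function on the disc, extended by zero. -/
def ev (f : AnalyticFun disc) (z : ℂ) : ℂ := open Classical in
  if h : z ∈ disc then f.1 ⟨z, h⟩ else 0

theorem ev_of_mem (f : AnalyticFun disc) {z : ℂ} (h : z ∈ disc) : ev f z = f.1 ⟨z, h⟩ := by
  simp only [ev, dif_pos h]

theorem ev_of_notMem (f : AnalyticFun disc) {z : ℂ} (h : z ∉ disc) : ev f z = 0 := by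
  simp only [ev, dif_neg h]

theorem differentiableOn_ev (f : AnalyticFun disc) : DifferentiableOn ℂ (ev f) disc := by
  obtain ⟨F, hF, hFf⟩ := f.2
  refine hF.differentiableOn.congr fun z hz => ?_
  rw [ev_of_mem f hz, hFf ⟨z, hz⟩]

theorem analyticFun_ext {f g : AnalyticFun disc} (h : ∀ z ∈ disc, ev f z = ev g z) : f = g := by
  refine Subtype.ext (ContinuousMap.ext fun z => ?_)
  have := h z z.2
  rwa [ev_of_mem f z.2, ev_of_mem g z.2] at this

/-- The analytic function on the disc given by `F` (zero if `F` is not holomorphic there). -/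
def toAnalytic (F : ℂ → ℂ) : AnalyticFun disc := open Classical in
  if h : DifferentiableOn ℂ F disc then
    ⟨⟨fun z => F z, h.continuousOn.domRestrict⟩, F, h.analyticOnNhd Metric.isOpen_ball,
      fun _ => rfl⟩
  else ⟨0, 0, analyticOnNhd_const, fun _ => rfl⟩

theorem ev_toAnalytic {F : ℂ → ℂ} (h : DifferentiableOn ℂ F disc) {z : ℂ} (hz : z ∈ disc) :
    ev (toAnalytic F) z = F z := by
  rw [ev_of_mem _ hz, toAnalytic, dif_pos h]
  rfl

theorem measurable_of_ev {α : Type*} [MeasurableSpace α] {Φ : α → AnalyticFun disc}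
    (h : ∀ z ∈ disc, Measurable fun a => ev (Φ a) z) : Measurable Φ := by
  have : Measurable[_, MeasurableSpace.comap (fun (f : AnalyticFun disc) (z : disc) => f.1 z)
        MeasurableSpace.pi] Φ := by
    rw [measurable_comap_iff, measurable_pi_iff]
    intro z
    have := h z z.2
    simpa only [ev_of_mem _ z.2, Function.comp_def] using this
  exact this.mono le_rfl analyticFun_measurableSpace_le

theorem continuous_eval_analyticFun :
    Continuous fun p : AnalyticFun disc × disc => p.1.1 p.2 :=
  (continuous_eval (F := C(disc, ℂ))).comp
    ((continuous_subtype_val.comp continuous_fst).prodMk continuous_snd)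

theorem measurable_ev : Measurable fun p : AnalyticFun disc × ℂ => ev p.1 p.2 := by
  have hs : MeasurableSet {p : AnalyticFun disc × ℂ | p.2 ∈ disc} :=
    measurable_snd Metric.isOpen_ball.measurableSet
  refine measurable_of_restrict_of_restrict_compl (s := {p : AnalyticFun disc × ℂ | p.2 ∈ disc}) hs
    ?_ ?_
  · have h1 : Measurable fun q : {p : AnalyticFun disc × ℂ | p.2 ∈ disc} =>
        ((q.1.1, ⟨q.1.2, q.2⟩) : AnalyticFun disc × disc) :=
      (measurable_fst.comp measurable_subtype_coe).prodMk
        ((measurable_snd.comp measurable_subtype_coe).subtype_mk)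
    convert continuous_eval_analyticFun.measurable.comp h1 using 1
    funext q
    exact ev_of_mem _ q.2
  · convert (measurable_const (a := (0 : ℂ))) using 1
    funext q
    exact ev_of_notMem _ q.2

theorem measurable_ev_apply (z : ℂ) : Measurable fun f : AnalyticFun disc => ev f z :=
  measurable_ev.comp (measurable_id.prodMk measurable_const)

/-- The derivative of an analytic function, set to zero outside the disc. -/
def evDeriv (f : AnalyticFun disc) (z : ℂ) : ℂ := disc.indicator (deriv (ev f)) z

theorem evDeriv_of_mem (f : AnalyticFun disc) {z : ℂ} (h : z ∈ disc) :
    evDeriv f z = deriv (ev f) z := indicator_of_mem h _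

/-- A pointwise limit of difference quotients with increments 1/(n+1), cut off outside the disc. -/
theorem measurable_evDeriv : Measurable fun p : AnalyticFun disc × ℂ => evDeriv p.1 p.2 := by
  have hd : MeasurableSet disc := Metric.isOpen_ball.measurableSet
  have hs : MeasurableSet {p : AnalyticFun disc × ℂ | p.2 ∈ disc} := measurable_snd hd
  set δ : ℕ → ℂ := fun n => ((1 / ((n : ℝ) + 1) : ℝ) : ℂ)
  refine measurable_of_tendsto_metrizable (f := fun (n : ℕ) (p : AnalyticFun disc × ℂ) =>
    {p : AnalyticFun disc × ℂ | p.2 ∈ disc}.indicator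
      (fun p => (δ n)⁻¹ * (ev p.1 (p.2 + δ n) - ev p.1 p.2)) p) (fun n => ?_) ?_
  · refine Measurable.indicator ?_ hs
    refine Measurable.const_mul (Measurable.sub ?_ measurable_ev) _
    exact measurable_ev.comp (measurable_fst.prodMk (measurable_snd.add_const _))
  · rw [tendsto_pi_nhds]
    rintro ⟨f, z⟩
    by_cases hz : z ∈ disc
    · rw [evDeriv_of_mem f hz]
      have h1 := ((differentiableOn_ev f).differentiableAt
        (Metric.isOpen_ball.mem_nhds hz)).hasDerivAt.tendsto_slope_zero
      have h2 : Filter.Tendsto δ Filter.atTop (nhdsWithin 0 {0}ᶜ) := by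
        refine tendsto_nhdsWithin_iff.2 ⟨?_, Filter.Eventually.of_forall fun n => ?_⟩
        · have := (Complex.continuous_ofReal.tendsto 0).comp
            (tendsto_one_div_add_atTop_nhds_zero_nat (𝕜 := ℝ))
          simpa only [δ, Complex.ofReal_zero, Function.comp_def] using this
        · have : (1 / ((n : ℝ) + 1)) ≠ 0 := by positivity
          simpa only [δ, mem_compl_iff, mem_singleton_iff, Complex.ofReal_eq_zero] using this
      refine (h1.comp h2).congr fun n => ?_
      simp only [Function.comp, smul_eq_mul]
      rw [indicator_of_mem (by exact hz)]
    · rw [evDeriv, indicator_of_notMem hz]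
      refine tendsto_const_nhds.congr fun n => ?_
      rw [indicator_of_notMem (by exact hz)]

attribute [irreducible] ev evDeriv

/-! ### The standard complex Gaussian law -/

theorem measurable_stdComplexGaussian_map :
    Measurable fun p : ℝ × ℝ => ((p.1 : ℂ) + Complex.I * (p.2 : ℂ)) / (Real.sqrt 2 : ℂ) := by
  fun_prop

instance : IsProbabilityMeasure stdComplexGaussian :=
  Measure.isProbabilityMeasure_map measurable_stdComplexGaussian_map.aemeasurable

/-- Re(cw) = (Re c · X − Im c · Y)/√2, so the integral splits into two real Gaussian characteristic
functions. -/
theorem integral_cexp_re_mul_stdComplexGaussian (c : ℂ) :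
    ∫ w, Complex.exp (Complex.I * ((c * w).re : ℂ)) ∂stdComplexGaussian =
      Complex.exp (-(‖c‖ ^ 2 / 4 : ℝ)) := by
  have h2 : (Real.sqrt 2 : ℝ) ≠ 0 := by positivity
  rw [stdComplexGaussian, integral_map measurable_stdComplexGaussian_map.aemeasurable
    (Continuous.aestronglyMeasurable (by fun_prop))]
  have h : ∀ p : ℝ × ℝ, Complex.exp (Complex.I *
      ((c * (((p.1 : ℂ) + Complex.I * (p.2 : ℂ)) / (Real.sqrt 2 : ℂ))).re : ℂ)) =
      Complex.exp ((c.re / Real.sqrt 2 : ℝ) * p.1 * Complex.I) *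
      Complex.exp ((-c.im / Real.sqrt 2 : ℝ) * p.2 * Complex.I) := by
    intro p
    rw [← Complex.exp_add]
    congr 1
    have : (c * (((p.1 : ℂ) + Complex.I * (p.2 : ℂ)) / (Real.sqrt 2 : ℂ))).re =
        c.re / Real.sqrt 2 * p.1 + (-c.im / Real.sqrt 2) * p.2 := by
      rw [← mul_div_assoc, Complex.div_ofReal_re]
      simp only [Complex.mul_re, Complex.add_re, Complex.add_im, Complex.ofReal_re,
        Complex.ofReal_im, Complex.I_re, Complex.I_im, Complex.mul_im]
      ring
    rw [this]
    push_cast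
    ring
  simp_rw [h]
  rw [integral_prod_mul (fun x : ℝ => Complex.exp ((c.re / Real.sqrt 2 : ℝ) * x * Complex.I))
    (fun y : ℝ => Complex.exp ((-c.im / Real.sqrt 2 : ℝ) * y * Complex.I)),
    ← charFun_apply_real, ← charFun_apply_real, charFun_gaussianReal, charFun_gaussianReal,
    ← Complex.exp_add]
  congr 1
  have h3 : ((Real.sqrt 2 : ℝ) : ℂ) ^ 2 = 2 := by
    exact_mod_cast Real.sq_sqrt (by norm_num : (0 : ℝ) ≤ 2)
  have h4 : (‖c‖ : ℂ) ^ 2 = (c.re : ℂ) ^ 2 + (c.im : ℂ) ^ 2 := by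
    have := Complex.sq_norm c
    rw [Complex.normSq_apply] at this
    exact_mod_cast by rw [this]; ring
  push_cast
  rw [div_pow, div_pow, h3, h4]
  ring

theorem ext_of_integral_cexp_re_mul {μ ν : Measure ℂ} [IsFiniteMeasure μ] [IsFiniteMeasure ν]
    (h : ∀ c : ℂ, ∫ w, Complex.exp (Complex.I * ((c * w).re : ℂ)) ∂μ =
      ∫ w, Complex.exp (Complex.I * ((c * w).re : ℂ)) ∂ν) : μ = ν := by
  refine Measure.ext_of_charFun (funext fun t => ?_)
  rw [charFun_apply, charFun_apply]
  have h1 : ∀ w : ℂ, (inner ℝ w t : ℂ) * Complex.I = Complex.I * ((conj t * w).re : ℂ) := by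
    intro w
    rw [mul_comm]
    congr 2
    rw [Complex.inner, ← Complex.conj_re (conj t * w)]
    simp [mul_comm]
  simp_rw [h1]
  exact h _

theorem stdComplexGaussian_map_conj :
    stdComplexGaussian.map (fun w => conj w) = stdComplexGaussian := by
  have hm : Measurable fun w : ℂ => conj w := Complex.continuous_conj.measurable
  have := Measure.isProbabilityMeasure_map (μ := stdComplexGaussian) hm.aemeasurable
  refine ext_of_integral_cexp_re_mul fun c => ?_
  rw [integral_map hm.aemeasurable (Continuous.aestronglyMeasurable (by fun_prop))]
  have h1 : ∀ w : ℂ, (c * conj w).re = (conj c * w).re := by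
    intro w
    rw [← Complex.conj_re (c * conj w)]
    simp
  simp_rw [h1]
  rw [integral_cexp_re_mul_stdComplexGaussian, integral_cexp_re_mul_stdComplexGaussian,
    RCLike.norm_conj]

theorem stdComplexGaussian_map_mul {u : ℂ} (hu : ‖u‖ = 1) :
    stdComplexGaussian.map (fun w => u * w) = stdComplexGaussian := by
  have hm : Measurable fun w : ℂ => u * w := by fun_prop
  have := Measure.isProbabilityMeasure_map (μ := stdComplexGaussian) hm.aemeasurable
  refine ext_of_integral_cexp_re_mul fun c => ?_
  rw [integral_map hm.aemeasurable (Continuous.aestronglyMeasurable (by fun_prop))]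
  simp_rw [← mul_assoc]
  rw [integral_cexp_re_mul_stdComplexGaussian, integral_cexp_re_mul_stdComplexGaussian,
    norm_mul, hu, mul_one]

/-- The density of the standard complex Gaussian law. -/
def gaussDensity (w : ℂ) : ℝ := Real.exp (-‖w‖ ^ 2) / Real.pi

theorem gaussDensity_nonneg (w : ℂ) : 0 ≤ gaussDensity w := by
  unfold gaussDensity; positivity

theorem measurable_gaussDensity : Measurable gaussDensity := by
  unfold gaussDensity; fun_prop

theorem lintegral_comp_real_mul {q : ℝ} (hq : 0 < q) (g : ℂ → ℝ≥0∞) :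
    ENNReal.ofReal (q ^ 2) * ∫⁻ w : ℂ, g (q * w) = ∫⁻ w : ℂ, g w := by
  have h1 := Measure.map_addHaar_smul (volume : Measure ℂ) hq.ne'
  have h2 : MeasurableEmbedding fun w : ℂ => q • w :=
    (MeasurableEquiv.smul₀ q hq.ne').measurableEmbedding
  have h3 := h2.lintegral_map (μ := volume) g
  rw [h1, lintegral_smul_measure, Complex.finrank_real_complex,
    abs_of_pos (by positivity : (0 : ℝ) < (q ^ 2)⁻¹), smul_eq_mul] at h3
  simp only [Complex.real_smul] at h3
  rw [← h3, ← mul_assoc, ← ENNReal.ofReal_mul (by positivity), mul_inv_cancel₀ (by positivity),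
    ENNReal.ofReal_one, one_mul]

theorem stdComplexGaussian_eq_withDensity :
    stdComplexGaussian = volume.withDensity fun w => ENNReal.ofReal (gaussDensity w) := by
  refine Measure.ext_of_lintegral _ fun g hg => ?_
  have hT := measurable_stdComplexGaussian_map
  have hpdf : Measurable fun p : ℝ × ℝ => gaussianPDF 0 1 p.1 * gaussianPDF 0 1 p.2 :=
    ((measurable_gaussianPDF 0 1).comp measurable_fst).mul
      ((measurable_gaussianPDF 0 1).comp measurable_snd)
  have hgd : Measurable fun w => ENNReal.ofReal (gaussDensity w) :=
    measurable_gaussDensity.ennreal_ofReal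
  rw [stdComplexGaussian, lintegral_map hg hT, gaussianReal_of_var_ne_zero _ one_ne_zero,
    prod_withDensity (measurable_gaussianPDF 0 1) (measurable_gaussianPDF 0 1),
    lintegral_withDensity_eq_lintegral_mul _ hpdf
      (g := fun p => g (((p.1 : ℂ) + Complex.I * (p.2 : ℂ)) / (Real.sqrt 2 : ℂ))) (hg.comp hT),
    lintegral_withDensity_eq_lintegral_mul _ hgd hg]
  have h2 : (0 : ℝ) < 1 / Real.sqrt 2 := by positivity
  rw [← lintegral_comp_real_mul h2, ← lintegral_const_mul' _ _ ENNReal.ofReal_ne_top,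
    ← (Complex.volume_preserving_equiv_real_prod.symm _).lintegral_comp_emb
      Complex.measurableEquivRealProd.symm.measurableEmbedding]
  refine lintegral_congr fun p => ?_
  simp only [Pi.mul_apply]
  have hp : ((1 / Real.sqrt 2 : ℝ) : ℂ) * Complex.measurableEquivRealProd.symm p =
      ((p.1 : ℂ) + Complex.I * (p.2 : ℂ)) / (Real.sqrt 2 : ℂ) := by
    have : Complex.measurableEquivRealProd.symm p = (p.1 : ℂ) + Complex.I * (p.2 : ℂ) := by
      apply Complex.ext <;> simp
    rw [this]; push_cast; ring
  rw [hp, ← mul_assoc, gaussianPDF, gaussianPDF, ← ENNReal.ofReal_mul (gaussianPDFReal_nonneg _ _ _),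
    ← ENNReal.ofReal_mul (by positivity)]
  congr 2
  have hn : ‖((p.1 : ℂ) + Complex.I * (p.2 : ℂ)) / (Real.sqrt 2 : ℂ)‖ ^ 2 =
      (p.1 ^ 2 + p.2 ^ 2) / 2 := by
    rw [norm_div, div_pow, Complex.norm_real, Real.norm_of_nonneg (Real.sqrt_nonneg _),
      Real.sq_sqrt (by norm_num), mul_comm Complex.I, Complex.sq_norm, Complex.normSq_add_mul_I]
  rw [gaussDensity, hn, gaussianPDFReal, gaussianPDFReal, div_pow, one_pow,
    Real.sq_sqrt (by norm_num)]
  have e : Real.exp (-((p.1 ^ 2 + p.2 ^ 2) / 2)) =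
      Real.exp (-p.1 ^ 2 / 2) * Real.exp (-p.2 ^ 2 / 2) := by
    rw [← Real.exp_add]; ring_nf
  have e2 : (Real.sqrt (2 * Real.pi))⁻¹ * (Real.sqrt (2 * Real.pi))⁻¹ = 1 / 2 / Real.pi := by
    rw [← mul_inv, Real.mul_self_sqrt (by positivity)]; field_simp
  rw [e]
  simp only [NNReal.coe_one, mul_one, sub_zero]
  linear_combination Real.exp (-p.1 ^ 2 / 2) * Real.exp (-p.2 ^ 2 / 2) * e2

theorem lintegral_stdComplexGaussian {g : ℂ → ℝ≥0∞} (hg : Measurable g) :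
    ∫⁻ w, g w ∂stdComplexGaussian = ∫⁻ w, ENNReal.ofReal (gaussDensity w) * g w := by
  rw [stdComplexGaussian_eq_withDensity,
    lintegral_withDensity_eq_lintegral_mul _ measurable_gaussDensity.ennreal_ofReal hg]
  rfl

/-- The extra factor only changes the variance, since the product of the two exponentials is
exp(−|w/q|²). The substitution w ↦ qw undoes this, with planar Jacobian q². -/
theorem lintegral_exp_mul_stdComplexGaussian {g : ℂ → ℝ≥0∞} (hg : Measurable g) {q : ℝ}
    (hq : 0 < q) :
    ∫⁻ w, ENNReal.ofReal (Real.exp (-((q ^ 2)⁻¹ - 1) * ‖w‖ ^ 2)) * g w ∂stdComplexGaussian =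
      ENNReal.ofReal (q ^ 2) * ∫⁻ w, g (q * w) ∂stdComplexGaussian := by
  rw [lintegral_stdComplexGaussian (by fun_prop), lintegral_stdComplexGaussian (by fun_prop),
    ← lintegral_comp_real_mul hq]
  congr 1
  refine lintegral_congr fun w => ?_
  rw [← mul_assoc, ← ENNReal.ofReal_mul (gaussDensity_nonneg _)]
  congr 2
  rw [gaussDensity, gaussDensity, div_mul_eq_mul_div, ← Real.exp_add, norm_mul, mul_pow,
    Complex.norm_real, Real.norm_of_nonneg hq.le]
  congr 2
  field_simp
  ring

theorem integral_norm_pow_stdComplexGaussian (a : ℕ) :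
    ∫ w, ‖w‖ ^ a ∂stdComplexGaussian = Real.Gamma ((a + 2) / 2) := by
  rw [stdComplexGaussian_eq_withDensity, integral_withDensity_eq_integral_toReal_smul
    measurable_gaussDensity.ennreal_ofReal (Filter.Eventually.of_forall fun _ =>
      ENNReal.ofReal_lt_top)]
  have h := Complex.integral_rpow_mul_exp_neg_rpow (p := 2) (q := a) (by norm_num)
    (by have := Nat.cast_nonneg (α := ℝ) a; linarith)
  have h1 : ∀ w : ℂ, (ENNReal.ofReal (gaussDensity w)).toReal • ‖w‖ ^ a =
      (‖w‖ ^ (a : ℝ) * Real.exp (-‖w‖ ^ (2 : ℝ))) / Real.pi := by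
    intro w
    rw [ENNReal.toReal_ofReal (gaussDensity_nonneg w), gaussDensity, smul_eq_mul,
      Real.rpow_natCast, Real.rpow_ofNat]
    ring
  simp_rw [h1]
  rw [integral_div, h]
  field_simp

theorem integrable_norm_pow_stdComplexGaussian (a : ℕ) :
    Integrable (fun w : ℂ => ‖w‖ ^ a) stdComplexGaussian := by
  refine Integrable.of_integral_ne_zero ?_
  rw [integral_norm_pow_stdComplexGaussian]
  exact (Real.Gamma_pos_of_pos (by positivity)).ne'

theorem integrable_moment_stdComplexGaussian (a b : ℕ) :
    Integrable (fun w : ℂ => w ^ a * conj w ^ b) stdComplexGaussian := by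
  refine (integrable_norm_pow_stdComplexGaussian (a + b)).mono'
    (Continuous.aestronglyMeasurable (by fun_prop)) (Filter.Eventually.of_forall fun w => ?_)
  rw [norm_mul, norm_pow, norm_pow, RCLike.norm_conj, pow_add]

theorem integral_moment_stdComplexGaussian (a b : ℕ) :
    ∫ w, w ^ a * conj w ^ b ∂stdComplexGaussian = if a = b then (a.factorial : ℂ) else 0 := by
  split_ifs with h
  · subst h
    have h1 : ∀ w : ℂ, w ^ a * conj w ^ a = ((‖w‖ ^ (2 * a) : ℝ) : ℂ) := by
      intro w
      rw [← mul_pow, Complex.mul_conj', pow_mul]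
      push_cast; rfl
    simp_rw [h1]
    rw [integral_complex_ofReal, integral_norm_pow_stdComplexGaussian]
    have : ((2 * a : ℕ) + 2 : ℝ) / 2 = a + 1 := by push_cast; ring
    rw [this, Real.Gamma_nat_eq_factorial]
    simp
  · have hab : ((a : ℂ) - b) ≠ 0 := by
      rw [sub_ne_zero]; exact_mod_cast h
    -- The rotation u = e^{it} is chosen so that u^a ū^b = −1; rotation invariance then makes the
    -- moment equal to its own negative.
    set t : ℝ := Real.pi / ((a : ℝ) - b)
    set u : ℂ := Complex.exp (t * Complex.I)
    have hu : ‖u‖ = 1 := Complex.norm_exp_ofReal_mul_I _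
    have hconj : conj u = Complex.exp (-(t * Complex.I)) := by
      rw [← Complex.exp_conj]; simp
    have huab : u ^ a * conj u ^ b = -1 := by
      rw [hconj, ← Complex.exp_nat_mul, ← Complex.exp_nat_mul, ← Complex.exp_add,
        ← Complex.exp_pi_mul_I]
      congr 1
      simp only [t]
      push_cast
      field_simp
      ring
    have h1 := integral_map (μ := stdComplexGaussian) (φ := fun w => u * w)
      (f := fun w => w ^ a * conj w ^ b) (by fun_prop)
      (Continuous.aestronglyMeasurable (by fun_prop))
    rw [stdComplexGaussian_map_mul hu] at h1
    have h2 : ∀ w, (u * w) ^ a * conj (u * w) ^ b = -1 * (w ^ a * conj w ^ b) := by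
      intro w
      rw [map_mul, ← huab]; ring
    simp_rw [h2] at h1
    rw [integral_const_mul] at h1
    have h3 := h1
    linear_combination h3 / 2

theorem stdComplexGaussian_singleton (w : ℂ) : stdComplexGaussian {w} = 0 := by
  rw [stdComplexGaussian_eq_withDensity]
  exact withDensity_absolutelyContinuous _ _ (by simp)

attribute [irreducible] gaussDensity

/-! ### Gaussian laws on the space of analytic functions -/

theorem ext_of_integral_cexp_re_sum {ι : Type*} [Fintype ι] {μ ν : Measure (ι → ℂ)}
    [IsFiniteMeasure μ] [IsFiniteMeasure ν]
    (h : ∀ c : ι → ℂ, ∫ x, Complex.exp (Complex.I * ((∑ i, c i * x i).re : ℂ)) ∂μ =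
      ∫ x, Complex.exp (Complex.I * ((∑ i, c i * x i).re : ℂ)) ∂ν) : μ = ν := by
  classical
  refine Measure.ext_of_charFunDual (funext fun L => ?_)
  rw [charFunDual_apply, charFunDual_apply]
  -- These coefficients represent the real functional L as x ↦ Re ∑ c_i x_i; they are read off on
  -- the real basis e_i, i·e_i.
  set c : ι → ℂ := fun i => (L (Pi.single i 1) : ℂ) - Complex.I * (L (Pi.single i Complex.I) : ℂ)
  have h1 : ∀ x : ι → ℂ, (L x : ℂ) * Complex.I =
      Complex.I * ((∑ i, c i * x i).re : ℂ) := by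
    intro x
    rw [mul_comm]
    congr 2
    have hx : x = ∑ i, ((x i).re • (Pi.single i (1 : ℂ) : ι → ℂ) +
        (x i).im • (Pi.single i Complex.I : ι → ℂ)) := by
      ext j
      simp only [Finset.sum_apply, Pi.add_apply, Pi.smul_apply, Pi.single_apply, smul_ite,
        smul_zero, Finset.sum_add_distrib, Finset.sum_ite_eq, Finset.mem_univ, if_true]
      simp [Complex.re_add_im]
    conv_lhs => rw [hx]
    rw [map_sum, Complex.re_sum]
    refine Finset.sum_congr rfl fun i _ => ?_
    simp only [map_add, map_smul, smul_eq_mul, c, Complex.mul_re, Complex.sub_re, Complex.sub_im,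
      Complex.ofReal_re, Complex.ofReal_im, Complex.I_re, Complex.I_im, Complex.mul_im]
    ring
  simp_rw [h1]
  exact h c

/-- The Szegő kernel of the unit disc. -/
def szego (z w : ℂ) : ℂ := 1 / (1 - z * conj w)

/-- `m` is the law of the centred complex Gaussian analytic function on the disc whose covariance
is the Szegő kernel, in terms of its characteristic functional. -/
def IsGAFLaw (m : Measure (AnalyticFun disc)) : Prop :=
  ∀ (ι : Type) [Fintype ι] (z c : ι → ℂ), (∀ i, z i ∈ disc) →
    ∫ f, Complex.exp (Complex.I * ((∑ i, c i * ev f (z i)).re : ℂ)) ∂m =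
      Complex.exp (-(1 / 4) * ∑ i, ∑ j, c i * conj (c j) * szego (z i) (z j))

theorem measurable_ev_family {ι : Type*} (z : ι → ℂ) :
    Measurable fun (f : AnalyticFun disc) (i : ι) => ev f (z i) :=
  measurable_pi_iff.2 fun i => measurable_ev_apply (z i)

/-- The characteristic functional fixes all finite-dimensional marginals, these fix the law on the
product space, and evaluations generate the σ-algebra. -/
theorem IsGAFLaw.eq {m m' : Measure (AnalyticFun disc)} [IsProbabilityMeasure m]
    [IsProbabilityMeasure m'] (hm : IsGAFLaw m) (hm' : IsGAFLaw m') : m = m' := by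
  set E : AnalyticFun disc → disc → ℂ := fun f z => ev f z
  have hE : Measurable E := measurable_ev_family _
  have := Measure.isProbabilityMeasure_map (μ := m) hE.aemeasurable
  have := Measure.isProbabilityMeasure_map (μ := m') hE.aemeasurable
  have hr : ∀ I : Finset disc, Measurable (I.restrict (π := fun _ : disc => ℂ)) :=
    fun I => Finset.measurable_restrict I
  have hprob : ∀ I : Finset disc,
      IsProbabilityMeasure ((m.map E).map (I.restrict (π := fun _ : disc => ℂ))) :=
    fun I => Measure.isProbabilityMeasure_map (hr I).aemeasurable
  have hprob' : ∀ I : Finset disc,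
      IsProbabilityMeasure ((m'.map E).map (I.restrict (π := fun _ : disc => ℂ))) :=
    fun I => Measure.isProbabilityMeasure_map (hr I).aemeasurable
  have key : m.map E = m'.map E := by
    refine IsProjectiveLimit.unique
      (P := fun I : Finset disc => (m.map E).map (I.restrict (π := fun _ : disc => ℂ)))
      (fun I => rfl) (fun I => ?_)
    refine ext_of_integral_cexp_re_sum fun c => ?_
    have hcont : Continuous fun x : I → ℂ =>
        Complex.exp (Complex.I * ((∑ i, c i * x i).re : ℂ)) := by fun_prop
    have hcomp : Measurable fun x : disc → ℂ =>
        Complex.exp (Complex.I * ((∑ i, c i * I.restrict x i).re : ℂ)) :=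
      hcont.measurable.comp (hr I)
    rw [integral_map (hr I).aemeasurable hcont.aestronglyMeasurable,
      integral_map (hr I).aemeasurable hcont.aestronglyMeasurable,
      integral_map hE.aemeasurable hcomp.aestronglyMeasurable,
      integral_map hE.aemeasurable hcomp.aestronglyMeasurable]
    exact (hm' I (fun i => (i : disc)) c fun i => i.1.2).trans
      (hm I (fun i => (i : disc)) c fun i => i.1.2).symm
  refine Measure.ext fun s hs => ?_
  obtain ⟨t, ht, rfl⟩ := analyticFun_measurableSpace_le s hs
  have hpre : (fun (f : AnalyticFun disc) (z : disc) => f.1 z) = E := by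
    funext f z
    exact (ev_of_mem f z.2).symm
  rw [hpre, ← Measure.map_apply hE ht, ← Measure.map_apply hE ht, key]

theorem norm_mul_conj_lt_one {z w : ℂ} (hz : z ∈ disc) (hw : w ∈ disc) : ‖z * conj w‖ < 1 := by
  rw [norm_mul, RCLike.norm_conj]
  exact mul_lt_one_of_nonneg_of_lt_one_left (norm_nonneg _) (mem_ball_zero_iff.1 hz)
    (mem_ball_zero_iff.1 hw).le

theorem hasSum_szego {z w : ℂ} (hz : z ∈ disc) (hw : w ∈ disc) :
    HasSum (fun k : ℕ => z ^ k * conj w ^ k) (szego z w) := by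
  rw [szego, one_div]
  simpa only [mul_pow] using hasSum_geometric_of_norm_lt_one (norm_mul_conj_lt_one hz hw)

/-- This is the variance of ∑ c_i F(z_i), split over the Taylor coefficients of F. It serves for the
characteristic functional and for positivity of the Szegő matrix. -/
theorem hasSum_norm_sq_szego {ι : Type*} [Fintype ι] (z c : ι → ℂ) (hz : ∀ i, z i ∈ disc) :
    HasSum (fun k : ℕ => ((‖∑ i, c i * z i ^ k‖ ^ 2 : ℝ) : ℂ))
      (∑ i, ∑ j, c i * conj (c j) * szego (z i) (z j)) := by
  have h := hasSum_sum (s := Finset.univ) fun (i : ι) _ => hasSum_sum (s := Finset.univ)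
    fun (j : ι) _ => (hasSum_szego (hz i) (hz j)).mul_left (c i * conj (c j))
  convert! h using 2 with k
  push_cast
  rw [← Complex.mul_conj', map_sum, Finset.sum_mul_sum]
  refine Finset.sum_congr rfl fun i _ => Finset.sum_congr rfl fun j _ => ?_
  rw [map_mul, map_pow]
  ring

theorem integral_cexp_re_sum_of_iid {Ω ι : Type*} [MeasurableSpace Ω] {P : Measure Ω} [Fintype ι]
    {g : ι → Ω → ℂ} (hg : IsIIDStdComplexGaussian P g) (a : ι → ℂ) :
    ∫ ω, Complex.exp (Complex.I * ((∑ i, a i * g i ω).re : ℂ)) ∂P =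
      Complex.exp (-(1 / 4) * ∑ i, ((‖a i‖ ^ 2 : ℝ) : ℂ)) := by
  have h1 := hg.indep.integral_fun_prod_comp
    (f := fun i w => Complex.exp (Complex.I * ((a i * w).re : ℂ)))
    (fun i => (hg.measurable i).aemeasurable)
    (fun i => Continuous.aestronglyMeasurable (by fun_prop))
  have h2 : ∀ ω, Complex.exp (Complex.I * ((∑ i, a i * g i ω).re : ℂ)) =
      ∏ i, Complex.exp (Complex.I * ((a i * g i ω).re : ℂ)) := by
    intro ω
    rw [← Complex.exp_sum, ← Finset.mul_sum, Complex.re_sum, Complex.ofReal_sum]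
  simp_rw [h2]
  rw [h1, Finset.mul_sum, Complex.exp_sum]
  refine Finset.prod_congr rfl fun i _ => ?_
  have h3 := integral_map (μ := P) (hg.measurable i).aemeasurable
    (f := fun w => Complex.exp (Complex.I * ((a i * w).re : ℂ)))
    (Continuous.aestronglyMeasurable (by fun_prop))
  rw [← h3, hg.law i, integral_cexp_re_mul_stdComplexGaussian]
  congr 1
  push_cast
  ring

theorem IsIIDStdComplexGaussian.precomp {Ω ι κ : Type*} [MeasurableSpace Ω] {P : Measure Ω}
    {g : ι → Ω → ℂ} (hg : IsIIDStdComplexGaussian P g) {e : κ → ι} (he : Function.Injective e) :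
    IsIIDStdComplexGaussian P fun k => g (e k) :=
  ⟨fun _ => hg.measurable _, fun _ => hg.law _, hg.indep.precomp he⟩

theorem IsIIDStdComplexGaussian.conj {Ω ι : Type*} [MeasurableSpace Ω] {P : Measure Ω}
    {g : ι → Ω → ℂ} (hg : IsIIDStdComplexGaussian P g) :
    IsIIDStdComplexGaussian P fun k ω => conj (g k ω) := by
  have hm : Measurable fun w : ℂ => conj w := Complex.continuous_conj.measurable
  refine ⟨fun k => hm.comp (hg.measurable k), fun k => ?_, hg.indep.comp _ fun _ => hm⟩
  have := Measure.map_map (μ := P) hm (hg.measurable k)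
  rw [hg.law, stdComplexGaussian_map_conj] at this
  exact this.symm

/-- Partial sums of the series are finite Gaussian combinations with explicit characteristic
function. The exponentials have modulus one, so dominated convergence passes to the limit. -/
theorem IsHyperbolicGAF.isGAFLaw {Ω : Type*} [MeasurableSpace Ω] {P : Measure Ω}
    [IsProbabilityMeasure P] {G : Ω → AnalyticFun disc} (hG : IsHyperbolicGAF 0 P G) :
    IsGAFLaw (P.map G) := by
  obtain ⟨hGm, g, hg, hsum⟩ := hG
  intro ι _ z c hz
  have hmeas : Measurable fun f : AnalyticFun disc =>
      Complex.exp (Complex.I * ((∑ i, c i * ev f (z i)).re : ℂ)) := by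
    have h1 : Continuous fun x : ι → ℂ =>
        Complex.exp (Complex.I * ((∑ i, c i * x i).re : ℂ)) := by fun_prop
    exact h1.measurable.comp (measurable_ev_family z)
  rw [integral_map hGm.aemeasurable hmeas.aestronglyMeasurable]
  have hlim : ∀ᵐ ω ∂P, Filter.Tendsto (fun n : ℕ => Complex.exp (Complex.I *
      ((∑ k ∈ Finset.range n, (∑ i, c i * z i ^ k) * g k ω).re : ℂ))) Filter.atTop
      (nhds (Complex.exp (Complex.I * ((∑ i, c i * ev (G ω) (z i)).re : ℂ)))) := by
    filter_upwards [hsum] with ω hω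
    have h1 : HasSum (fun k : ℕ => (∑ i, c i * z i ^ k) * g k ω) (∑ i, c i * ev (G ω) (z i)) := by
      convert! hasSum_sum (s := Finset.univ) fun (i : ι) _ => (hω ⟨z i, hz i⟩).mul_left (c i)
        using 1
      · funext k
        rw [Finset.sum_mul]
        refine Finset.sum_congr rfl fun i _ => ?_
        -- At α = 0 the weight √(Γ(k+1)/k!) equals 1.
        rw [add_zero, Real.Gamma_nat_eq_factorial, div_self (by positivity), Real.sqrt_one,
          Complex.ofReal_one]
        ring
      · exact Finset.sum_congr rfl fun i _ => by rw [ev_of_mem _ (hz i)]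
    have h2 : Continuous fun w : ℂ => Complex.exp (Complex.I * ((w.re : ℝ) : ℂ)) := by fun_prop
    exact (h2.tendsto _).comp h1.tendsto_sum_nat
  have hconv := tendsto_integral_of_dominated_convergence (μ := P) (fun _ => (1 : ℝ))
    (F := fun (n : ℕ) ω => Complex.exp (Complex.I *
      ((∑ k ∈ Finset.range n, (∑ i, c i * z i ^ k) * g k ω).re : ℂ)))
    (fun n => by
      have h1 : Continuous fun w : ℂ => Complex.exp (Complex.I * ((w.re : ℝ) : ℂ)) := by fun_prop
      refine (h1.measurable.comp (Finset.measurable_sum _ fun k _ => ?_)).aestronglyMeasurable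
      exact (hg.measurable k).const_mul _)
    (integrable_const _) (fun n => Filter.Eventually.of_forall fun ω => by
      rw [mul_comm, Complex.norm_exp_ofReal_mul_I]) hlim
  refine tendsto_nhds_unique hconv ?_
  have h3 : ∀ n : ℕ, ∫ ω, Complex.exp (Complex.I *
      ((∑ k ∈ Finset.range n, (∑ i, c i * z i ^ k) * g k ω).re : ℂ)) ∂P =
      Complex.exp (-(1 / 4) * ∑ k ∈ Finset.range n, ((‖∑ i, c i * z i ^ k‖ ^ 2 : ℝ) : ℂ)) := by
    intro n
    have := integral_cexp_re_sum_of_iid (hg.precomp (Fin.val_injective (n := n)))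
      (fun k : Fin n => ∑ i, c i * z i ^ (k : ℕ))
    rw [Fin.sum_univ_eq_sum_range (fun k => ((‖∑ i, c i * z i ^ k‖ ^ 2 : ℝ) : ℂ)) n] at this
    rw [← this]
    refine integral_congr_ae (Filter.Eventually.of_forall fun ω => ?_)
    simp only
    rw [Fin.sum_univ_eq_sum_range (fun k => (∑ i, c i * z i ^ k) * g k ω) n]
  simp_rw [h3]
  have h4 : Continuous fun w : ℂ => Complex.exp (-(1 / 4) * w) := by fun_prop
  exact (h4.tendsto _).comp (hasSum_norm_sq_szego z c hz).tendsto_sum_nat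

/-! ### Invariance of the Gaussian law -/

/-- The identity on the disc, zero outside. -/
def clip (a : ℂ) : ℂ := disc.indicator id a

theorem measurable_clip : Measurable clip :=
  measurable_id.indicator Metric.isOpen_ball.measurableSet

theorem clip_mem (a : ℂ) : clip a ∈ disc := by
  by_cases h : a ∈ disc
  · rwa [clip, indicator_of_mem h]
  · rw [clip, indicator_of_notMem h]; simp

theorem clip_of_mem {a : ℂ} (h : a ∈ disc) : clip a = a := by
  rw [clip, indicator_of_mem h, id]

/-- The disc automorphism sending `a` to `0`. -/
def mob (a w : ℂ) : ℂ := (w - clip a) / (1 - w * conj (clip a))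

/-- The normalized Szegő kernel at `a`. -/
def nker (a w : ℂ) : ℂ := (Real.sqrt (1 - ‖clip a‖ ^ 2) : ℂ) / (1 - w * conj (clip a))

theorem one_sub_mul_conj_ne_zero {z w : ℂ} (hz : z ∈ disc) (hw : w ∈ disc) :
    1 - z * conj w ≠ 0 := by
  intro h
  have h1 := norm_mul_conj_lt_one hz hw
  rw [← sub_eq_zero.1 h, norm_one] at h1
  exact lt_irrefl _ h1

theorem differentiableOn_mob (a : ℂ) : DifferentiableOn ℂ (mob a) disc := by
  unfold mob
  exact DifferentiableOn.div (by fun_prop) (by fun_prop)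
    fun w hw => one_sub_mul_conj_ne_zero hw (clip_mem a)

theorem differentiableOn_nker (a : ℂ) : DifferentiableOn ℂ (nker a) disc := by
  unfold nker
  exact DifferentiableOn.div (by fun_prop) (by fun_prop)
    fun w hw => one_sub_mul_conj_ne_zero hw (clip_mem a)

theorem measurable_conj : Measurable fun w : ℂ => conj w :=
  Complex.continuous_conj.measurable

theorem measurable_mob : Measurable fun p : ℂ × ℂ => mob p.1 p.2 := by
  have h1 : Measurable fun p : ℂ × ℂ => clip p.1 := measurable_clip.comp measurable_fst
  exact (measurable_snd.sub h1).div
    ((measurable_snd.mul (measurable_conj.comp h1)).const_sub 1)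

theorem measurable_nker : Measurable fun p : ℂ × ℂ => nker p.1 p.2 := by
  have h1 : Measurable fun p : ℂ × ℂ => clip p.1 := measurable_clip.comp measurable_fst
  refine Measurable.div ?_ ((measurable_snd.mul (measurable_conj.comp h1)).const_sub 1)
  have h2 : Measurable fun w : ℂ => (Real.sqrt (1 - ‖w‖ ^ 2) : ℂ) := by fun_prop
  exact h2.comp h1

theorem one_sub_norm_sq_pos {a : ℂ} (ha : a ∈ disc) : 0 < 1 - ‖a‖ ^ 2 := by
  have := mem_ball_zero_iff.1 ha
  have := norm_nonneg a
  nlinarith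

/-- Here b and v stand for the conjugates of a and of the second point, treated as independent
variables. -/
theorem szego_algebra {a b z v : ℂ} (h1 : 1 - z * b ≠ 0) (h2 : 1 - v * a ≠ 0)
    (h3 : 1 - z * v ≠ 0) :
    (1 - a * b) / ((1 - z * b) * (1 - v * a)) +
      (z - a) / (1 - z * b) * ((v - b) / (1 - v * a)) * (1 / (1 - z * v)) = 1 / (1 - z * v) := by
  rw [div_mul_div_comm, div_mul_div_comm, div_add_div _ _ (mul_ne_zero h1 h2)
    (mul_ne_zero (mul_ne_zero h1 h2) h3), div_eq_div_iff
    (mul_ne_zero (mul_ne_zero h1 h2) (mul_ne_zero (mul_ne_zero h1 h2) h3)) h3]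
  ring

/-- Reproducing-kernel form of the orthogonal decomposition H² = ℂ k_a ⊕ φ_a H² of the Hardy space.
-/
theorem szego_eq_add (a : ℂ) {z w : ℂ} (hz : z ∈ disc) (hw : w ∈ disc) :
    nker a z * conj (nker a w) + mob a z * conj (mob a w) * szego z w = szego z w := by
  have h1 := one_sub_mul_conj_ne_zero hz (clip_mem a)
  have h2 := (map_ne_zero (starRingEnd ℂ)).2 (one_sub_mul_conj_ne_zero hw (clip_mem a))
  have h3 := one_sub_mul_conj_ne_zero hz hw
  have h4 : ((Real.sqrt (1 - ‖clip a‖ ^ 2) : ℝ) : ℂ) * (Real.sqrt (1 - ‖clip a‖ ^ 2) : ℂ) =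
      1 - clip a * conj (clip a) := by
    rw [← Complex.ofReal_mul, Real.mul_self_sqrt (one_sub_norm_sq_pos (clip_mem a)).le,
      Complex.mul_conj']
    push_cast; rfl
  rw [nker, nker, mob, mob, szego, map_div₀, map_div₀, Complex.conj_ofReal, div_mul_div_comm, h4]
  simp only [map_sub, map_mul, map_one, Complex.conj_conj] at h2 ⊢
  exact szego_algebra h1 h2 h3

attribute [irreducible] nker

/-- The map `(ζ, f) ↦ ζ k_a + φ_a f`. -/
def affMap (a ζ : ℂ) (f : AnalyticFun disc) : AnalyticFun disc :=
  toAnalytic fun w => ζ * nker a w + mob a w * ev f w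

theorem ev_affMap (a ζ : ℂ) (f : AnalyticFun disc) {w : ℂ} (hw : w ∈ disc) :
    ev (affMap a ζ f) w = ζ * nker a w + mob a w * ev f w :=
  ev_toAnalytic (((differentiableOn_nker a).const_mul ζ).add
    ((differentiableOn_mob a).mul (differentiableOn_ev f))) hw

theorem measurable_affMap : Measurable fun p : ℂ × ℂ × AnalyticFun disc =>
    affMap p.1 p.2.1 p.2.2 := by
  refine measurable_of_ev (Φ := fun p : ℂ × ℂ × AnalyticFun disc => affMap p.1 p.2.1 p.2.2)
    fun z hz => ?_
  have h1 : Measurable fun p : ℂ × ℂ × AnalyticFun disc => nker p.1 z :=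
    measurable_nker.comp (measurable_fst.prodMk measurable_const)
  have h2 : Measurable fun p : ℂ × ℂ × AnalyticFun disc => mob p.1 z :=
    measurable_mob.comp (measurable_fst.prodMk measurable_const)
  have h3 : Measurable fun p : ℂ × ℂ × AnalyticFun disc => ev p.2.2 z :=
    (measurable_ev_apply z).comp (measurable_snd.comp measurable_snd)
  have h4 : Measurable fun p : ℂ × ℂ × AnalyticFun disc => p.2.1 :=
    measurable_fst.comp measurable_snd
  have h5 : (fun p : ℂ × ℂ × AnalyticFun disc => ev (affMap p.1 p.2.1 p.2.2) z) =
      fun p => p.2.1 * nker p.1 z + mob p.1 z * ev p.2.2 z :=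
    funext fun p => ev_affMap p.1 p.2.1 p.2.2 hz
  rw [h5]
  exact (h4.mul h1).add (h2.mul h3)

theorem measurable_affMap_left (a : ℂ) : Measurable fun p : ℂ × AnalyticFun disc =>
    affMap a p.1 p.2 :=
  measurable_affMap.comp (measurable_const.prodMk measurable_id)

/-- Covariances of independent Gaussian terms add, and by `szego_eq_add` those of ζ k_a and φ_a f
add up to S. -/
theorem IsGAFLaw.map_affMap {m : Measure (AnalyticFun disc)} [IsProbabilityMeasure m]
    (hm : IsGAFLaw m) (a : ℂ) :
    (stdComplexGaussian.prod m).map (fun p => affMap a p.1 p.2) = m := by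
  have hA := measurable_affMap_left a
  have := Measure.isProbabilityMeasure_map (μ := stdComplexGaussian.prod m) hA.aemeasurable
  refine IsGAFLaw.eq (fun ι _ z c hz => ?_) hm
  have hmeas : Measurable fun f : AnalyticFun disc =>
      Complex.exp (Complex.I * ((∑ i, c i * ev f (z i)).re : ℂ)) := by
    have h1 : Continuous fun x : ι → ℂ =>
        Complex.exp (Complex.I * ((∑ i, c i * x i).re : ℂ)) := by fun_prop
    exact h1.measurable.comp (measurable_ev_family z)
  rw [integral_map hA.aemeasurable hmeas.aestronglyMeasurable]
  have h1 : ∀ p : ℂ × AnalyticFun disc,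
      Complex.exp (Complex.I * ((∑ i, c i * ev (affMap a p.1 p.2) (z i)).re : ℂ)) =
      Complex.exp (Complex.I * (((∑ i, c i * nker a (z i)) * p.1).re : ℂ)) *
      Complex.exp (Complex.I * ((∑ i, (c i * mob a (z i)) * ev p.2 (z i)).re : ℂ)) := by
    intro p
    rw [← Complex.exp_add, ← mul_add, ← Complex.ofReal_add, ← Complex.add_re, Finset.sum_mul,
      ← Finset.sum_add_distrib]
    congr 5
    funext i
    rw [ev_affMap _ _ _ (hz i)]
    ring
  simp_rw [h1]
  rw [integral_prod_mul (fun ζ : ℂ =>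
      Complex.exp (Complex.I * (((∑ i, c i * nker a (z i)) * ζ).re : ℂ)))
    (fun f : AnalyticFun disc =>
      Complex.exp (Complex.I * ((∑ i, (c i * mob a (z i)) * ev f (z i)).re : ℂ))),
    integral_cexp_re_mul_stdComplexGaussian, hm ι z _ hz, ← Complex.exp_add]
  congr 1
  have h2 : ((‖∑ i, c i * nker a (z i)‖ ^ 2 / 4 : ℝ) : ℂ) =
      (1 / 4) * ∑ i, ∑ j, c i * conj (c j) * (nker a (z i) * conj (nker a (z j))) := by
    push_cast
    rw [← Complex.mul_conj', map_sum, Finset.sum_mul_sum, div_eq_mul_one_div, mul_comm]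
    congr 1
    refine Finset.sum_congr rfl fun i _ => Finset.sum_congr rfl fun j _ => ?_
    rw [map_mul]
    ring
  push_cast at h2 ⊢
  rw [h2, ← neg_mul, ← mul_add, ← Finset.sum_add_distrib]
  congr 1
  refine Finset.sum_congr rfl fun i _ => ?_
  rw [← Finset.sum_add_distrib]
  refine Finset.sum_congr rfl fun j _ => ?_
  have h3 := szego_eq_add a (hz i) (hz j)
  rw [map_mul]
  linear_combination c i * conj (c j) * h3

theorem IsGAFLaw.lintegral_affMap {m : Measure (AnalyticFun disc)} [IsProbabilityMeasure m]
    (hm : IsGAFLaw m) (a : ℂ) {H : AnalyticFun disc → ℝ≥0∞} (hH : Measurable H) :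
    ∫⁻ f, H f ∂m = ∫⁻ ζ, ∫⁻ f, H (affMap a ζ f) ∂m ∂stdComplexGaussian := by
  conv_lhs => rw [← hm.map_affMap a]
  rw [lintegral_map hH (measurable_affMap_left a)]
  exact lintegral_prod _ (hH.comp (measurable_affMap_left a)).aemeasurable

attribute [irreducible] affMap mob

/-! ### Moments of complex Gaussian vectors and permanents -/

-- Such a σ carries each fibre of k onto the fibre of l over the same point, so fibre sizes must
-- agree. The solutions then form a coset of the stabilizer of l, a product of symmetric groups. The
-- factors on the right are exactly the Gaussian moments δ_{ab} a!.
open Equiv in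
theorem card_perm_comp_eq {ι κ : Type*} [Fintype ι] [DecidableEq ι] [Fintype κ] [DecidableEq κ]
    (k l : ι → κ) :
    (Finset.univ.filter fun σ : Perm ι => l ∘ σ = k).card =
      ∏ j, if Fintype.card {i // k i = j} = Fintype.card {i // l i = j} then
        (Fintype.card {i // k i = j}).factorial else 0 := by
  by_cases h : ∀ j, Fintype.card {i // k i = j} = Fintype.card {i // l i = j}
  · have e : ∀ j, {i // k i = j} ≃ {i // l i = j} := fun j => Fintype.equivOfCardEq (h j)
    set τ : Perm ι := Equiv.ofFiberEquiv e
    have hτ : l ∘ τ = k := funext fun i => Equiv.ofFiberEquiv_map e i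
    have h1 : (Finset.univ.filter fun σ : Perm ι => l ∘ σ = k).card =
        Fintype.card {g : Perm ι // l ∘ g = l} := by
      rw [Fintype.card_subtype]
      refine Finset.card_bij' (fun σ _ => σ * τ⁻¹) (fun g _ => g * τ) ?_ ?_ ?_ ?_
      · intro σ hσ
        simp only [Finset.mem_filter, Finset.mem_univ, true_and] at hσ ⊢
        rw [Perm.coe_mul, ← Function.comp_assoc, hσ, ← hτ, Function.comp_assoc, ← Perm.coe_mul,
          mul_inv_cancel, Perm.coe_one, Function.comp_id]
      · intro g hg
        simp only [Finset.mem_filter, Finset.mem_univ, true_and] at hg ⊢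
        rw [Perm.coe_mul, ← Function.comp_assoc, hg, hτ]
      · intro σ _; simp
      · intro g _; simp
    rw [h1, DomMulAct.stabilizer_card]
    exact Finset.prod_congr rfl fun j _ => by rw [if_pos (h j), h j]
  · obtain ⟨j, hj⟩ := not_forall.1 h
    rw [Finset.prod_eq_zero (Finset.mem_univ j) (if_neg hj), Finset.card_eq_zero,
      Finset.filter_eq_empty_iff]
    rintro σ - rfl
    exact hj (Fintype.card_congr (σ.subtypeEquiv fun i => Iff.rfl))

/-- The law of a finite family of independent standard complex Gaussian variables. -/
abbrev gaussVec (κ : Type*) [Fintype κ] : Measure (κ → ℂ) := Measure.pi fun _ => stdComplexGaussian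

theorem prod_comp_eq_prod_pow_card {ι κ : Type*} [Fintype ι] [Fintype κ] [DecidableEq κ]
    (k : ι → κ) (x : κ → ℂ) : ∏ i, x (k i) = ∏ j, x j ^ Fintype.card {i // k i = j} := by
  rw [← Finset.prod_fiberwise (s := Finset.univ) (g := k)]
  refine Finset.prod_congr rfl fun j _ => ?_
  rw [Finset.prod_congr rfl (g := fun _ => x j), Finset.prod_const, Fintype.card_subtype]
  intro i hi
  rw [(Finset.mem_filter.1 hi).2]

theorem prod_mul_conj_eq {ι κ : Type*} [Fintype ι] [Fintype κ] [DecidableEq κ]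
    (k l : ι → κ) (x : κ → ℂ) : ∏ i, (x (k i) * conj (x (l i))) =
      ∏ j, (x j ^ Fintype.card {i // k i = j} * conj (x j) ^ Fintype.card {i // l i = j}) := by
  rw [Finset.prod_mul_distrib, Finset.prod_mul_distrib, prod_comp_eq_prod_pow_card k x,
    prod_comp_eq_prod_pow_card l fun j => conj (x j)]

/-- Independence factors the integral into moments of single coordinates, whose factorials count the
pairings σ. -/
theorem integral_prod_mul_conj_gaussVec {ι κ : Type*} [Fintype ι] [DecidableEq ι] [Fintype κ]
    [DecidableEq κ] (k l : ι → κ) :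
    ∫ x, ∏ i, (x (k i) * conj (x (l i))) ∂gaussVec κ =
      ∑ σ : Equiv.Perm ι, if l ∘ σ = k then (1 : ℂ) else 0 := by
  simp_rw [prod_mul_conj_eq]
  rw [integral_fintype_prod_eq_prod (fun j w => w ^ Fintype.card {i // k i = j} *
    conj w ^ Fintype.card {i // l i = j})]
  simp_rw [integral_moment_stdComplexGaussian]
  rw [Finset.sum_boole, card_perm_comp_eq]
  push_cast
  rfl

theorem integrable_prod_mul_conj_gaussVec {ι κ : Type*} [Fintype ι] [Fintype κ]
    (k l : ι → κ) :
    Integrable (fun x : κ → ℂ => ∏ i, (x (k i) * conj (x (l i)))) (gaussVec κ) := by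
  classical
  simp_rw [prod_mul_conj_eq]
  exact Integrable.fintype_prod (f := fun j w => w ^ Fintype.card {i // k i = j} *
    conj w ^ Fintype.card {i // l i = j}) fun j => integrable_moment_stdComplexGaussian _ _

theorem prod_mulVec_mul_conj {ι κ : Type*} [Fintype ι] [DecidableEq ι] [Fintype κ]
    (A : Matrix ι κ ℂ) (x : κ → ℂ) :
    ∏ i, ((A.mulVec x) i * conj ((A.mulVec x) i)) =
      ∑ k : ι → κ, ∑ l : ι → κ, (∏ i, (A i (k i) * conj (A i (l i)))) *
        ∏ i, (x (k i) * conj (x (l i))) := by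
  have h : ∀ i, (A.mulVec x) i * conj ((A.mulVec x) i) =
      (∑ j, A i j * x j) * ∑ j, conj (A i j * x j) := by
    intro i
    rw [Matrix.mulVec, dotProduct, map_sum]
  simp_rw [h]
  rw [Finset.prod_mul_distrib, Finset.prod_univ_sum, Finset.prod_univ_sum, Finset.sum_mul_sum]
  simp only [Fintype.piFinset_univ]
  refine Finset.sum_congr rfl fun k _ => Finset.sum_congr rfl fun l _ => ?_
  rw [← Finset.prod_mul_distrib, ← Finset.prod_mul_distrib]
  refine Finset.prod_congr rfl fun i _ => ?_
  rw [map_mul]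
  ring

-- Expand every factor over the columns of A. Each pairing σ contracts the columns into ∏ (AAᴴ)_{σ
-- i, i}, and the sum over σ is the permanent.
open Matrix in
theorem integral_prod_mulVec_gaussVec {ι κ : Type*} [Fintype ι] [DecidableEq ι] [Fintype κ]
    (A : Matrix ι κ ℂ) :
    Integrable (fun x : κ → ℂ => ∏ i, ((A.mulVec x) i * conj ((A.mulVec x) i))) (gaussVec κ) ∧
    ∫ x, ∏ i, ((A.mulVec x) i * conj ((A.mulVec x) i)) ∂gaussVec κ =
      (A * Aᴴ).permanent := by
  classical
  have hint : ∀ k l : ι → κ, Integrable (fun x : κ → ℂ =>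
      (∏ i, (A i (k i) * conj (A i (l i)))) * ∏ i, (x (k i) * conj (x (l i)))) (gaussVec κ) :=
    fun k l => (integrable_prod_mul_conj_gaussVec k l).const_mul _
  simp_rw [prod_mulVec_mul_conj]
  refine ⟨integrable_finsetSum _ fun k _ => integrable_finsetSum _ fun l _ => hint k l, ?_⟩
  rw [integral_finsetSum _ fun k _ => integrable_finsetSum _ fun l _ => hint k l]
  have h1 : ∀ k : ι → κ, ∫ x, ∑ l : ι → κ, (∏ i, (A i (k i) * conj (A i (l i)))) *
      ∏ i, (x (k i) * conj (x (l i))) ∂gaussVec κ =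
      ∑ l : ι → κ, ∑ σ : Equiv.Perm ι,
        if l ∘ σ = k then ∏ i, (A i (k i) * conj (A i (l i))) else 0 := by
    intro k
    rw [integral_finsetSum _ fun l _ => hint k l]
    refine Finset.sum_congr rfl fun l _ => ?_
    rw [integral_const_mul, integral_prod_mul_conj_gaussVec, Finset.mul_sum]
    exact Finset.sum_congr rfl fun σ _ => by rw [mul_ite, mul_one, mul_zero]
  simp_rw [h1]
  rw [Finset.sum_comm]
  have h2 : ∀ l : ι → κ, (∑ k : ι → κ, ∑ σ : Equiv.Perm ι,
        if l ∘ σ = k then ∏ i, (A i (k i) * conj (A i (l i))) else 0) =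
      ∑ σ : Equiv.Perm ι, ∏ i, (A (σ i) (l i) * conj (A i (l i))) := by
    intro l
    -- Passing to σ⁻¹ moves the permutation from the choice of columns to the row index.
    rw [Finset.sum_comm, ← Equiv.sum_comp (Equiv.inv (Equiv.Perm ι))]
    refine Finset.sum_congr rfl fun σ _ => ?_
    rw [Finset.sum_ite_eq, if_pos (Finset.mem_univ _), Finset.prod_mul_distrib,
      Finset.prod_mul_distrib, ← Equiv.prod_comp σ]
    simp
  simp_rw [h2]
  rw [Finset.sum_comm, Matrix.permanent]
  refine Finset.sum_congr rfl fun σ _ => ?_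
  simp only [Matrix.mul_apply, Matrix.conjTranspose_apply]
  rw [Finset.prod_univ_sum, Fintype.piFinset_univ]
  rfl

/-- The Gram matrix of the Szegő kernel. -/
def szegoMatrix {ι : Type*} (z : ι → ℂ) : Matrix ι ι ℂ := Matrix.of fun i j => szego (z i) (z j)

theorem conj_szego (z w : ℂ) : conj (szego z w) = szego w z := by
  simp only [szego, map_div₀, map_sub, map_one, map_mul, Complex.conj_conj]
  rw [mul_comm]

-- The quadratic form of the Szegő matrix is ∑_k |∑_i conj(x_i) z_i^k|² ≥ 0, so a self-adjoint
-- square root serves as A.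
open scoped Matrix ComplexOrder MatrixOrder in
open Matrix in
theorem exists_szegoMatrix_eq {ι : Type*} [Fintype ι] (z : ι → ℂ) (hz : ∀ i, z i ∈ disc) :
    ∃ A : Matrix ι ι ℂ, szegoMatrix z = A * Aᴴ := by
  classical
  have hpos : (szegoMatrix z).PosSemidef := by
    refine PosSemidef.of_dotProduct_mulVec_nonneg ?_ fun x => ?_
    · ext i j
      exact conj_szego _ _
    · have h := hasSum_norm_sq_szego z (fun i => conj (x i)) hz
      have h1 : star x ⬝ᵥ (szegoMatrix z *ᵥ x) =
          ∑ i, ∑ j, conj (x i) * conj (conj (x j)) * szego (z i) (z j) := by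
        simp only [dotProduct, mulVec, Finset.mul_sum, szegoMatrix, of_apply, Pi.star_apply]
        refine Finset.sum_congr rfl fun i _ => Finset.sum_congr rfl fun j _ => ?_
        rw [Complex.conj_conj, RCLike.star_def]
        ring
      rw [h1]
      exact h.nonneg fun k => by rw [Complex.zero_le_real]; positivity
  obtain ⟨X, hX, -, hXX⟩ := CFC.exists_sqrt_of_isSelfAdjoint_of_quasispectrumRestricts
    hpos.isHermitian (QuasispectrumRestricts.nnreal_of_nonneg hpos.nonneg)
  refine ⟨X, ?_⟩
  have h2 : Xᴴ = X := hX
  rw [h2, hXX]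

theorem isIID_gaussVec (κ : Type*) [Fintype κ] :
    IsIIDStdComplexGaussian (gaussVec κ) fun (j : κ) (x : κ → ℂ) => x j :=
  ⟨fun j => measurable_pi_apply j, fun j => (measurePreserving_eval _ j).map_eq,
    iIndepFun_pi (X := fun _ w => w) fun _ => aemeasurable_id⟩

-- Both sides are centred complex Gaussian with covariance AAᴴ. This reduces moments of the values
-- of f to moments of i.i.d. coordinates.
open Matrix in
theorem IsGAFLaw.map_ev_eq {m : Measure (AnalyticFun disc)} [IsProbabilityMeasure m]
    (hm : IsGAFLaw m) {ι : Type} [Fintype ι] {z : ι → ℂ} (hz : ∀ i, z i ∈ disc)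
    {A : Matrix ι ι ℂ} (hA : szegoMatrix z = A * Aᴴ) :
    m.map (fun f i => ev f (z i)) = (gaussVec ι).map fun x => A.mulVec x := by
  have hev := measurable_ev_family z
  have hmul : Measurable fun x : ι → ℂ => A.mulVec x := by
    refine Continuous.measurable ?_
    fun_prop
  have := Measure.isProbabilityMeasure_map (μ := m) hev.aemeasurable
  have := Measure.isProbabilityMeasure_map (μ := gaussVec ι) hmul.aemeasurable
  refine ext_of_integral_cexp_re_sum fun c => ?_
  have hcont : Continuous fun x : ι → ℂ =>
      Complex.exp (Complex.I * ((∑ i, c i * x i).re : ℂ)) := by fun_prop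
  rw [integral_map hev.aemeasurable hcont.aestronglyMeasurable,
    integral_map hmul.aemeasurable hcont.aestronglyMeasurable, hm ι z c hz]
  have h1 := integral_cexp_re_sum_of_iid (isIID_gaussVec ι) fun j => ∑ i, c i * A i j
  have h2 : ∀ x : ι → ℂ, ∑ i, c i * (A.mulVec x) i = ∑ j, (∑ i, c i * A i j) * x j := by
    intro x
    simp only [mulVec, dotProduct, Finset.mul_sum, Finset.sum_mul]
    rw [Finset.sum_comm]
    simp only [mul_assoc]
  simp_rw [h2]
  rw [h1]
  congr 2
  have h3 : ∀ j, ((‖∑ i, c i * A i j‖ ^ 2 : ℝ) : ℂ) =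
      ∑ i, ∑ i', c i * conj (c i') * (A i j * conj (A i' j)) := by
    intro j
    push_cast
    rw [← Complex.mul_conj', map_sum, Finset.sum_mul_sum]
    refine Finset.sum_congr rfl fun i _ => Finset.sum_congr rfl fun i' _ => ?_
    rw [map_mul]
    ring
  simp_rw [h3]
  conv_rhs => rw [Finset.sum_comm]
  refine Finset.sum_congr rfl fun i _ => ?_
  conv_rhs => rw [Finset.sum_comm]
  refine Finset.sum_congr rfl fun i' _ => ?_
  have h4 : szego (z i) (z i') = (A * Aᴴ) i i' := by rw [← hA]; rfl
  rw [h4, Matrix.mul_apply, Finset.mul_sum]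
  rfl

/-- **Wick's formula** for the Gaussian analytic function. -/
theorem IsGAFLaw.integral_prod_ev {m : Measure (AnalyticFun disc)} [IsProbabilityMeasure m]
    (hm : IsGAFLaw m) {ι : Type} [Fintype ι] [DecidableEq ι] {z : ι → ℂ} (hz : ∀ i, z i ∈ disc) :
    Integrable (fun f => ∏ i, (ev f (z i) * conj (ev f (z i)))) m ∧
    ∫ f, ∏ i, (ev f (z i) * conj (ev f (z i))) ∂m = (szegoMatrix z).permanent := by
  obtain ⟨A, hA⟩ := exists_szegoMatrix_eq z hz
  have hmap := hm.map_ev_eq hz hA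
  have hev := measurable_ev_family z
  have hmul : Measurable fun x : ι → ℂ => A.mulVec x := by
    refine Continuous.measurable ?_
    fun_prop
  have hcont : Continuous fun x : ι → ℂ => ∏ i, (x i * conj (x i)) := by fun_prop
  obtain ⟨h1, h2⟩ := integral_prod_mulVec_gaussVec A
  have h3 : Integrable (fun x : ι → ℂ => ∏ i, (x i * conj (x i)))
      ((gaussVec ι).map fun x => A.mulVec x) :=
    (integrable_map_measure hcont.aestronglyMeasurable hmul.aemeasurable).2 h1
  rw [← hmap] at h3
  refine ⟨(integrable_map_measure hcont.aestronglyMeasurable hev.aemeasurable).1 h3, ?_⟩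
  rw [hA, ← h2, ← integral_map (f := fun x : ι → ℂ => ∏ i, (x i * conj (x i))) hev.aemeasurable
    hcont.aestronglyMeasurable, hmap, integral_map hmul.aemeasurable hcont.aestronglyMeasurable]

theorem IsGAFLaw.lintegral_prod_ev {m : Measure (AnalyticFun disc)} [IsProbabilityMeasure m]
    (hm : IsGAFLaw m) {ι : Type} [Fintype ι] [DecidableEq ι] {z : ι → ℂ} (hz : ∀ i, z i ∈ disc) :
    ∃ p : ℝ, 0 ≤ p ∧ (p : ℂ) = (szegoMatrix z).permanent ∧
      ∫⁻ f, ∏ i, ENNReal.ofReal (‖ev f (z i)‖ ^ 2) ∂m = ENNReal.ofReal p := by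
  obtain ⟨h1, h2⟩ := hm.integral_prod_ev hz
  have h3 : ∀ f : AnalyticFun disc, ∏ i, (ev f (z i) * conj (ev f (z i))) =
      ((∏ i, ‖ev f (z i)‖ ^ 2 : ℝ) : ℂ) := by
    intro f
    push_cast
    exact Finset.prod_congr rfl fun i _ => Complex.mul_conj' _
  simp_rw [h3] at h1 h2
  rw [integral_complex_ofReal] at h2
  have h4 : ∀ f : AnalyticFun disc, 0 ≤ ∏ i, ‖ev f (z i)‖ ^ 2 :=
    fun f => Finset.prod_nonneg fun i _ => by positivity
  refine ⟨_, integral_nonneg h4, h2, ?_⟩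
  have h5 : Integrable (fun f => ∏ i, ‖ev f (z i)‖ ^ 2) m := by
    have := h1.re
    simpa only [RCLike.re_eq_complex_re, Complex.ofReal_re] using this
  rw [ofReal_integral_eq_lintegral_ofReal h5 (Filter.Eventually.of_forall h4)]
  refine lintegral_congr fun f => ?_
  rw [ENNReal.ofReal_prod_of_nonneg fun i _ => by positivity]

/-! ### Borchardt's identity -/

section Borchardt

open Equiv

variable {F : Type*} [Field F] {n : ℕ}

/-- The coefficient of `M 0 j` in `∑ σ, ε σ * ∏ i, M i (σ i)`. -/
def rowCoeff (ε : Perm (Fin (n + 1)) → F) (M : Matrix (Fin (n + 1)) (Fin (n + 1)) F)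
    (j : Fin (n + 1)) : F :=
  ∑ σ, if σ 0 = j then ε σ * ∏ i : Fin n, M i.succ (σ i.succ) else 0

theorem sum_perm_eq_sum_rowCoeff (ε : Perm (Fin (n + 1)) → F)
    (M : Matrix (Fin (n + 1)) (Fin (n + 1)) F) :
    ∑ σ, ε σ * ∏ i, M i (σ i) = ∑ j, M 0 j * rowCoeff ε M j := by
  simp only [rowCoeff, Finset.mul_sum, mul_ite, mul_zero]
  rw [Finset.sum_comm]
  refine Finset.sum_congr rfl fun σ _ => ?_
  rw [Finset.sum_ite_eq, if_pos (Finset.mem_univ _), Fin.prod_univ_succ]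
  ring

theorem det_eq_sum_row {m : ℕ} (M : Matrix (Fin m) (Fin m) F) :
    M.det = ∑ σ : Perm (Fin m), ((Perm.sign σ : ℤ) : F) * ∏ i, M i (σ i) := by
  rw [← Matrix.det_transpose, Matrix.det_apply']
  rfl

theorem permanent_eq_sum_row {m : ℕ} (M : Matrix (Fin m) (Fin m) F) :
    M.permanent = ∑ σ : Perm (Fin m), ∏ i, M i (σ i) := by
  rw [← Matrix.permanent_transpose, Matrix.permanent]
  rfl

/-- The columns other than `j`. -/
def minorCol (j : Fin (n + 1)) (i : Fin n) : Fin (n + 1) := swap 0 j i.succ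

theorem minorCol_injective (j : Fin (n + 1)) : Function.Injective (minorCol j) :=
  (swap 0 j).injective.comp (Fin.succ_injective n)

/-- A permutation is encoded by the image j of 0 and a permutation e of the remaining columns as
listed by `minorCol j`. That list need not be increasing, which is why the sign in `rowCoeff_sign`
is −1 for every j ≠ 0 instead of alternating. -/
theorem rowCoeff_eq (ε : Perm (Fin (n + 1)) → F) (M : Matrix (Fin (n + 1)) (Fin (n + 1)) F)
    (j : Fin (n + 1)) :
    rowCoeff ε M j = ∑ e : Perm (Fin n), ε (Perm.decomposeFin.symm (j, e)) *
      ∏ i : Fin n, M i.succ (minorCol j (e i)) := by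
  rw [rowCoeff, ← Equiv.sum_comp Perm.decomposeFin.symm, Fintype.sum_prod_type,
    Finset.sum_eq_single j]
  · refine Finset.sum_congr rfl fun e _ => ?_
    rw [if_pos (Perm.decomposeFin_symm_apply_zero j e)]
    simp only [Perm.decomposeFin_symm_apply_succ, minorCol]
  · intro p _ hp
    exact Finset.sum_eq_zero fun e _ => if_neg (by rwa [Perm.decomposeFin_symm_apply_zero])
  · intro h; exact absurd (Finset.mem_univ _) h

theorem rowCoeff_one (M : Matrix (Fin (n + 1)) (Fin (n + 1)) F) (j : Fin (n + 1)) :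
    rowCoeff (fun _ => 1) M j = (M.submatrix Fin.succ (minorCol j)).permanent := by
  simp only [rowCoeff_eq, permanent_eq_sum_row, one_mul, Matrix.submatrix_apply]

theorem rowCoeff_sign (M : Matrix (Fin (n + 1)) (Fin (n + 1)) F) (j : Fin (n + 1)) :
    rowCoeff (fun σ => ((Perm.sign σ : ℤ) : F)) M j =
      (if j = 0 then 1 else -1) * (M.submatrix Fin.succ (minorCol j)).det := by
  simp only [rowCoeff_eq, det_eq_sum_row, Finset.mul_sum, Matrix.submatrix_apply,
    Perm.decomposeFin.symm_sign]
  refine Finset.sum_congr rfl fun e _ => ?_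
  split_ifs <;> simp

/-- Composing with the transposition of j and k exchanges the permutations sending 0 to j with those
sending 0 to k. The factor δ is −1 for the determinant and 1 for the permanent. -/
theorem rowCoeff_reroute {ε : Perm (Fin (n + 1)) → F} {δ : F}
    (hε : ∀ j k, j ≠ k → ∀ σ, ε (swap j k * σ) = δ * ε σ)
    (M : Matrix (Fin (n + 1)) (Fin (n + 1)) F) {j k : Fin (n + 1)} (hjk : j ≠ k) :
    rowCoeff ε M k = δ * ∑ σ : Perm (Fin (n + 1)), if σ 0 = j then
      ε σ * ∏ i : Fin n, M i.succ (swap j k (σ i.succ)) else 0 := by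
  rw [rowCoeff, ← Equiv.sum_comp (Equiv.mulLeft (swap j k)), Finset.mul_sum]
  refine Finset.sum_congr rfl fun σ _ => ?_
  simp only [Equiv.coe_mulLeft, Perm.mul_apply, hε j k hjk]
  have : swap j k (σ 0) = k ↔ σ 0 = j := by
    rw [swap_apply_eq_iff, swap_apply_right]
  simp only [this, mul_ite, mul_zero, mul_assoc]

/-- The Cauchy-type matrix `1 / (1 - x_i y_j)`. -/
def cauchyMat {m : ℕ} (x y : Fin m → F) : Matrix (Fin m) (Fin m) F :=
  Matrix.of fun i j => 1 / (1 - x i * y j)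

/-- Every k ≠ j is the column of exactly one later row i, and the swap changes only that row's
factor, from 1/(1 − x_i y_k) to 1/(1 − x_i y_j). The term k = j vanishes by the convention 1/0 = 0,
and the others are an identity of partial fractions. -/
theorem sum_prod_swap {x y : Fin (n + 1) → F} (hxy : ∀ i j, 1 - x i * y j ≠ 0)
    (hy : Function.Injective y) {j : Fin (n + 1)} {σ : Perm (Fin (n + 1))} (hσ : σ 0 = j) :
    ∑ k, 1 / (y j - y k) * ∏ i : Fin n, cauchyMat x y i.succ (swap j k (σ i.succ)) =
      (∏ i : Fin n, cauchyMat x y i.succ (σ i.succ)) *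
        (∑ k, 1 / (y j - y k) + ∑ i : Fin n, x i.succ / (1 - x i.succ * y j)) := by
  rw [← Equiv.sum_comp σ, ← Equiv.sum_comp σ (fun k => 1 / (y j - y k)), Fin.sum_univ_succ,
    Fin.sum_univ_succ, hσ, sub_self, div_zero, zero_mul, zero_add, zero_add,
    ← Finset.sum_add_distrib, Finset.mul_sum]
  refine Finset.sum_congr rfl fun i _ => ?_
  have hne : σ i.succ ≠ j := by
    rw [← hσ]
    exact fun h => Fin.succ_ne_zero i (σ.injective h)
  have h1 : ∏ i' : Fin n, cauchyMat x y i'.succ (swap j (σ i.succ) (σ i'.succ)) =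
      cauchyMat x y i.succ j *
        ∏ i' ∈ Finset.univ.erase i, cauchyMat x y i'.succ (σ i'.succ) := by
    rw [← Finset.mul_prod_erase _ _ (Finset.mem_univ i), swap_apply_right]
    congr 1
    refine Finset.prod_congr rfl fun i' hi' => ?_
    rw [swap_apply_of_ne_of_ne]
    · rw [← hσ]
      exact fun h => Fin.succ_ne_zero i' (σ.injective h)
    · exact fun h => (Finset.mem_erase.1 hi').1 (Fin.succ_injective _ (σ.injective h))
  rw [h1, ← Finset.mul_prod_erase _ _ (Finset.mem_univ i)]
  have h2 : y j - y (σ i.succ) ≠ 0 := sub_ne_zero.2 fun h => hne (hy h).symm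
  have h3 := hxy i.succ j
  have h4 := hxy i.succ (σ i.succ)
  generalize ∏ i' ∈ Finset.univ.erase i, cauchyMat x y i'.succ (σ i'.succ) = p
  simp only [cauchyMat, Matrix.of_apply]
  generalize x i.succ = a at *
  generalize y j = b at *
  generalize y (σ i.succ) = c at *
  have e : 1 / (b - c) + a / (1 - a * b) = (1 - a * c) / ((b - c) * (1 - a * b)) := by
    rw [div_add_div _ _ h2 h3]
    congr 1
    ring
  have e2 : 1 / (1 - a * c) * (1 - a * c) = 1 := one_div_mul_cancel h4
  rw [e, div_eq_mul_one_div (1 - a * c), ← one_div_mul_one_div]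
  linear_combination -(1 / (b - c) * (1 / (1 - a * b)) * p) * e2

/-- The bracket of `sum_prod_swap` does not depend on σ once σ 0 = j, so it factors out. Determinant
and permanent share it up to the sign δ, and this opposition of signs is what makes Borchardt's
identity work. -/
theorem sum_rowCoeff_div {ε : Perm (Fin (n + 1)) → F} {δ : F}
    (hε : ∀ j k, j ≠ k → ∀ σ, ε (swap j k * σ) = δ * ε σ)
    {x y : Fin (n + 1) → F} (hxy : ∀ i j, 1 - x i * y j ≠ 0)
    (hy : Function.Injective y) (j : Fin (n + 1)) :
    ∑ k, 1 / (y j - y k) * rowCoeff ε (cauchyMat x y) k =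
      δ * rowCoeff ε (cauchyMat x y) j *
        (∑ k, 1 / (y j - y k) + ∑ i : Fin n, x i.succ / (1 - x i.succ * y j)) := by
  have h1 : ∀ k, 1 / (y j - y k) * rowCoeff ε (cauchyMat x y) k =
      1 / (y j - y k) * (δ * ∑ σ : Perm (Fin (n + 1)), if σ 0 = j then
      ε σ * ∏ i : Fin n, cauchyMat x y i.succ (swap j k (σ i.succ)) else 0) := by
    intro k
    by_cases hk : j = k
    · rw [hk, sub_self, div_zero, zero_mul, zero_mul]
    · rw [rowCoeff_reroute hε _ hk]
  simp_rw [h1, mul_left_comm _ δ]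
  rw [← Finset.mul_sum, mul_assoc]
  congr 1
  simp_rw [Finset.mul_sum]
  rw [Finset.sum_comm, rowCoeff, Finset.sum_mul]
  refine Finset.sum_congr rfl fun σ _ => ?_
  split_ifs with hσ
  · simp_rw [mul_left_comm _ (ε σ)]
    rw [← Finset.mul_sum, sum_prod_swap hxy hy hσ, mul_assoc]
  · simp

/-- Expand determinant and permanent along row 0 with coefficients D_j and Q_k. By induction the
diagonal terms of the product are the expansion of the determinant of squares. Off the diagonal,
C_{0j} C_{0k} = (y_j C_{0j} − y_k C_{0k})/(y_j − y_k), and by `sum_rowCoeff_div` the resulting sums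
contribute ∓ y_j C_{0j} D_j Q_j R_j, which cancel. -/
theorem det_mul_permanent_cauchyMat_of_injective {m : ℕ} {x y : Fin m → F}
    (hxy : ∀ i j, 1 - x i * y j ≠ 0) (hy : Function.Injective y) :
    (cauchyMat x y).det * (cauchyMat x y).permanent =
      (Matrix.of fun i j => cauchyMat x y i j ^ 2).det := by
  induction m with
  | zero => simp [Matrix.permanent_isEmpty]
  | succ n ih =>
    set C := cauchyMat x y
    set D := rowCoeff (fun σ => ((Perm.sign σ : ℤ) : F)) C
    set Q := rowCoeff (fun _ => (1 : F)) C
    set R : Fin (n + 1) → F := fun j =>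
      ∑ k, 1 / (y j - y k) + ∑ i : Fin n, x i.succ / (1 - x i.succ * y j)
    have hD : ∀ j, ∑ k, 1 / (y j - y k) * D k = -1 * D j * R j :=
      sum_rowCoeff_div (fun j k hjk σ => by rw [Perm.sign_mul, Perm.sign_swap hjk]; simp) hxy hy
    have hQ : ∀ j, ∑ k, 1 / (y j - y k) * Q k = 1 * Q j * R j :=
      sum_rowCoeff_div (fun j k hjk σ => by simp) hxy hy
    have hdet : C.det = ∑ j, C 0 j * D j := by
      rw [det_eq_sum_row, sum_perm_eq_sum_rowCoeff]
    have hperm : C.permanent = ∑ j, C 0 j * Q j := by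
      rw [← sum_perm_eq_sum_rowCoeff, permanent_eq_sum_row]
      simp only [one_mul]
    have hsq : (Matrix.of fun i j => C i j ^ 2).det = ∑ j, C 0 j ^ 2 * (D j * Q j) := by
      rw [det_eq_sum_row, sum_perm_eq_sum_rowCoeff]
      refine Finset.sum_congr rfl fun j _ => ?_
      rw [rowCoeff_sign]
      have h1 := ih (x := x ∘ Fin.succ) (y := y ∘ minorCol j) (fun i k => hxy _ _)
        (hy.comp (minorCol_injective j))
      simp only [D, Q, rowCoeff_sign, rowCoeff_one, mul_assoc]
      congr 2
      exact h1.symm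
    have hCC : ∀ j k, C 0 j * C 0 k = (if j = k then C 0 j ^ 2 else 0) +
        (1 / (y j - y k) * (y j * C 0 j) + 1 / (y k - y j) * (y k * C 0 k)) := by
      intro j k
      split_ifs with hjk
      · subst hjk
        simp [sq]
      · have h1 : y j - y k ≠ 0 := sub_ne_zero.2 fun h => hjk (hy h)
        have h2 : y k - y j ≠ 0 := sub_ne_zero.2 fun h => hjk (hy h).symm
        have h3 := hxy 0 j
        have h4 := hxy 0 k
        have h5 : y k - y j = -(y j - y k) := by ring
        simp only [C, cauchyMat, Matrix.of_apply]
        rw [h5]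
        field_simp
        ring
    rw [hdet, hperm, hsq, Finset.sum_mul_sum]
    have h1 : ∀ j k, C 0 j * D j * (C 0 k * Q k) = (if j = k then C 0 j ^ 2 * (D j * Q k) else 0) +
        (y j * C 0 j * D j * (1 / (y j - y k) * Q k) +
          y k * C 0 k * Q k * (1 / (y k - y j) * D j)) := by
      intro j k
      have := hCC j k
      split_ifs at this ⊢
      · linear_combination D j * Q k * this
      · linear_combination D j * Q k * this
    simp_rw [h1, Finset.sum_add_distrib]
    rw [Finset.sum_comm (f := fun j k => y k * C 0 k * Q k * (1 / (y k - y j) * D j))]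
    simp_rw [← Finset.mul_sum, hD, hQ]
    simp only [Finset.sum_ite_eq, Finset.mem_univ, if_true]
    rw [add_eq_left, ← Finset.sum_add_distrib]
    refine Finset.sum_eq_zero fun j _ => ?_
    ring

/-- **Borchardt's identity**. -/
theorem det_mul_permanent_cauchyMat {m : ℕ} {x y : Fin m → F} (hxy : ∀ i j, 1 - x i * y j ≠ 0) :
    (cauchyMat x y).det * (cauchyMat x y).permanent =
      (Matrix.of fun i j => cauchyMat x y i j ^ 2).det := by
  by_cases hy : Function.Injective y
  · exact det_mul_permanent_cauchyMat_of_injective hxy hy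
  · obtain ⟨j, k, hjk, hne⟩ : ∃ j k, y j = y k ∧ j ≠ k := by
      simpa [Function.Injective] using hy
    rw [Matrix.det_zero_of_column_eq hne fun i => by simp [cauchyMat, hjk],
      Matrix.det_zero_of_column_eq hne fun i => by simp [cauchyMat, hjk], zero_mul]

end Borchardt

/-! ### Determinants of the Bergman and Szegő kernels -/

theorem det_bergmanKernel {n : ℕ} {z : Fin n → ℂ} (hz : ∀ i, z i ∈ disc) :
    (Matrix.of fun i j => bergmanKernel (z i) (z j)).det =
      (1 / Real.pi : ℂ) ^ n * ((szegoMatrix z).det * (szegoMatrix z).permanent) := by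
  have h1 : szegoMatrix z = cauchyMat z fun j => conj (z j) := rfl
  have h2 : (Matrix.of fun i j => bergmanKernel (z i) (z j)) =
      (1 / Real.pi : ℂ) • Matrix.of fun i j => cauchyMat z (fun j => conj (z j)) i j ^ 2 := by
    ext i j
    simp only [bergmanKernel, Matrix.of_apply, Matrix.smul_apply, cauchyMat, smul_eq_mul]
    rw [div_pow, one_pow, div_mul_div_comm, one_mul]
  rw [h1, det_mul_permanent_cauchyMat fun i j => one_sub_mul_conj_ne_zero (hz i) (hz j), h2,
    Matrix.det_smul, Fintype.card_fin]

theorem szego_ne_zero {z w : ℂ} (hz : z ∈ disc) (hw : w ∈ disc) : szego z w ≠ 0 :=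
  one_div_ne_zero (one_sub_mul_conj_ne_zero hz hw)

theorem szego_self {z : ℂ} : szego z z = ((1 / (1 - ‖z‖ ^ 2) : ℝ) : ℂ) := by
  rw [szego, Complex.mul_conj']
  push_cast
  rfl

theorem nker_mul_conj_nker {a z w : ℂ} (ha : a ∈ disc) :
    nker a z * conj (nker a w) = szego z a * szego a w / szego a a := by
  have h4 : ((Real.sqrt (1 - ‖a‖ ^ 2) : ℝ) : ℂ) * (Real.sqrt (1 - ‖a‖ ^ 2) : ℂ) =
      1 - a * conj a := by
    rw [← Complex.ofReal_mul, Real.mul_self_sqrt (one_sub_norm_sq_pos ha).le, Complex.mul_conj']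
    push_cast; rfl
  rw [nker, nker, clip_of_mem ha, map_div₀, Complex.conj_ofReal, div_mul_div_comm, h4]
  simp only [szego, map_sub, map_one, map_mul, Complex.conj_conj]
  rw [div_mul_div_comm, div_div_eq_mul_div, div_one, one_mul, one_div_mul_eq_div, mul_comm a (conj w)]

/-- Eliminating column 0 leaves the Schur complement S(y_i,y_j) − S(y_i,x) S(x,y_j)/S(x,x), which
`szego_eq_add` at a = x factors as φ_x(y_i) conj φ_x(y_j) S(y_i,y_j). -/
theorem det_szegoMatrix_cons {n : ℕ} {x : ℂ} {y : Fin n → ℂ} (hx : x ∈ disc)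
    (hy : ∀ i, y i ∈ disc) :
    (szegoMatrix (Fin.cons x y : Fin (n + 1) → ℂ)).det =
      szego x x * (∏ i, mob x (y i) * conj (mob x (y i))) * (szegoMatrix y).det := by
  set z : Fin (n + 1) → ℂ := Fin.cons x y
  set M := szegoMatrix z
  have hxx := szego_ne_zero hx hx
  set B : Matrix (Fin (n + 1)) (Fin (n + 1)) ℂ := Matrix.of fun i j =>
    M i j - (Fin.cons 0 (fun i => szego (y i) x / szego x x) : Fin (n + 1) → ℂ) i * M 0 j
  have hM0 : M 0 0 = szego x x := rfl
  have hdet : M.det = B.det := by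
    refine Matrix.det_eq_of_forall_row_eq_smul_add_const
      (Fin.cons 0 (fun i => szego (y i) x / szego x x)) 0 (by simp) fun i j => ?_
    simp [B]
  have hB0 : ∀ i : Fin n, B i.succ 0 = 0 := by
    intro i
    have : M i.succ 0 = szego (y i) x := rfl
    simp only [B, Matrix.of_apply, Fin.cons_succ, hM0, this]
    rw [div_mul_cancel₀ _ hxx, sub_self]
  rw [hdet, Matrix.det_succ_column_zero, Fin.sum_univ_succ]
  simp only [hB0, mul_zero, zero_mul, Finset.sum_const_zero, add_zero]
  have hB00 : B 0 0 = szego x x := by simp [B, hM0]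
  have hminor : B.submatrix (Fin.succAbove 0) Fin.succ = Matrix.of fun i j =>
      mob x (y i) * (Matrix.of fun i j => conj (mob x (y j)) * szegoMatrix y i j) i j := by
    ext i j
    have h1 : M i.succ j.succ = szego (y i) (y j) := rfl
    have h2 : M 0 j.succ = szego x (y j) := rfl
    have h3 : szegoMatrix y i j = szego (y i) (y j) := rfl
    have h4 := szego_eq_add x (hy i) (hy j)
    rw [nker_mul_conj_nker hx] at h4
    simp only [Matrix.submatrix_apply, Fin.succAbove_zero, B, Matrix.of_apply, Fin.cons_succ, h1,
      h2, h3]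
    linear_combination -h4
  rw [hB00, hminor, Matrix.det_mul_column, Matrix.det_mul_row, Finset.prod_mul_distrib]
  simp
  ring

/-! ### The point process of zeros -/

/-- `f` is not identically zero. -/
def IsNontrivial (f : AnalyticFun disc) : Prop := ∃ w ∈ disc, ev f w ≠ 0

/-- The zeros of `f`, with the convention that the zero function has none. -/
def zeros (f : AnalyticFun disc) : Set ℂ := {z | z ∈ disc ∧ ev f z = 0 ∧ IsNontrivial f}

theorem zeros_subset (f : AnalyticFun disc) : zeros f ⊆ disc := fun _ h => h.1

theorem zeroSet_eq_zeros {f : AnalyticFun disc} (h : IsNontrivial f) : zeroSet f = zeros f := by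
  ext z
  constructor
  · rintro ⟨hz, h0⟩
    exact ⟨hz, by rw [ev_of_mem f hz, h0], h⟩
  · rintro ⟨hz, h0, -⟩
    exact ⟨hz, by rwa [ev_of_mem f hz] at h0⟩

theorem analyticOnNhd_ev (f : AnalyticFun disc) : AnalyticOnNhd ℂ (ev f) disc :=
  (differentiableOn_ev f).analyticOnNhd Metric.isOpen_ball

theorem isPreconnected_disc : IsPreconnected disc := (convex_ball (0 : ℂ) 1).isPreconnected

/-- Otherwise zeros accumulate inside the disc and f vanishes identically, a case excluded by the
convention in `zeros`. -/
theorem finite_zeros_inter (f : AnalyticFun disc) {K : Set ℂ} (hK : IsCompact K) (hKd : K ⊆ disc) :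
    (zeros f ∩ K).Finite := by
  by_contra hinf
  obtain ⟨x, hxK, hx⟩ := Set.Infinite.exists_accPt_of_subset_isCompact hinf hK inter_subset_right
  rw [accPt_iff_frequently_nhdsNE] at hx
  obtain ⟨y, hy⟩ := Set.Infinite.nonempty hinf
  obtain ⟨w, hw, hne⟩ := hy.1.2.2
  exact hne ((analyticOnNhd_ev f).eqOn_zero_of_preconnected_of_frequently_eq_zero
    isPreconnected_disc (hKd hxK) (hx.mono fun y hy => hy.1.2.1) hw)

theorem measurableSet_isNontrivial : MeasurableSet {f : AnalyticFun disc | IsNontrivial f} := by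
  have : {f : AnalyticFun disc | IsNontrivial f} = ⋃ w : disc, {f | f.1 w ≠ 0} := by
    ext f
    simp only [mem_ofPred_eq, mem_iUnion, IsNontrivial]
    constructor
    · rintro ⟨w, hw, h⟩
      exact ⟨⟨w, hw⟩, by rwa [ev_of_mem f hw] at h⟩
    · rintro ⟨w, h⟩
      exact ⟨w, w.2, by rwa [ev_of_mem f w.2]⟩
  rw [this]
  refine (isOpen_iUnion fun w => ?_).measurableSet
  exact isOpen_ne_fun ((continuous_eval_const (F := C(disc, ℂ)) w).comp continuous_subtype_val)
    continuous_const

/-- Having no zero on a compact set is an open condition for locally uniform convergence. -/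
theorem measurableSet_zeros_inter_nonempty {K : Set ℂ} (hK : IsCompact K) (hKd : K ⊆ disc) :
    MeasurableSet {f : AnalyticFun disc | (zeros f ∩ K).Nonempty} := by
  have hK' : IsCompact ((↑) ⁻¹' K : Set disc) := by
    refine Topology.IsInducing.subtypeVal.isCompact_preimage' hK ?_
    rwa [Subtype.range_coe]
  have hopen := ((ContinuousMap.isOpen_setOfPred_mapsTo hK'
    (isOpen_compl_singleton (x := (0 : ℂ)))).preimage
    (continuous_subtype_val (p := fun f : C(disc, ℂ) => ∃ F : ℂ → ℂ, AnalyticOnNhd ℂ F disc ∧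
      ∀ z : disc, F z = f z))).measurableSet
  have : {f : AnalyticFun disc | (zeros f ∩ K).Nonempty} =
      {f : AnalyticFun disc | IsNontrivial f} ∩
        {f : AnalyticFun disc | MapsTo f.1 ((↑) ⁻¹' K : Set disc) {0}ᶜ}ᶜ := by
    ext f
    simp only [mem_ofPred_eq, mem_inter_iff, mem_compl_iff]
    constructor
    · rintro ⟨z, ⟨hz, h0, hn⟩, hzK⟩
      refine ⟨hn, fun h => h (x := ⟨z, hz⟩) hzK ?_⟩
      rw [mem_singleton_iff, ← ev_of_mem f hz, h0]
    · rintro ⟨hn, h⟩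
      simp only [MapsTo, mem_compl_iff, mem_singleton_iff, not_forall, not_not] at h
      obtain ⟨z, hzK, h0⟩ := h
      exact ⟨z, ⟨z.2, by rw [ev_of_mem f z.2]; exact h0, hn⟩, hzK⟩
  rw [this]
  exact measurableSet_isNontrivial.inter hopen.compl

/-- The closed balls with centre in a countable dense set and radius `1 / (m + 1)`. -/
def ratBall (p : ℕ × ℕ) : Set ℂ :=
  Metric.closedBall (TopologicalSpace.denseSeq ℂ p.1) (1 / ((p.2 : ℝ) + 1))

theorem exists_ratBall_disjoint {n : ℕ} {x : Fin n → ℂ} (hx : Function.Injective x) :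
    ∃ b : Fin n → ℕ × ℕ, (∀ i j, i ≠ j → Disjoint (ratBall (b i)) (ratBall (b j))) ∧
      ∀ i, x i ∈ ratBall (b i) := by
  have h1 : ∀ᶠ m : ℕ in Filter.atTop, ∀ i j, i ≠ j → 4 * (1 / ((m : ℝ) + 1)) < dist (x i) (x j) := by
    simp only [Filter.eventually_all]
    intro i j hij
    have hpos : 0 < dist (x i) (x j) := dist_pos.2 (hx.ne hij)
    have := (tendsto_one_div_add_atTop_nhds_zero_nat (𝕜 := ℝ)).const_mul 4
    rw [mul_zero] at this
    exact this.eventually_lt_const hpos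
  obtain ⟨m, hm⟩ := h1.exists
  have hr : (0 : ℝ) < 1 / ((m : ℝ) + 1) := by positivity
  have h2 : ∀ i, ∃ k, dist (x i) (TopologicalSpace.denseSeq ℂ k) < 1 / ((m : ℝ) + 1) := fun i => by
    exact Metric.denseRange_iff.1 (TopologicalSpace.denseRange_denseSeq ℂ) (x i) _ hr
  choose k hk using h2
  refine ⟨fun i => (k i, m), fun i j hij => Set.disjoint_left.2 fun p hp hq => ?_, fun i => (hk i).le⟩
  have h3 : dist p (TopologicalSpace.denseSeq ℂ (k i)) ≤ 1 / ((m : ℝ) + 1) := hp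
  have h4 : dist p (TopologicalSpace.denseSeq ℂ (k j)) ≤ 1 / ((m : ℝ) + 1) := hq
  have h5 := dist_triangle4 (x i) (TopologicalSpace.denseSeq ℂ (k i)) p (x j)
  have h6 := dist_triangle p (TopologicalSpace.denseSeq ℂ (k j)) (x j)
  have := hm i j hij
  have := hk i
  have := hk j
  rw [dist_comm (TopologicalSpace.denseSeq ℂ (k i)) p] at h5
  rw [dist_comm (TopologicalSpace.denseSeq ℂ (k j)) (x j)] at h6
  linarith

theorem le_encard_iff {α : Type*} {s : Set α} {n : ℕ} :
    (n : ℕ∞) ≤ s.encard ↔ ∃ x : Fin n → α, Function.Injective x ∧ ∀ i, x i ∈ s := by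
  constructor
  · intro h
    obtain ⟨t, hts, ht⟩ := Set.exists_subset_encard_eq h
    have htf : t.Finite := Set.finite_of_encard_eq_coe ht
    have hc : Nat.card t = n := by
      rw [Nat.card_coe_set_eq, Set.ncard_def, ht, ENat.toNat_natCast]
    have := htf.to_subtype
    let e : Fin n ≃ t := (Finite.equivFinOfCardEq hc).symm
    exact ⟨fun i => e i, Subtype.val_injective.comp e.injective, fun i => hts (e i).2⟩
  · rintro ⟨x, hx, hxs⟩
    have h1 : (range x).encard = n := by
      rw [← image_univ, hx.encard_image, encard_univ]
      simp
    rw [← h1]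
    exact Set.encard_le_encard (range_subset_iff.2 hxs)

/-- At least n zeros lie in K exactly when n pairwise disjoint balls of a countable family each meet
the zeros in K, which reduces counting to hitting events. -/
theorem measurableSet_le_encard_zeros {K : Set ℂ} (hK : IsCompact K) (hKd : K ⊆ disc) (n : ℕ) :
    MeasurableSet {f : AnalyticFun disc | (n : ℕ∞) ≤ (zeros f ∩ K).encard} := by
  have : {f : AnalyticFun disc | (n : ℕ∞) ≤ (zeros f ∩ K).encard} =
      ⋃ b : {b : Fin n → ℕ × ℕ // ∀ i j, i ≠ j → Disjoint (ratBall (b i)) (ratBall (b j))},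
        ⋂ i, {f : AnalyticFun disc | (zeros f ∩ (K ∩ ratBall (b.1 i))).Nonempty} := by
    ext f
    simp only [mem_ofPred_eq, mem_iUnion, mem_iInter, le_encard_iff]
    constructor
    · rintro ⟨x, hx, hxs⟩
      obtain ⟨b, hb, hxb⟩ := exists_ratBall_disjoint hx
      exact ⟨⟨b, hb⟩, fun i => ⟨x i, (hxs i).1, (hxs i).2, hxb i⟩⟩
    · rintro ⟨b, hb⟩
      choose x hx using hb
      refine ⟨x, fun i j hij => ?_, fun i => ⟨(hx i).1, (hx i).2.1⟩⟩
      by_contra hne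
      refine Set.disjoint_left.1 (b.2 i j hne) (hx i).2.2 ?_
      rw [hij]
      exact (hx j).2.2
  rw [this]
  exact MeasurableSet.iUnion fun b => MeasurableSet.iInter fun i =>
    measurableSet_zeros_inter_nonempty (hK.inter (isCompact_closedBall _ _))
      (inter_subset_left.trans hKd)

theorem measurable_encard_zeros {K : Set ℂ} (hK : IsCompact K) (hKd : K ⊆ disc) :
    Measurable fun f : AnalyticFun disc => (zeros f ∩ K).encard := by
  refine ENat.measurable_iff.2 fun n => ?_
  have : (fun f : AnalyticFun disc => (zeros f ∩ K).encard) ⁻¹' {(n : ℕ∞)} =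
      {f : AnalyticFun disc | (n : ℕ∞) ≤ (zeros f ∩ K).encard} \
        {f : AnalyticFun disc | ((n + 1 : ℕ) : ℕ∞) ≤ (zeros f ∩ K).encard} := by
    ext f
    simp only [mem_preimage, mem_singleton_iff, mem_sdiff, mem_ofPred_eq, not_le]
    push_cast
    rw [ENat.lt_add_one_iff (ENat.natCast_ne_top n)]
    exact ⟨fun h => ⟨h.ge, h.le⟩, fun h => le_antisymm h.2 h.1⟩
  rw [this]
  exact (measurableSet_le_encard_zeros hK hKd n).diff (measurableSet_le_encard_zeros hK hKd (n + 1))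

/-- The counting measure of the zeros. -/
def zeroMeasure (f : AnalyticFun disc) : Measure ℂ :=
  Measure.sum fun x : zeros f => Measure.dirac (x : ℂ)

theorem lintegral_zeroMeasure (f : AnalyticFun disc) (h : ℂ → ℝ≥0∞) :
    ∫⁻ x, h x ∂zeroMeasure f = ∑' x : zeros f, h x := by
  rw [zeroMeasure, lintegral_sum_measure]
  simp only [lintegral_dirac]

theorem zeroMeasure_apply (f : AnalyticFun disc) {B : Set ℂ} (hB : MeasurableSet B) :
    zeroMeasure f B = ((zeros f ∩ B).encard : ℝ≥0∞) := by
  rw [← lintegral_indicator_one hB, lintegral_zeroMeasure, ← ENNReal.tsum_set_one,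
    tsum_subtype (zeros f) (B.indicator 1), tsum_subtype (zeros f ∩ B) fun _ => (1 : ℝ≥0∞)]
  refine tsum_congr fun x => ?_
  rw [indicator_indicator]
  rfl

/-- The closed discs exhausting the unit disc. -/
def exhaust (m : ℕ) : Set ℂ := Metric.closedBall 0 (1 - 1 / ((m : ℝ) + 1))

theorem exhaust_subset (m : ℕ) : exhaust m ⊆ disc :=
  Metric.closedBall_subset_ball (by have : (0 : ℝ) < 1 / ((m : ℝ) + 1) := by positivity
                                    linarith)

/-- Disjoint annuli covering the unit disc. -/
def annulus (m : ℕ) : Set ℂ := {z | z ∈ disc ∧ ⌊1 / (1 - ‖z‖)⌋₊ = m}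

theorem measurableSet_annulus (m : ℕ) : MeasurableSet (annulus m) := by
  have h1 : Measurable fun z : ℂ => ⌊1 / (1 - ‖z‖)⌋₊ :=
    Nat.measurable_floor.comp (by fun_prop)
  exact Metric.isOpen_ball.measurableSet.inter (h1 (measurableSet_singleton m))

theorem annulus_subset (m : ℕ) : annulus m ⊆ exhaust m := by
  rintro z ⟨hz, hm⟩
  have h1 : 0 < 1 - ‖z‖ := sub_pos.2 (mem_ball_zero_iff.1 hz)
  have h2 := Nat.lt_floor_add_one (1 / (1 - ‖z‖))
  rw [hm, div_lt_iff₀ h1] at h2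
  rw [exhaust, mem_closedBall_zero_iff]
  have h3 : 1 / ((m : ℝ) + 1) ≤ 1 - ‖z‖ := by
    rw [div_le_iff₀ (by positivity)]
    linarith
  linarith

/-- On a compact disc the counting measures are finite, so it suffices to test the π-system of
closed sets, where `measurable_encard_zeros` applies. -/
theorem measurable_zeroMeasure_restrict_exhaust (m : ℕ) :
    Measurable fun f : AnalyticFun disc => (zeroMeasure f).restrict (exhaust m) := by
  have hK : IsCompact (exhaust m) := isCompact_closedBall _ _
  have hval : ∀ (f : AnalyticFun disc) (C : Set ℂ), MeasurableSet C →
      (zeroMeasure f).restrict (exhaust m) C = ((zeros f ∩ (C ∩ exhaust m)).encard : ℝ≥0∞) := by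
    intro f C hC
    rw [Measure.restrict_apply hC, zeroMeasure_apply f (hC.inter hK.measurableSet)]
  have hfin : ∀ f : AnalyticFun disc, IsFiniteMeasure ((zeroMeasure f).restrict (exhaust m)) := by
    intro f
    refine ⟨?_⟩
    rw [hval f _ MeasurableSet.univ, univ_inter]
    have := (finite_zeros_inter f hK (exhaust_subset m)).encard_lt_top
    simpa using this
  have hmeas : ∀ C : Set ℂ, IsClosed C → Measurable fun f : AnalyticFun disc =>
      (zeroMeasure f).restrict (exhaust m) C := by
    intro C hC
    simp_rw [fun f => hval f C hC.measurableSet]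
    exact (measurable_of_countable fun e : ℕ∞ => (e : ℝ≥0∞)).comp
      (measurable_encard_zeros (hK.inter_left hC) (inter_subset_right.trans (exhaust_subset m)))
  refine Measurable.measure_of_isPiSystem (S := {s | IsClosed s}) ?_ isPiSystem_isClosed
    (fun s hs => hmeas s hs) (hmeas _ isClosed_univ)
  rw [← borel_eq_generateFrom_isClosed]
  exact BorelSpace.measurable_eq

theorem zeroMeasure_eq_sum (f : AnalyticFun disc) :
    zeroMeasure f = Measure.sum fun m => (zeroMeasure f).restrict (annulus m) := by
  have hdisj : Pairwise (Function.onFun Disjoint annulus) := fun m n hmn =>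
    Set.disjoint_left.2 fun z hz hz' => hmn (hz.2.symm.trans hz'.2)
  have hunion : ⋃ m, annulus m = disc := by
    ext z
    simp [annulus]
  rw [← Measure.restrict_iUnion hdisj measurableSet_annulus, hunion]
  refine (Measure.restrict_eq_self_of_ae_mem ?_).symm
  rw [ae_iff]
  have : {a | a ∉ disc} = discᶜ := rfl
  rw [this, zeroMeasure_apply f Metric.isOpen_ball.measurableSet.compl]
  have : zeros f ∩ discᶜ = ∅ := by
    rw [← sdiff_eq]
    exact sdiff_eq_empty.2 (zeros_subset f)
  simp [this]

theorem measurable_zeroMeasure_restrict_annulus (m : ℕ) :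
    Measurable fun f : AnalyticFun disc => (zeroMeasure f).restrict (annulus m) := by
  have : ∀ f : AnalyticFun disc, (zeroMeasure f).restrict (annulus m) =
      ((zeroMeasure f).restrict (exhaust m)).restrict (annulus m) := fun f => by
    rw [Measure.restrict_restrict (measurableSet_annulus m),
      inter_eq_self_of_subset_left (annulus_subset m)]
  simp_rw [this]
  refine Measure.measurable_of_measurable_coe _ fun s hs => ?_
  simp_rw [Measure.restrict_apply hs (μ := (zeroMeasure _).restrict (exhaust m))]
  exact (Measure.measurable_coe (hs.inter (measurableSet_annulus m))).comp
    (measurable_zeroMeasure_restrict_exhaust m)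

theorem measurable_zeroMeasure : Measurable zeroMeasure := by
  refine Measure.measurable_of_measurable_coe _ fun s hs => ?_
  have : ∀ f, zeroMeasure f s = ∑' m, (zeroMeasure f).restrict (annulus m) s := by
    intro f
    conv_lhs => rw [zeroMeasure_eq_sum f, Measure.sum_apply _ hs]
  simp_rw [this]
  exact Measurable.tsum fun m =>
    (Measure.measurable_coe hs).comp (measurable_zeroMeasure_restrict_annulus m)

/-- The zeros, as a kernel from analytic functions to points. -/
def zeroKernel : Kernel (AnalyticFun disc) ℂ := ⟨zeroMeasure, measurable_zeroMeasure⟩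

/-- The masses are finite but perhaps not uniformly bounded; cutting the parameter space by their
integer part yields bounded pieces. -/
theorem isSFiniteKernel_of_isFiniteMeasure {α β : Type*} [MeasurableSpace α] [MeasurableSpace β]
    (κ : Kernel α β) (h : ∀ a, IsFiniteMeasure (κ a)) : IsSFiniteKernel κ := by
  classical
  have hs : ∀ c : ℕ, MeasurableSet {a | ⌊(κ a univ).toReal⌋₊ = c} := fun c =>
    (Nat.measurable_floor.comp (κ.measurable_coe MeasurableSet.univ).ennreal_toReal)
      (measurableSet_singleton c)
  refine ⟨fun c => Kernel.piecewise (hs c) κ 0, fun c => ⟨(c + 1 : ℕ), ENNReal.natCast_lt_top _,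
    fun a => ?_⟩, ?_⟩
  · rw [Kernel.piecewise_apply]
    split_ifs with ha
    · have h1 := Nat.lt_floor_add_one (κ a univ).toReal
      rw [show ⌊(κ a univ).toReal⌋₊ = c from ha] at h1
      rw [← ENNReal.ofReal_toReal (measure_ne_top (κ a) univ)]
      refine ENNReal.ofReal_le_of_le_toReal ?_
      rw [ENNReal.toReal_natCast]
      push_cast
      exact h1.le
    · simp
  · ext a s hs'
    rw [Kernel.sum_apply' _ _ hs', tsum_eq_single ⌊(κ a univ).toReal⌋₊, Kernel.piecewise_apply,
      if_pos (by exact rfl)]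
    intro c hc
    rw [Kernel.piecewise_apply, if_neg (by exact fun h => hc h.symm)]
    simp

instance : IsSFiniteKernel zeroKernel := by
  have h : zeroKernel = Kernel.sum fun m => (⟨fun f => (zeroMeasure f).restrict (annulus m),
      measurable_zeroMeasure_restrict_annulus m⟩ : Kernel (AnalyticFun disc) ℂ) := by
    ext1 f
    rw [Kernel.sum_apply]
    exact zeroMeasure_eq_sum f
  rw [h]
  refine Kernel.isSFiniteKernel_sum (hκs := fun m => isSFiniteKernel_of_isFiniteMeasure _ fun f => ⟨?_⟩)
  change (zeroMeasure f).restrict (annulus m) univ < ⊤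
  rw [Measure.restrict_apply_univ]
  refine (measure_mono (annulus_subset m)).trans_lt ?_
  have hK : IsCompact (exhaust m) := isCompact_closedBall _ _
  rw [zeroMeasure_apply f hK.measurableSet]
  simpa using (finite_zeros_inter f hK (exhaust_subset m)).encard_lt_top

theorem measurable_lintegral_zeroMeasure {α : Type*} [MeasurableSpace α]
    {h : α × AnalyticFun disc → ℂ → ℝ≥0∞} (hh : Measurable (Function.uncurry h)) :
    Measurable fun p : α × AnalyticFun disc => ∫⁻ x, h p x ∂zeroMeasure p.2 :=
  Measurable.lintegral_kernel_prod_right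
    (κ := zeroKernel.comap (fun p : α × AnalyticFun disc => p.2) measurable_snd) hh

theorem measurable_encard_zeros_inter {B : Set ℂ} (hB : MeasurableSet B) :
    Measurable fun f : AnalyticFun disc => (zeros f ∩ B).encard := by
  have h1 : Measurable fun f : AnalyticFun disc => ((zeros f ∩ B).encard : ℝ≥0∞) := by
    simp_rw [← fun f => zeroMeasure_apply f hB]
    exact (Measure.measurable_coe hB).comp measurable_zeroMeasure
  refine ENat.measurable_iff.2 fun n => ?_
  convert! h1 (measurableSet_singleton (n : ℝ≥0∞)) using 1
  ext f
  simp only [mem_preimage, mem_singleton_iff]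
  rw [← ENat.toENNReal_coe, ENat.toENNReal_inj]

attribute [irreducible] zeroMeasure

/-! ### The area formula for holomorphic functions -/

theorem countable_zeros (f : AnalyticFun disc) : (zeros f).Countable := by
  have : zeros f ⊆ ⋃ m, zeros f ∩ exhaust m := by
    intro z hz
    have h1 : z ∈ annulus ⌊1 / (1 - ‖z‖)⌋₊ := ⟨hz.1, rfl⟩
    exact mem_iUnion.2 ⟨_, hz, annulus_subset _ h1⟩
  exact (countable_iUnion fun m =>
    (finite_zeros_inter f (isCompact_closedBall _ _) (exhaust_subset m)).countable).mono this

theorem det_smulRight_complex (c : ℂ) :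
    (((ContinuousLinearMap.toSpanSingleton ℂ c).restrictScalars ℝ : ℂ →L[ℝ] ℂ)).det = ‖c‖ ^ 2 := by
  rw [Complex.sq_norm, ← Algebra.norm_complex_apply, Algebra.norm_apply, ContinuousLinearMap.det]
  congr 1
  ext
  all_goals simp [mul_comm]

/-- The inverse function theorem gives local injectivity off the critical points; a countable
subcover is then made disjoint. -/
theorem exists_countable_injOn_cover {u : ℂ → ℂ} (hu : DifferentiableOn ℂ u disc) :
    ∃ A : ℕ → Set ℂ, (∀ i, MeasurableSet (A i)) ∧ Pairwise (Function.onFun Disjoint A) ∧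
      (∀ i, InjOn u (A i)) ∧ ⋃ i, A i = {x | x ∈ disc ∧ deriv u x ≠ 0} := by
  set V : Set ℂ := {x | x ∈ disc ∧ deriv u x ≠ 0}
  have hV : IsOpen V :=
    ((hu.analyticOnNhd Metric.isOpen_ball).deriv.continuousOn).isOpen_inter_preimage
      Metric.isOpen_ball (isOpen_compl_singleton (x := (0 : ℂ)))
  have hloc : ∀ x ∈ V, ∃ s, IsOpen s ∧ x ∈ s ∧ InjOn u s := by
    intro x hx
    have h1 : HasStrictDerivAt u (deriv u x) x :=
      ((hu.analyticOnNhd Metric.isOpen_ball) x hx.1).hasStrictDerivAt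
    have h2 := h1.hasStrictFDerivAt_equiv hx.2
    exact ⟨(h2.toOpenPartialHomeomorph u).source, (h2.toOpenPartialHomeomorph u).open_source,
      h2.mem_toOpenPartialHomeomorph_source, (h2.toOpenPartialHomeomorph u).injOn⟩
  choose! s hso hxs hinj using hloc
  obtain ⟨t, htV, htc, hcov⟩ := TopologicalSpace.countable_cover_nhdsWithin (f := s) (s := V)
    fun x hx => mem_nhdsWithin_of_mem_nhds ((hso x hx).mem_nhds (hxs x hx))
  rcases t.eq_empty_or_nonempty with rfl | htn
  · refine ⟨fun _ => ∅, fun _ => MeasurableSet.empty, fun _ _ _ => disjoint_bot_left, fun _ => by simp,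
      ?_⟩
    rw [iUnion_empty]
    exact (subset_empty_iff.1 (by simpa using hcov)).symm
  obtain ⟨e, rfl⟩ := htc.exists_eq_range htn
  have he : ∀ i, e i ∈ V := fun i => htV (mem_range_self i)
  refine ⟨fun i => V ∩ disjointed (fun i => s (e i)) i, fun i => hV.measurableSet.inter
    (MeasurableSet.disjointed (fun i => (hso _ (he i)).measurableSet) i), fun i j hij =>
    (disjoint_disjointed _ hij).mono inter_subset_right inter_subset_right, fun i =>
    (hinj _ (he i)).mono (inter_subset_right.trans (disjointed_subset _ i)), ?_⟩
  rw [← inter_iUnion, iUnion_disjointed]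
  refine inter_eq_left.2 (hcov.trans ?_)
  rw [biUnion_range]

theorem hasFDerivWithinAt_real {u : ℂ → ℂ} {x : ℂ} {s : Set ℂ} (h : DifferentiableAt ℂ u x) :
    HasFDerivWithinAt u ((ContinuousLinearMap.toSpanSingleton ℂ (deriv u x)).restrictScalars ℝ)
      s x :=
  (h.hasDerivAt.hasFDerivAt.restrictScalars ℝ).hasFDerivWithinAt

/-- The sum of `H` over the points of `S` at which `u` takes the value `w`. -/
def fiberSum (u : ℂ → ℂ) (H : ℂ → ℝ≥0∞) (S : Set ℂ) (w : ℂ) : ℝ≥0∞ :=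
  ∑' x : ℂ, (S ∩ u ⁻¹' {w}).indicator H x

/-- Where u is injective a fibre has at most one point, and the claim is the change of variables
with real Jacobian |u'|². -/
theorem lintegral_fiberSum_of_injOn {u : ℂ → ℂ} (hu : DifferentiableOn ℂ u disc) {H : ℂ → ℝ≥0∞}
    (hH : Measurable H) {A : Set ℂ} (hA : MeasurableSet A) (hAd : A ⊆ disc) (hinj : InjOn u A) :
    Measurable (fiberSum u H A) ∧
    ∫⁻ x in A, ENNReal.ofReal (‖deriv u x‖ ^ 2) * H x = ∫⁻ w, fiberSum u H A w := by
  have hd : ∀ x ∈ A, HasFDerivWithinAt u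
      ((ContinuousLinearMap.toSpanSingleton ℂ (deriv u x)).restrictScalars ℝ) A x := fun x hx =>
    hasFDerivWithinAt_real (hu.differentiableAt (Metric.isOpen_ball.mem_nhds (hAd hx)))
  have hemb := measurableEmbedding_of_fderivWithin hA hd hinj
  have himg : MeasurableSet (u '' A) := measurable_image_of_fderivWithin hA hd hinj
  have hval : ∀ x ∈ A, fiberSum u H A (u x) = H x := by
    intro x hx
    have hmem : x ∈ A ∩ u ⁻¹' {u x} := ⟨hx, rfl⟩
    rw [fiberSum, tsum_eq_single x, indicator_of_mem hmem]
    exact fun y hy => indicator_of_notMem (fun h => hy (hinj h.1 hx h.2)) _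
  have hzero : ∀ w, w ∉ u '' A → fiberSum u H A w = 0 := by
    intro w hw
    refine ENNReal.tsum_eq_zero.2 fun x => indicator_of_notMem (fun h => hw ⟨x, h.1, h.2⟩) _
  constructor
  · have : fiberSum u H A = Function.extend (A.domRestrict u) (fun x : A => H x) fun _ => 0 := by
      funext w
      by_cases hw : w ∈ u '' A
      · obtain ⟨x, hx, rfl⟩ := hw
        rw [hval x hx]
        exact (hemb.injective.extend_apply (fun x : A => H x) (fun _ => 0) ⟨x, hx⟩).symm
      · rw [hzero w hw, Function.extend_apply']
        rintro ⟨x, rfl⟩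
        exact hw ⟨x, x.2, rfl⟩
    rw [this]
    exact hemb.measurable_extend (hH.comp measurable_subtype_coe) measurable_const
  · have h1 := lintegral_image_eq_lintegral_abs_det_fderiv_mul volume hA hd hinj (fiberSum u H A)
    have h2 : ∫⁻ w in u '' A, fiberSum u H A w = ∫⁻ w, fiberSum u H A w := by
      rw [← lintegral_indicator himg]
      refine lintegral_congr fun w => ?_
      by_cases hw : w ∈ u '' A
      · rw [indicator_of_mem hw]
      · rw [indicator_of_notMem hw, hzero w hw]
    rw [← h2, h1]
    refine setLIntegral_congr_fun hA fun x hx => ?_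
    rw [det_smulRight_complex, hval x hx, abs_of_nonneg (by positivity)]

theorem tsum_indicator_of_disjoint {α : Type*} {A : ℕ → Set α}
    (hA : Pairwise (Function.onFun Disjoint A)) (g : α → ℝ≥0∞) (x : α) :
    ∑' i, (A i).indicator g x = (⋃ i, A i).indicator g x := by
  by_cases hx : x ∈ ⋃ i, A i
  · obtain ⟨i, hi⟩ := mem_iUnion.1 hx
    rw [indicator_of_mem hx, tsum_eq_single i, indicator_of_mem hi]
    exact fun j hj => indicator_of_notMem (fun h => Set.disjoint_left.1 (hA hj) h hi) _
  · rw [indicator_of_notMem hx]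
    exact ENNReal.tsum_eq_zero.2 fun i =>
      indicator_of_notMem (fun h => hx (mem_iUnion.2 ⟨i, h⟩)) _

/-- **Area formula** for a holomorphic function on the disc. -/
theorem lintegral_norm_deriv_sq_mul {u : ℂ → ℂ} (hu : DifferentiableOn ℂ u disc)
    (hne : ∃ x ∈ disc, deriv u x ≠ 0) {H : ℂ → ℝ≥0∞} (hH : Measurable H) :
    ∫⁻ x in disc, ENNReal.ofReal (‖deriv u x‖ ^ 2) * H x = ∫⁻ w, fiberSum u H disc w := by
  obtain ⟨A, hA, hdisj, hinj, hunion⟩ := exists_countable_injOn_cover hu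
  set V : Set ℂ := {x | x ∈ disc ∧ deriv u x ≠ 0}
  have hAd : ∀ i, A i ⊆ disc := fun i x hx => by
    have : x ∈ V := hunion ▸ mem_iUnion.2 ⟨i, hx⟩
    exact this.1
  have hu' : DifferentiableOn ℂ (deriv u) disc := hu.deriv Metric.isOpen_ball
  -- Critical points are zeros of u', which is analytic and not identically zero.
  have hcrit : (disc \ V).Countable := by
    refine (countable_zeros (toAnalytic (deriv u))).mono fun x hx => ?_
    refine (show x ∈ disc ∧ _ ∧ IsNontrivial _ from ⟨hx.1, ?_, ?_⟩)
    · rw [ev_toAnalytic hu' hx.1]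
      by_contra h
      exact hx.2 ⟨hx.1, h⟩
    · obtain ⟨y, hy, h⟩ := hne
      exact ⟨y, hy, by rwa [ev_toAnalytic hu' hy]⟩
  have hVd : V ⊆ disc := fun x hx => hx.1
  have h1 : ∫⁻ x in disc, ENNReal.ofReal (‖deriv u x‖ ^ 2) * H x =
      ∫⁻ x in V, ENNReal.ofReal (‖deriv u x‖ ^ 2) * H x := by
    refine setLIntegral_congr ?_
    refine (ae_eq_set.2 ⟨hcrit.measure_zero _, ?_⟩)
    rw [sdiff_eq_empty.2 hVd, measure_empty]
  rw [h1, ← hunion, lintegral_iUnion hA hdisj]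
  have h2 := fun i => lintegral_fiberSum_of_injOn hu hH (hA i) (hAd i) (hinj i)
  simp_rw [fun i => (h2 i).2]
  rw [← lintegral_tsum fun i => (h2 i).1.aemeasurable]
  refine lintegral_congr_ae ?_
  -- Fibres taken in the disc and in V differ only over critical values, a countable and hence null
  -- set.
  have h3 : ∀ᵐ w : ℂ, w ∉ u '' (disc \ V) := by
    refine measure_mono_null (fun w hw => ?_) ((hcrit.image u).measure_zero volume)
    exact not_not.1 hw
  filter_upwards [h3] with w hw
  simp only [fiberSum]
  rw [ENNReal.tsum_comm]
  refine tsum_congr fun x => ?_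
  have h4 : ∀ i, (A i ∩ u ⁻¹' {w}).indicator H x = (A i).indicator ((u ⁻¹' {w}).indicator H) x :=
    fun i => by rw [indicator_indicator]
  simp_rw [h4]
  rw [tsum_indicator_of_disjoint hdisj, hunion, indicator_indicator]
  by_cases hx : x ∈ u ⁻¹' {w}
  · have : x ∈ V ↔ x ∈ disc := ⟨fun h => h.1, fun h => by
      by_contra hxV
      exact hw ⟨x, ⟨h, hxV⟩, hx⟩⟩
    by_cases hxd : x ∈ disc
    · rw [indicator_of_mem (show x ∈ V ∩ _ from ⟨this.2 hxd, hx⟩),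
        indicator_of_mem (show x ∈ disc ∩ _ from ⟨hxd, hx⟩)]
    · rw [indicator_of_notMem fun h => hxd h.1.1, indicator_of_notMem fun h => hxd h.1]
  · rw [indicator_of_notMem fun h => hx h.2, indicator_of_notMem fun h => hx h.2]

/-! ### The Campbell formula for the zeros -/

theorem clip_zero : clip 0 = 0 := clip_of_mem (by simp)

theorem mob_zero_left (w : ℂ) : mob 0 w = w := by
  rw [mob, clip_zero]; simp

theorem nker_zero_left (w : ℂ) : nker 0 w = 1 := by
  rw [nker, clip_zero]; simp

theorem ev_affMap_zero (ζ : ℂ) (f : AnalyticFun disc) {w : ℂ} (hw : w ∈ disc) :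
    ev (affMap 0 ζ f) w = ζ + w * ev f w := by
  rw [ev_affMap 0 ζ f hw, mob_zero_left, nker_zero_left, mul_one]

theorem zero_mem_disc : (0 : ℂ) ∈ disc := by simp

theorem differentiableOn_mul_ev (g : AnalyticFun disc) :
    DifferentiableOn ℂ (fun w => w * ev g w) disc :=
  differentiableOn_id.mul (differentiableOn_ev g)

theorem IsNontrivial.exists_ne {g : AnalyticFun disc} (hg : IsNontrivial g) (x : ℂ) :
    ∃ y ∈ disc, y ≠ x ∧ ev g y ≠ 0 := by
  by_contra! h
  obtain ⟨w, hw, hne⟩ := hg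
  have hwx : w = x := by
    by_contra hwx
    exact hne (h w hw hwx)
  refine hne ((analyticOnNhd_ev g).eqOn_zero_of_preconnected_of_frequently_eq_zero
    isPreconnected_disc hw (Filter.Eventually.frequently ?_) hw)
  filter_upwards [self_mem_nhdsWithin,
    mem_nhdsWithin_of_mem_nhds (Metric.isOpen_ball.mem_nhds hw)] with y hy hyd
  exact h y hyd (hwx ▸ hy)

theorem IsNontrivial.exists_ne_zero {g : AnalyticFun disc} (hg : IsNontrivial g) :
    ∃ y ∈ disc, y * ev g y ≠ 0 := by
  obtain ⟨y, hy, hy0, hne⟩ := hg.exists_ne 0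
  exact ⟨y, hy, mul_ne_zero hy0 hne⟩

theorem IsNontrivial.affMap_zero {g : AnalyticFun disc} (hg : IsNontrivial g) (ζ : ℂ) :
    IsNontrivial (affMap 0 ζ g) := by
  obtain ⟨y, hy, hne⟩ := hg.exists_ne_zero
  by_cases hζ : ζ = 0
  · exact ⟨y, hy, by rwa [ev_affMap_zero _ _ hy, hζ, zero_add]⟩
  · exact ⟨0, zero_mem_disc, by rwa [ev_affMap_zero _ _ zero_mem_disc, zero_mul, add_zero]⟩

theorem IsNontrivial.exists_deriv_ne_zero {g : AnalyticFun disc} (hg : IsNontrivial g) :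
    ∃ x ∈ disc, deriv (fun w => w * ev g w) x ≠ 0 := by
  by_contra! h
  obtain ⟨y, hy, hne⟩ := hg.exists_ne_zero
  refine hne ?_
  have := Metric.isOpen_ball.is_const_of_deriv_eq_zero isPreconnected_disc
    (differentiableOn_mul_ev g) h hy zero_mem_disc
  simpa using this

theorem zeros_affMap_zero_neg {g : AnalyticFun disc} (hg : IsNontrivial g) (w : ℂ) :
    zeros (affMap 0 (-w) g) = disc ∩ (fun x => x * ev g x) ⁻¹' {w} := by
  ext x
  constructor
  · rintro ⟨hx, h0, -⟩
    rw [ev_affMap_zero _ _ hx, neg_add_eq_zero] at h0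
    exact ⟨hx, h0.symm⟩
  · rintro ⟨hx, h0 : x * ev g x = w⟩
    exact ⟨hx, by rw [ev_affMap_zero _ _ hx, h0, neg_add_cancel], hg.affMap_zero _⟩

/-- In the decomposition ζ + w g(w) the value at 0 is ζ, whose law has no atom. -/
theorem IsGAFLaw.ae_isNontrivial {m : Measure (AnalyticFun disc)} [IsProbabilityMeasure m]
    (hm : IsGAFLaw m) : ∀ᵐ f ∂m, IsNontrivial f := by
  have hs : MeasurableSet {f : AnalyticFun disc | ev f 0 = 0} :=
    measurable_ev_apply 0 (measurableSet_singleton 0)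
  have h1 : m {f : AnalyticFun disc | ev f 0 = 0} = 0 := by
    rw [← lintegral_indicator_one hs, hm.lintegral_affMap 0 (measurable_one.indicator hs)]
    have : ∀ ζ (f : AnalyticFun disc),
        {f : AnalyticFun disc | ev f 0 = 0}.indicator (1 : AnalyticFun disc → ℝ≥0∞) (affMap 0 ζ f) =
        ({0} : Set ℂ).indicator 1 ζ := by
      intro ζ f
      have h2 : affMap 0 ζ f ∈ {f : AnalyticFun disc | ev f 0 = 0} ↔ ζ ∈ ({0} : Set ℂ) := by
        rw [mem_ofPred_eq, ev_affMap_zero _ _ zero_mem_disc, zero_mul, add_zero, mem_singleton_iff]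
      by_cases hζ : ζ ∈ ({0} : Set ℂ)
      · rw [indicator_of_mem hζ, indicator_of_mem (h2.2 hζ)]; rfl
      · rw [indicator_of_notMem hζ, indicator_of_notMem fun h => hζ (h2.1 h)]
    simp_rw [this]
    simp only [lintegral_const, measure_univ, mul_one]
    rw [lintegral_indicator_one (measurableSet_singleton _), stdComplexGaussian_singleton]
  filter_upwards [measure_eq_zero_iff_ae_notMem.1 h1] with f hf
  exact ⟨0, zero_mem_disc, hf⟩

/-- The derivative of `w ↦ w f(w)` on the disc. -/
def mulDeriv (f : AnalyticFun disc) (x : ℂ) : ℂ := ev f x + x * evDeriv f x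

theorem measurable_mulDeriv : Measurable fun p : AnalyticFun disc × ℂ => mulDeriv p.1 p.2 :=
  measurable_ev.add (measurable_snd.mul measurable_evDeriv)

theorem deriv_mul_ev (f : AnalyticFun disc) {x : ℂ} (hx : x ∈ disc) :
    deriv (fun w => w * ev f w) x = mulDeriv f x := by
  have h := ((differentiableOn_ev f).differentiableAt (Metric.isOpen_ball.mem_nhds hx)).hasDerivAt
  have h1 : HasDerivAt (fun w => w * ev f w) (1 * ev f x + x * deriv (ev f) x) x :=
    (hasDerivAt_id x).mul h
  rw [h1.deriv, mulDeriv, evDeriv_of_mem f hx, one_mul]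

/-- The weight obtained by integrating out the value at the origin. -/
def slice (h : ℂ → AnalyticFun disc → ℝ≥0∞) (x : ℂ) (g : AnalyticFun disc) : ℝ≥0∞ :=
  ENNReal.ofReal (gaussDensity (x * ev g x)) * h x (affMap 0 (-(x * ev g x)) g)

theorem measurable_slice {h : ℂ → AnalyticFun disc → ℝ≥0∞}
    (hh : Measurable (Function.uncurry h)) :
    Measurable fun p : ℂ × AnalyticFun disc => slice h p.1 p.2 := by
  have h1 : Measurable fun p : ℂ × AnalyticFun disc => p.1 * ev p.2 p.1 :=
    measurable_fst.mul (measurable_ev.comp measurable_swap)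
  have h2 : Measurable fun p : ℂ × AnalyticFun disc => affMap 0 (-(p.1 * ev p.2 p.1)) p.2 :=
    measurable_affMap.comp (measurable_const.prodMk (h1.neg.prodMk measurable_snd))
  exact ((measurable_gaussDensity.comp h1).ennreal_ofReal).mul
    (hh.comp (measurable_fst.prodMk h2))

theorem measurable_lintegral_zeroMeasure_self {h : ℂ → AnalyticFun disc → ℝ≥0∞}
    (hh : Measurable (Function.uncurry h)) :
    Measurable fun f : AnalyticFun disc => ∫⁻ x, h x f ∂zeroMeasure f :=
  (measurable_lintegral_zeroMeasure (α := Unit) (h := fun p x => h x p.2)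
    (hh.comp (measurable_snd.prodMk (measurable_snd.comp measurable_fst)))).comp
    (measurable_const.prodMk measurable_id (f := fun _ => ()))

/-- For fixed g the zeros of ζ + w g(w) form the fibre of w ↦ w g(w) over −ζ. The area formula turns
the integral over ζ into one over x, and the density of ζ, evaluated at x g(x), enters `slice`. -/
theorem lintegral_zeros_affMap_zero {h : ℂ → AnalyticFun disc → ℝ≥0∞}
    (hh : Measurable (Function.uncurry h)) {g : AnalyticFun disc} (hg : IsNontrivial g) :
    ∫⁻ ζ, ∫⁻ x, h x (affMap 0 ζ g) ∂zeroMeasure (affMap 0 ζ g) ∂stdComplexGaussian =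
      ∫⁻ x in disc, ENNReal.ofReal (‖mulDeriv g x‖ ^ 2) * slice h x g := by
  have hA : Measurable fun ζ : ℂ => affMap 0 ζ g :=
    (measurable_affMap_left 0).comp (measurable_id.prodMk measurable_const)
  have hH : Measurable fun x => slice h x g :=
    (measurable_slice hh).comp (measurable_id.prodMk measurable_const)
  have hZ : Measurable fun ζ => ∫⁻ x, h x (affMap 0 ζ g) ∂zeroMeasure (affMap 0 ζ g) :=
    (measurable_lintegral_zeroMeasure_self hh).comp hA
  rw [lintegral_stdComplexGaussian hZ, ← lintegral_neg_eq_self]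
  have h1 := lintegral_norm_deriv_sq_mul (differentiableOn_mul_ev g) hg.exists_deriv_ne_zero hH
  have h2 : ∫⁻ x in disc, ENNReal.ofReal (‖deriv (fun w => w * ev g w) x‖ ^ 2) * slice h x g =
      ∫⁻ x in disc, ENNReal.ofReal (‖mulDeriv g x‖ ^ 2) * slice h x g :=
    setLIntegral_congr_fun Metric.isOpen_ball.measurableSet fun x hx => by
      rw [deriv_mul_ev g hx]
  rw [← h2, h1]
  refine lintegral_congr fun w => ?_
  have h3 : gaussDensity (-w) = gaussDensity w := by rw [gaussDensity, gaussDensity, norm_neg]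
  rw [h3, lintegral_zeroMeasure, tsum_subtype _ fun x => h x (affMap 0 (-w) g),
    zeros_affMap_zero_neg hg, fiberSum, ← ENNReal.tsum_mul_left]
  refine tsum_congr fun x => ?_
  by_cases hx : x ∈ disc ∩ (fun x => x * ev g x) ⁻¹' {w}
  · rw [indicator_of_mem hx, indicator_of_mem hx, slice, show x * ev g x = w from hx.2]
  · rw [indicator_of_notMem hx, indicator_of_notMem hx, mul_zero]

/-! ### Decomposition at the zero instead of the origin -/

theorem sqrt_mul_nker_self {x : ℂ} (hx : x ∈ disc) (w : ℂ) :
    (Real.sqrt (1 - ‖x‖ ^ 2) : ℂ) * nker x w = (1 - x * conj x) / (1 - w * conj x) := by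
  rw [nker, clip_of_mem hx, ← mul_div_assoc, ← Complex.ofReal_mul,
    Real.mul_self_sqrt (one_sub_norm_sq_pos hx).le, Complex.mul_conj']
  push_cast; rfl

/-- Put g = r ζ k_x + φ_x f with r = √(1 − |x|²), so that g(x) = ζ. Then w g(w) − x g(x) = φ_x(w)(ζ
+ w f(w)): the function forced to vanish at x is φ_x times ζ + w f(w), itself a copy of the Gaussian
function when ζ and f are independent with their Gaussian laws. -/
theorem affMap_zero_affMap {x : ℂ} (hx : x ∈ disc) (ζ : ℂ) (f : AnalyticFun disc) :
    affMap 0 (-(x * ζ)) (affMap x (Real.sqrt (1 - ‖x‖ ^ 2) * ζ) f) =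
      affMap x 0 (affMap 0 ζ f) := by
  refine analyticFun_ext fun w hw => ?_
  have h1 := sqrt_mul_nker_self hx w
  have h2 := one_sub_mul_conj_ne_zero hw hx
  rw [ev_affMap_zero _ _ hw, ev_affMap _ _ _ hw, ev_affMap _ _ _ hw, ev_affMap_zero _ _ hw,
    mul_right_comm, h1, mob, clip_of_mem hx]
  field_simp
  ring

theorem ev_affMap_self {x : ℂ} (hx : x ∈ disc) (ζ : ℂ) (f : AnalyticFun disc) :
    ev (affMap x (Real.sqrt (1 - ‖x‖ ^ 2) * ζ) f) x = ζ := by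
  have h1 := sqrt_mul_nker_self hx x
  have h2 := one_sub_mul_conj_ne_zero hx hx
  rw [ev_affMap _ _ _ hx, mul_right_comm, h1, mob, clip_of_mem hx, sub_self, zero_div, zero_mul,
    div_self h2, one_mul, add_zero]

/-- Up to a constant the function differentiated is φ_x(w)(ζ + w f(w)), where φ_x(x) = 0 and φ_x'(x)
= 1/(1 − |x|²). -/
theorem mulDeriv_affMap_self {x : ℂ} (hx : x ∈ disc) (ζ : ℂ) (f : AnalyticFun disc) :
    mulDeriv (affMap x (Real.sqrt (1 - ‖x‖ ^ 2) * ζ) f) x =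
      ev (affMap 0 ζ f) x / (1 - x * conj x) := by
  have h2 := one_sub_mul_conj_ne_zero hx hx
  rw [← deriv_mul_ev _ hx]
  have hd := ((differentiableOn_ev (affMap 0 ζ f)).differentiableAt
    (Metric.isOpen_ball.mem_nhds hx)).hasDerivAt
  have hmob : HasDerivAt (mob x) (1 / (1 - x * conj x)) x := by
    have h3 : HasDerivAt (fun w : ℂ => (w - x) / (1 - w * conj x))
        ((1 * (1 - x * conj x) - (x - x) * (-(1 * conj x))) / (1 - x * conj x) ^ 2) x :=
      ((hasDerivAt_id x).sub_const x).div (((hasDerivAt_id x).mul_const (conj x)).const_sub 1) h2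
    convert! h3 using 1
    · funext w; rw [mob, clip_of_mem hx]
    · field_simp; ring
  have h4 := (hmob.mul hd).const_add (x * ζ)
  have h5 : (fun w => w * ev (affMap x (Real.sqrt (1 - ‖x‖ ^ 2) * ζ) f) w) =ᶠ[nhds x]
      fun w => x * ζ + (mob x * ev (affMap 0 ζ f)) w := by
    filter_upwards [Metric.isOpen_ball.mem_nhds hx] with w hw
    have h6 := congrArg (fun F => ev F w) (affMap_zero_affMap hx ζ f)
    rw [ev_affMap_zero _ _ hw, ev_affMap x 0 _ hw, zero_mul, zero_add] at h6
    rw [Pi.mul_apply, ← h6]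
    ring
  rw [h5.deriv_eq, h4.deriv, mob, clip_of_mem hx, sub_self, zero_div, zero_mul, add_zero,
    one_div_mul_eq_div]

/-- The density of the first intensity relative to the conditional weight. -/
def campbellWeight (x : ℂ) (f : AnalyticFun disc) : ℝ≥0∞ :=
  ENNReal.ofReal (1 / (Real.pi * (1 - ‖x‖ ^ 2))) * ENNReal.ofReal (‖ev f x‖ ^ 2)

theorem measurable_campbellWeight :
    Measurable fun p : ℂ × AnalyticFun disc => campbellWeight p.1 p.2 := by
  have h1 : Measurable fun p : ℂ × AnalyticFun disc => ev p.2 p.1 :=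
    measurable_ev.comp measurable_swap
  have h2 : Measurable fun x : ℂ => 1 / (Real.pi * (1 - ‖x‖ ^ 2)) := by fun_prop
  exact (h2.comp measurable_fst).ennreal_ofReal.mul (h1.norm.pow_const 2).ennreal_ofReal

/-- Decompose g as ζ k_x + φ_x f. The density in `slice` is Gaussian in ζ and is absorbed by
rescaling ζ to rζ, at the cost of r². The integrand then depends on ζ and f only through ζ + w f(w),
which has law m. The constants combine as r² · π⁻¹ · (1 − |x|²)⁻² = 1/(π(1 − |x|²)). -/
theorem IsGAFLaw.lintegral_slice {m : Measure (AnalyticFun disc)} [IsProbabilityMeasure m]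
    (hm : IsGAFLaw m) {h : ℂ → AnalyticFun disc → ℝ≥0∞} (hh : Measurable (Function.uncurry h))
    {x : ℂ} (hx : x ∈ disc) :
    ∫⁻ g, ENNReal.ofReal (‖mulDeriv g x‖ ^ 2) * slice h x g ∂m =
      ∫⁻ f, campbellWeight x f * h x (affMap x 0 f) ∂m := by
  have hr2 := one_sub_norm_sq_pos hx
  set r := Real.sqrt (1 - ‖x‖ ^ 2) with hr
  have hr0 : 0 < r := Real.sqrt_pos.2 hr2
  have hsq : r ^ 2 = 1 - ‖x‖ ^ 2 := Real.sq_sqrt hr2.le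
  have hrc : (r : ℂ) ≠ 0 := Complex.ofReal_ne_zero.2 hr0.ne'
  have hmx : Measurable fun g : AnalyticFun disc => h x g :=
    hh.comp (measurable_const.prodMk measurable_id)
  have hm1 : Measurable fun g : AnalyticFun disc => ENNReal.ofReal (‖mulDeriv g x‖ ^ 2) *
      h x (affMap 0 (-(x * ev g x)) g) := by
    have h1 : Measurable fun g : AnalyticFun disc => mulDeriv g x :=
      measurable_mulDeriv.comp (measurable_id.prodMk measurable_const)
    have h2 : Measurable fun g : AnalyticFun disc => affMap 0 (-(x * ev g x)) g :=
      (measurable_affMap_left 0).comp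
        (((measurable_ev_apply x).const_mul x).neg.prodMk measurable_id)
    exact (h1.norm.pow_const 2).ennreal_ofReal.mul (hmx.comp h2)
  have hm2 : Measurable fun g : AnalyticFun disc =>
      ENNReal.ofReal (‖mulDeriv g x‖ ^ 2) * slice h x g := by
    have h1 : Measurable fun g : AnalyticFun disc => mulDeriv g x :=
      measurable_mulDeriv.comp (measurable_id.prodMk measurable_const)
    exact (h1.norm.pow_const 2).ennreal_ofReal.mul
      ((measurable_slice hh).comp (measurable_const.prodMk measurable_id))
  have hm3 : Measurable fun f : AnalyticFun disc => campbellWeight x f * h x (affMap x 0 f) :=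
    (measurable_campbellWeight.comp (measurable_const.prodMk measurable_id)).mul
      (hmx.comp ((measurable_affMap_left x).comp (measurable_const.prodMk measurable_id)))
  set Φ : ℂ → ℝ≥0∞ := fun ζ => ∫⁻ f, ENNReal.ofReal (1 / Real.pi) *
    (ENNReal.ofReal (‖mulDeriv (affMap x ζ f) x‖ ^ 2) *
      h x (affMap 0 (-(x * ev (affMap x ζ f) x)) (affMap x ζ f))) ∂m
  have hΦ : Measurable Φ := by
    refine Measurable.lintegral_prod_right' (f := fun p : ℂ × AnalyticFun disc =>
      ENNReal.ofReal (1 / Real.pi) * (ENNReal.ofReal (‖mulDeriv (affMap x p.1 p.2) x‖ ^ 2) *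
      h x (affMap 0 (-(x * ev (affMap x p.1 p.2) x)) (affMap x p.1 p.2)))) ?_
    exact (hm1.comp (measurable_affMap_left x)).const_mul _
  rw [hm.lintegral_affMap x hm2, hm.lintegral_affMap 0 hm3]
  have h1 : ∀ ζ, ∫⁻ f, ENNReal.ofReal (‖mulDeriv (affMap x ζ f) x‖ ^ 2) *
      slice h x (affMap x ζ f) ∂m =
      ENNReal.ofReal (Real.exp (-((r ^ 2)⁻¹ - 1) * ‖ζ‖ ^ 2)) * Φ ζ := by
    intro ζ
    rw [← lintegral_const_mul]
    · refine lintegral_congr fun f => ?_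
      -- Before rescaling, the value at x is ζ/r, and |x|²/r² = r⁻² − 1 is the exponent absorbed by
      -- `lintegral_exp_mul_stdComplexGaussian`.
      have h2 : gaussDensity (x * ev (affMap x ζ f) x) =
          Real.exp (-((r ^ 2)⁻¹ - 1) * ‖ζ‖ ^ 2) * (1 / Real.pi) := by
        have h3 : ζ = r * (ζ / r) := by field_simp
        have h4 : ev (affMap x ζ f) x = ζ / r := by
          conv_lhs => rw [h3]
          exact ev_affMap_self hx _ f
        rw [h4, gaussDensity, mul_one_div, norm_mul, norm_div, Complex.norm_real,
          Real.norm_of_nonneg hr0.le, mul_pow, div_pow]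
        congr 2
        rw [show ‖x‖ ^ 2 = 1 - r ^ 2 by rw [hsq]; ring]
        field_simp
      rw [slice, h2, ENNReal.ofReal_mul (by positivity)]
      ring
    · exact ((hm1.comp ((measurable_affMap_left x).comp
        (measurable_const.prodMk measurable_id)))).const_mul _
  simp_rw [h1]
  rw [lintegral_exp_mul_stdComplexGaussian hΦ hr0, ← lintegral_const_mul]
  · refine lintegral_congr fun ζ => ?_
    rw [← lintegral_const_mul]
    · refine lintegral_congr fun f => ?_
      rw [mulDeriv_affMap_self hx, ev_affMap_self hx, affMap_zero_affMap hx, campbellWeight,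
        ← mul_assoc, ← mul_assoc]
      congr 1
      rw [← ENNReal.ofReal_mul (by positivity), ← ENNReal.ofReal_mul (by positivity),
        ← ENNReal.ofReal_mul (by positivity)]
      congr 1
      rw [Complex.mul_conj', norm_div, ← hsq]
      have : ‖(1 : ℂ) - (‖x‖ : ℂ) ^ 2‖ = r ^ 2 := by
        rw [hsq, ← Complex.ofReal_pow, ← Complex.ofReal_one, ← Complex.ofReal_sub,
          Complex.norm_real, Real.norm_of_nonneg hr2.le]
      rw [this]
      field_simp
    · exact ((hm1.comp ((measurable_affMap_left x).comp
        (measurable_const.prodMk measurable_id)))).const_mul _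
  · exact hΦ.comp (measurable_const_mul _)

/-- **Campbell formula**: the zeros of a Gaussian analytic function, with the function itself as a
mark. -/
theorem IsGAFLaw.lintegral_zeros {m : Measure (AnalyticFun disc)} [IsProbabilityMeasure m]
    (hm : IsGAFLaw m) {h : ℂ → AnalyticFun disc → ℝ≥0∞} (hh : Measurable (Function.uncurry h)) :
    ∫⁻ f, ∫⁻ x, h x f ∂zeroMeasure f ∂m =
      ∫⁻ x in disc, ∫⁻ f, campbellWeight x f * h x (affMap x 0 f) ∂m := by
  have hZ := measurable_lintegral_zeroMeasure_self hh
  -- Write the function as ζ + w g(w) and integrate over ζ first, with g fixed.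
  rw [hm.lintegral_affMap 0 hZ, lintegral_lintegral_swap
    (f := fun ζ g => ∫⁻ x, h x (affMap 0 ζ g) ∂zeroMeasure (affMap 0 ζ g))
    (hZ.comp (measurable_affMap_left 0)).aemeasurable]
  have h1 : ∫⁻ g, ∫⁻ ζ, ∫⁻ x, h x (affMap 0 ζ g) ∂zeroMeasure (affMap 0 ζ g) ∂stdComplexGaussian ∂m =
      ∫⁻ g, (∫⁻ x in disc, ENNReal.ofReal (‖mulDeriv g x‖ ^ 2) * slice h x g) ∂m :=
    lintegral_congr_ae (hm.ae_isNontrivial.mono fun g hg => lintegral_zeros_affMap_zero hh hg)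
  have h2 : Measurable fun p : AnalyticFun disc × ℂ =>
      ENNReal.ofReal (‖mulDeriv p.1 p.2‖ ^ 2) * slice h p.2 p.1 :=
    (measurable_mulDeriv.norm.pow_const 2).ennreal_ofReal.mul
      ((measurable_slice hh).comp measurable_swap)
  rw [h1, lintegral_lintegral_swap h2.aemeasurable]
  exact setLIntegral_congr_fun Metric.isOpen_ball.measurableSet fun x hx => hm.lintegral_slice hh hx

/-! ### Sums over tuples of distinct zeros -/

/-- The `n`-tuples of pairwise distinct points of `Z`. -/
def distinctTuples (n : ℕ) (Z : Set ℂ) : Set (Fin n → ℂ) :=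
  {x | Function.Injective x ∧ ∀ i, x i ∈ Z}

/-- The sum of `h` over the `n`-tuples of pairwise distinct points of `Z`. -/
def tupleSum (n : ℕ) (Z : Set ℂ) (h : (Fin n → ℂ) → ℝ≥0∞) : ℝ≥0∞ :=
  ∑' x : distinctTuples n Z, h x

theorem tupleSum_eq_tsum (n : ℕ) (Z : Set ℂ) (h : (Fin n → ℂ) → ℝ≥0∞) :
    tupleSum n Z h = ∑' x, (distinctTuples n Z).indicator h x := tsum_subtype _ _

theorem tupleSum_zero (Z : Set ℂ) (h : (Fin 0 → ℂ) → ℝ≥0∞) : tupleSum 0 Z h = h default := by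
  rw [tupleSum_eq_tsum, tsum_eq_single default fun y hy => (hy (Subsingleton.elim _ _)).elim]
  exact indicator_of_mem (show default ∈ distinctTuples 0 Z from
    ⟨Function.injective_of_subsingleton _, fun i => i.elim0⟩) _

theorem cons_mem_distinctTuples {n : ℕ} {Z : Set ℂ} {x : ℂ} {y : Fin n → ℂ} :
    (Fin.cons x y : Fin (n + 1) → ℂ) ∈ distinctTuples (n + 1) Z ↔
      x ∈ Z ∧ y ∈ distinctTuples n Z ∧ ∀ i, y i ≠ x := by
  simp only [distinctTuples, mem_ofPred_eq, Fin.cons_injective_iff, Fin.forall_fin_succ,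
    Fin.cons_zero, Fin.cons_succ, mem_range, not_exists]
  tauto

theorem tupleSum_succ (n : ℕ) (Z : Set ℂ) (h : (Fin (n + 1) → ℂ) → ℝ≥0∞) :
    tupleSum (n + 1) Z h =
      ∑' x : Z, tupleSum n Z ({y | ∀ i, y i ≠ (x : ℂ)}.indicator fun y => h (Fin.cons (x : ℂ) y)) := by
  rw [tupleSum_eq_tsum, ← (Fin.consEquiv fun _ : Fin (n + 1) => ℂ).tsum_eq,
    ENNReal.tsum_prod', tsum_subtype Z fun x : ℂ =>
      tupleSum n Z ({y | ∀ i, y i ≠ x}.indicator fun y => h (Fin.cons x y))]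
  refine tsum_congr fun x => ?_
  by_cases hx : x ∈ Z
  · rw [indicator_of_mem hx, tupleSum_eq_tsum]
    refine tsum_congr fun y => ?_
    rw [indicator_indicator]
    change (distinctTuples (n + 1) Z).indicator h (Fin.cons x y) = _
    by_cases hy : y ∈ distinctTuples n Z ∩ {y | ∀ i, y i ≠ x}
    · rw [indicator_of_mem hy, indicator_of_mem (cons_mem_distinctTuples.2 ⟨hx, hy.1, hy.2⟩)]
    · rw [indicator_of_notMem hy, indicator_of_notMem fun h => hy ?_]
      exact ⟨(cons_mem_distinctTuples.1 h).2.1, (cons_mem_distinctTuples.1 h).2.2⟩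
  · rw [indicator_of_notMem hx]
    exact ENNReal.tsum_eq_zero.2 fun y =>
      indicator_of_notMem (fun h => hx (cons_mem_distinctTuples.1 h).1) _

theorem tupleSum_const_mul (n : ℕ) (Z : Set ℂ) (c : ℝ≥0∞) (h : (Fin n → ℂ) → ℝ≥0∞) :
    c * tupleSum n Z h = tupleSum n Z fun y => c * h y := ENNReal.tsum_mul_left.symm

/-- Allows the zeros of φ_x f to be replaced by those of f in sums over tuples that avoid x. -/
theorem tupleSum_congr_of_avoid {n : ℕ} {Z Z' : Set ℂ} {x : ℂ} (hZ : Z \ {x} = Z' \ {x})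
    (h : (Fin n → ℂ) → ℝ≥0∞) :
    tupleSum n Z ({y | ∀ i, y i ≠ x}.indicator h) =
      tupleSum n Z' ({y | ∀ i, y i ≠ x}.indicator h) := by
  rw [tupleSum_eq_tsum, tupleSum_eq_tsum, indicator_indicator, indicator_indicator]
  congr 2
  funext y
  have hiff : ∀ w, w ≠ x → (w ∈ Z ↔ w ∈ Z') := fun w hw => by
    have : w ∈ Z \ {x} ↔ w ∈ Z' \ {x} := by rw [hZ]
    simpa [hw] using this
  congr 1
  ext y
  simp only [distinctTuples, mem_inter_iff, mem_ofPred_eq]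
  constructor
  · rintro ⟨⟨h1, h2⟩, h3⟩
    exact ⟨⟨h1, fun i => (hiff _ (h3 i)).1 (h2 i)⟩, h3⟩
  · rintro ⟨⟨h1, h2⟩, h3⟩
    exact ⟨⟨h1, fun i => (hiff _ (h3 i)).2 (h2 i)⟩, h3⟩

theorem measurable_finCons {α : Type*} [MeasurableSpace α] {n : ℕ} {u : α → ℂ}
    {v : α → Fin n → ℂ} (hu : Measurable u) (hv : Measurable v) :
    Measurable fun a => (Fin.cons (u a) (v a) : Fin (n + 1) → ℂ) := by
  refine measurable_pi_iff.2 fun i => ?_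
  refine Fin.cases ?_ (fun j => ?_) i
  · simpa only [Fin.cons_zero] using hu
  · simpa only [Fin.cons_succ] using measurable_pi_iff.1 hv j

theorem measurableSet_avoid {α : Type*} [MeasurableSpace α] {n : ℕ} {u : α → ℂ}
    {v : α → Fin n → ℂ} (hu : Measurable u) (hv : Measurable v) :
    MeasurableSet {a | ∀ i, v a i ≠ u a} := by
  have : {a | ∀ i, v a i ≠ u a} = ⋂ i, {a | v a i = u a}ᶜ := by
    ext a; simp
  rw [this]
  exact MeasurableSet.iInter fun i =>
    (measurableSet_eq_fun (measurable_pi_iff.1 hv i) hu).compl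

/-- Induction on n with an arbitrary parameter space, since the first point of the tuple becomes a
parameter for the others. -/
theorem measurable_tupleSum (n : ℕ) {α : Type*} [MeasurableSpace α] {F : α → AnalyticFun disc}
    (hF : Measurable F) {h : α → (Fin n → ℂ) → ℝ≥0∞} (hh : Measurable (Function.uncurry h)) :
    Measurable fun a => tupleSum n (zeros (F a)) (h a) := by
  induction n generalizing α with
  | zero =>
    simp_rw [tupleSum_zero]
    exact hh.comp (measurable_id.prodMk measurable_const)
  | succ n ih =>
    simp_rw [tupleSum_succ]
    have h1 := fun a => lintegral_zeroMeasure (F a) fun x =>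
      tupleSum n (zeros (F a)) ({y | ∀ i, y i ≠ x}.indicator fun y => h a (Fin.cons x y))
    simp_rw [← h1]
    refine Measurable.lintegral_kernel_prod_right (κ := zeroKernel.comap F hF)
      (f := fun a x => tupleSum n (zeros (F a))
        ({y | ∀ i, y i ≠ x}.indicator fun y => h a (Fin.cons x y))) ?_
    refine ih (α := α × ℂ) (F := fun p => F p.1) (h := fun p =>
      {y | ∀ i, y i ≠ p.2}.indicator fun y => h p.1 (Fin.cons p.2 y)) (hF.comp measurable_fst) ?_
    have h2 : Measurable fun q : (α × ℂ) × (Fin n → ℂ) => h q.1.1 (Fin.cons q.1.2 q.2) :=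
      hh.comp ((measurable_fst.comp measurable_fst).prodMk
        (measurable_finCons (measurable_snd.comp measurable_fst) measurable_snd))
    exact h2.indicator (measurableSet_avoid (measurable_snd.comp measurable_fst) measurable_snd)

/-! ### Iterating the Campbell formula -/

theorem mob_eq_zero_iff {x w : ℂ} (hx : x ∈ disc) (hw : w ∈ disc) : mob x w = 0 ↔ w = x := by
  rw [mob, div_eq_zero_iff, clip_of_mem hx, sub_eq_zero]
  simp [one_sub_mul_conj_ne_zero hw hx]

theorem norm_mob_comm {x y : ℂ} (hx : x ∈ disc) (hy : y ∈ disc) : ‖mob x y‖ = ‖mob y x‖ := by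
  have : 1 - x * conj y = conj (1 - y * conj x) := by simp [mul_comm]
  rw [mob, mob, clip_of_mem hx, clip_of_mem hy, norm_div, norm_div, norm_sub_rev, this,
    RCLike.norm_conj]

/-- Multiplication of `f` by the finite Blaschke product with zeros `z`. -/
def blaschkeMul {n : ℕ} (z : Fin n → ℂ) (f : AnalyticFun disc) : AnalyticFun disc :=
  toAnalytic fun w => (∏ i, mob (z i) w) * ev f w

theorem ev_blaschkeMul {n : ℕ} (z : Fin n → ℂ) (f : AnalyticFun disc) {w : ℂ} (hw : w ∈ disc) :
    ev (blaschkeMul z f) w = (∏ i, mob (z i) w) * ev f w :=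
  ev_toAnalytic ((DifferentiableOn.fun_finsetProd fun i _ => differentiableOn_mob (z i)).mul
    (differentiableOn_ev f)) hw

attribute [irreducible] blaschkeMul

theorem measurable_blaschkeMul (n : ℕ) :
    Measurable fun p : (Fin n → ℂ) × AnalyticFun disc => blaschkeMul p.1 p.2 := by
  refine measurable_of_ev fun w hw => ?_
  simp_rw [fun p : (Fin n → ℂ) × AnalyticFun disc => ev_blaschkeMul p.1 p.2 hw]
  refine Measurable.mul (Finset.measurable_prod _ fun i _ => ?_)
    ((measurable_ev_apply w).comp measurable_snd)
  have h1 : Measurable fun p : (Fin n → ℂ) × AnalyticFun disc => p.1 i :=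
    (measurable_pi_apply i).comp measurable_fst
  exact measurable_mob.comp (h1.prodMk (measurable_const (a := w)))

theorem affMap_blaschkeMul {n : ℕ} (x : ℂ) (y : Fin n → ℂ) (f : AnalyticFun disc) :
    affMap x 0 (blaschkeMul y f) = blaschkeMul (Fin.cons x y : Fin (n + 1) → ℂ) f := by
  refine analyticFun_ext fun w hw => ?_
  rw [ev_affMap _ _ _ hw, ev_blaschkeMul _ _ hw, ev_blaschkeMul _ _ hw, Fin.prod_univ_succ,
    Fin.cons_zero, zero_mul, zero_add, mul_assoc]
  simp only [Fin.cons_succ]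

theorem blaschkeMul_zero (z : Fin 0 → ℂ) (f : AnalyticFun disc) : blaschkeMul z f = f :=
  analyticFun_ext fun w hw => by rw [ev_blaschkeMul _ _ hw]; simp

theorem zeros_affMap_sdiff {x : ℂ} (hx : x ∈ disc) (f : AnalyticFun disc) :
    zeros (affMap x 0 f) \ {x} = zeros f \ {x} := by
  have hev : ∀ w ∈ disc, ev (affMap x 0 f) w = mob x w * ev f w := fun w hw => by
    rw [ev_affMap _ _ _ hw, zero_mul, zero_add]
  have hn : IsNontrivial (affMap x 0 f) ↔ IsNontrivial f := by
    constructor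
    · rintro ⟨w, hw, h⟩
      rw [hev w hw] at h
      exact ⟨w, hw, right_ne_zero_of_mul h⟩
    · intro h
      obtain ⟨y, hy, hyx, hne⟩ := h.exists_ne x
      exact ⟨y, hy, by
        rw [hev y hy]; exact mul_ne_zero (mt (mob_eq_zero_iff hx hy).1 hyx) hne⟩
  ext w
  simp only [zeros, mem_sdiff, mem_ofPred_eq, mem_singleton_iff, hn]
  constructor
  · rintro ⟨⟨hw, h0, h1⟩, hne⟩
    rw [hev w hw] at h0
    exact ⟨⟨hw, (mul_eq_zero.1 h0).resolve_left (mt (mob_eq_zero_iff hx hw).1 hne), h1⟩, hne⟩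
  · rintro ⟨⟨hw, h0, h1⟩, hne⟩
    exact ⟨⟨hw, by rw [hev w hw, h0, mul_zero], h1⟩, hne⟩

/-- The determinant of the Szegő matrix, as a real number. -/
def szegoDet {n : ℕ} (z : Fin n → ℂ) : ℝ := (szegoMatrix z).det.re

theorem measurable_szegoDet (n : ℕ) : Measurable fun z : Fin n → ℂ => szegoDet z := by
  unfold szegoDet
  simp_rw [Matrix.det_apply]
  refine Complex.measurable_re.comp (Finset.measurable_sum _ fun σ _ => ?_)
  refine Measurable.const_smul (Finset.measurable_prod _ fun i _ => ?_) _
  exact (((measurable_pi_apply _).mul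
    (measurable_conj.comp (measurable_pi_apply _))).const_sub 1).const_div 1

theorem szegoMatrix_det_cons {n : ℕ} {x : ℂ} {y : Fin n → ℂ} (hx : x ∈ disc)
    (hy : ∀ i, y i ∈ disc) :
    (szegoMatrix (Fin.cons x y : Fin (n + 1) → ℂ)).det =
      ((1 / (1 - ‖x‖ ^ 2) * ∏ i, ‖mob x (y i)‖ ^ 2 : ℝ) : ℂ) * (szegoMatrix y).det := by
  rw [det_szegoMatrix_cons hx hy, szego_self]
  push_cast
  simp only [Complex.mul_conj']

theorem szegoDet_cons {n : ℕ} {x : ℂ} {y : Fin n → ℂ} (hx : x ∈ disc) (hy : ∀ i, y i ∈ disc) :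
    szegoDet (Fin.cons x y : Fin (n + 1) → ℂ) =
      1 / (1 - ‖x‖ ^ 2) * (∏ i, ‖mob x (y i)‖ ^ 2) * szegoDet y := by
  rw [szegoDet, szegoMatrix_det_cons hx hy, Complex.re_ofReal_mul, szegoDet]

theorem szegoDet_nonneg_and_ofReal {n : ℕ} (z : Fin n → ℂ) (hz : ∀ i, z i ∈ disc) :
    0 ≤ szegoDet z ∧ (szegoDet z : ℂ) = (szegoMatrix z).det := by
  induction n with
  | zero => simp [szegoDet]
  | succ n ih =>
    obtain ⟨x, y, rfl⟩ : ∃ x y, z = Fin.cons x y := ⟨z 0, Fin.tail z, (Fin.cons_self_tail z).symm⟩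
    have hx : x ∈ disc := by simpa using hz 0
    have hy : ∀ i, y i ∈ disc := fun i => by simpa using hz i.succ
    obtain ⟨h1, h2⟩ := ih y hy
    have := one_sub_norm_sq_pos hx
    rw [szegoDet_cons hx hy, szegoMatrix_det_cons hx hy, ← h2]
    exact ⟨by positivity, by push_cast; rfl⟩

/-- The weight in the iterated Campbell formula. -/
def tupleWeight {n : ℕ} (z : Fin n → ℂ) (f : AnalyticFun disc) : ℝ≥0∞ :=
  ENNReal.ofReal ((1 / Real.pi) ^ n * szegoDet z) * ∏ i, ENNReal.ofReal (‖ev f (z i)‖ ^ 2)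

theorem measurable_tupleWeight (n : ℕ) :
    Measurable fun p : (Fin n → ℂ) × AnalyticFun disc => tupleWeight p.1 p.2 := by
  refine Measurable.mul (((measurable_szegoDet n).comp measurable_fst).const_mul _).ennreal_ofReal
    (Finset.measurable_prod _ fun i _ => ?_)
  have : Measurable fun p : (Fin n → ℂ) × AnalyticFun disc => ev p.2 (p.1 i) :=
    measurable_ev.comp (measurable_snd.prodMk ((measurable_pi_apply i).comp measurable_fst))
  exact (this.norm.pow_const 2).ennreal_ofReal

/-- The Schur factor ∏|φ_x(y_i)|² equals |∏ φ_{y_i}(x)|² because |φ_x(y)| = |φ_y(x)|. Together with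
|f(x)|² it is the squared modulus at x of the Blaschke multiple of f. -/
theorem tupleWeight_cons {n : ℕ} {x : ℂ} {y : Fin n → ℂ} (hx : x ∈ disc) (hy : ∀ i, y i ∈ disc)
    (f : AnalyticFun disc) :
    tupleWeight (Fin.cons x y : Fin (n + 1) → ℂ) f =
      tupleWeight y f * campbellWeight x (blaschkeMul y f) := by
  have h0 := one_sub_norm_sq_pos hx
  have h1 := (szegoDet_nonneg_and_ofReal y hy).1
  have h2 : ∏ i, ‖mob x (y i)‖ ^ 2 = ‖∏ i, mob (y i) x‖ ^ 2 := by
    rw [norm_prod, ← Finset.prod_pow]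
    exact Finset.prod_congr rfl fun i _ => by rw [norm_mob_comm hx (hy i)]
  have h3 : ENNReal.ofReal ((1 / Real.pi) ^ (n + 1) *
        (1 / (1 - ‖x‖ ^ 2) * ‖∏ i, mob (y i) x‖ ^ 2 * szegoDet y)) * ENNReal.ofReal (‖ev f x‖ ^ 2) =
      ENNReal.ofReal ((1 / Real.pi) ^ n * szegoDet y) *
        (ENNReal.ofReal (1 / (Real.pi * (1 - ‖x‖ ^ 2))) *
          ENNReal.ofReal (‖∏ i, mob (y i) x‖ ^ 2 * ‖ev f x‖ ^ 2)) := by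
    rw [← ENNReal.ofReal_mul (by positivity), ← ENNReal.ofReal_mul (by positivity),
      ← ENNReal.ofReal_mul (by positivity)]
    congr 1
    rw [one_div_mul_eq_div, pow_succ]
    field_simp
  rw [tupleWeight, tupleWeight, campbellWeight, szegoDet_cons hx hy, Fin.prod_univ_succ,
    Fin.cons_zero, ev_blaschkeMul _ _ hx, norm_mul, mul_pow, h2, ← mul_assoc, h3]
  simp only [Fin.cons_succ]
  ring

/-- The determinant vanishes when points coincide, so the distinctness constraint disappears from
the integral side. -/
theorem tupleWeight_cons_eq_zero {n : ℕ} {x : ℂ} {y : Fin n → ℂ} (hx : x ∈ disc)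
    (hy : ∀ i, y i ∈ disc) (hxy : ¬ ∀ i, y i ≠ x) (f : AnalyticFun disc) :
    tupleWeight (Fin.cons x y : Fin (n + 1) → ℂ) f = 0 := by
  push Not at hxy
  obtain ⟨i, hi⟩ := hxy
  have : ∏ i, ‖mob x (y i)‖ ^ 2 = 0 :=
    Finset.prod_eq_zero (Finset.mem_univ i) (by
      rw [(mob_eq_zero_iff hx (hy i)).2 hi, norm_zero, zero_pow two_ne_zero])
  rw [tupleWeight, szegoDet_cons hx hy, this]
  simp

/-- The `n`-tuples of points of the disc. -/
def polydisc (n : ℕ) : Set (Fin n → ℂ) := {x | ∀ i, x i ∈ disc}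

theorem measurableSet_polydisc (n : ℕ) : MeasurableSet (polydisc n) := by
  have : polydisc n = ⋂ i, (fun x : Fin n → ℂ => x i) ⁻¹' disc := by ext; simp [polydisc]
  rw [this]
  exact MeasurableSet.iInter fun i => measurable_pi_apply i Metric.isOpen_ball.measurableSet

theorem lintegral_polydisc_succ (n : ℕ) {G : (Fin (n + 1) → ℂ) → ℝ≥0∞} (hG : Measurable G) :
    ∫⁻ z in polydisc (n + 1), G z =
      ∫⁻ x in disc, ∫⁻ y in polydisc n, G (Fin.cons x y) := by
  have hd : MeasurableSet disc := Metric.isOpen_ball.measurableSet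
  have he := (volume_preserving_piFinSuccAbove (fun _ : Fin (n + 1) => ℂ) 0).symm
  have hGi := hG.indicator (measurableSet_polydisc (n + 1))
  have hGe : Measurable fun p : ℂ × (Fin n → ℂ) => (polydisc (n + 1)).indicator G
      ((MeasurableEquiv.piFinSuccAbove (fun _ : Fin (n + 1) => ℂ) 0).symm p) :=
    hGi.comp he.measurable
  rw [← lintegral_indicator (measurableSet_polydisc _), ← he.lintegral_comp hGi,
    Measure.volume_eq_prod, lintegral_prod _ hGe.aemeasurable, ← lintegral_indicator hd]
  refine lintegral_congr fun x => ?_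
  have hcons : ∀ y : Fin n → ℂ, (MeasurableEquiv.piFinSuccAbove (fun _ : Fin (n + 1) => ℂ) 0).symm
      (x, y) = Fin.cons x y := fun y => by
    rw [← Fin.insertNth_zero']; rfl
  simp_rw [hcons]
  have hmem : ∀ y : Fin n → ℂ, (Fin.cons x y : Fin (n + 1) → ℂ) ∈ polydisc (n + 1) ↔
      x ∈ disc ∧ y ∈ polydisc n := fun y => by
    simp only [polydisc, mem_ofPred_eq, Fin.forall_fin_succ, Fin.cons_zero, Fin.cons_succ]
  by_cases hx : x ∈ disc
  · rw [indicator_of_mem hx, ← lintegral_indicator (measurableSet_polydisc n)]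
    refine lintegral_congr fun y => ?_
    by_cases hy : y ∈ polydisc n
    · rw [indicator_of_mem hy, indicator_of_mem ((hmem y).2 ⟨hx, hy⟩)]
    · rw [indicator_of_notMem hy, indicator_of_notMem fun h => hy ((hmem y).1 h).2]
  · rw [indicator_of_notMem hx, lintegral_eq_zero_of_ae_eq_zero]
    exact Filter.Eventually.of_forall fun y =>
      indicator_of_notMem (fun h => hx ((hmem y).1 h).1) _

/-- The Campbell formula removes the first zero x, and the induction hypothesis treats the others at
fixed x. Its test function carries `campbellWeight x f`, which is why h has to be allowed to depend
on f. Successive factors φ_x build up the Blaschke product. -/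
theorem IsGAFLaw.lintegral_tupleSum {m : Measure (AnalyticFun disc)} [IsProbabilityMeasure m]
    (hm : IsGAFLaw m) (n : ℕ) {h : (Fin n → ℂ) → AnalyticFun disc → ℝ≥0∞}
    (hh : Measurable (Function.uncurry h)) :
    ∫⁻ f, tupleSum n (zeros f) (fun z => h z f) ∂m =
      ∫⁻ z in polydisc n, ∫⁻ f, tupleWeight z f * h z (blaschkeMul z f) ∂m := by
  induction n with
  | zero =>
    simp_rw [tupleSum_zero, blaschkeMul_zero]
    have hp : polydisc 0 = univ := eq_univ_of_forall fun z i => i.elim0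
    have hint : ∀ F : (Fin 0 → ℂ) → ℝ≥0∞, ∫⁻ z, F z = F default := fun F => by
      rw [Measure.volume_pi_eq_dirac default, lintegral_dirac]
    rw [hp, Measure.restrict_univ, hint]
    simp [tupleWeight, szegoDet]
  | succ n ih =>
    have hk : Measurable (Function.uncurry fun (x : ℂ) (f : AnalyticFun disc) =>
        tupleSum n (zeros f)
          ({y : Fin n → ℂ | ∀ i, y i ≠ x}.indicator fun y => h (Fin.cons x y) f)) := by
      refine measurable_tupleSum n (α := ℂ × AnalyticFun disc) (F := fun p => p.2) (h := fun p =>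
        {y | ∀ i, y i ≠ p.1}.indicator fun y => h (Fin.cons p.1 y) p.2) measurable_snd ?_
      have h2 : Measurable fun q : (ℂ × AnalyticFun disc) × (Fin n → ℂ) =>
          h (Fin.cons q.1.1 q.2) q.1.2 :=
        hh.comp ((measurable_finCons (measurable_fst.comp measurable_fst) measurable_snd).prodMk
          (measurable_snd.comp measurable_fst))
      exact h2.indicator (measurableSet_avoid (measurable_fst.comp measurable_fst) measurable_snd)
    have h1 : ∀ f : AnalyticFun disc, tupleSum (n + 1) (zeros f) (fun z => h z f) =
        ∫⁻ x, tupleSum n (zeros f)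
          ({y | ∀ i, y i ≠ x}.indicator fun y => h (Fin.cons x y) f) ∂zeroMeasure f := fun f => by
      rw [tupleSum_succ, lintegral_zeroMeasure]
    simp_rw [h1]
    have hG : Measurable fun z : Fin (n + 1) → ℂ =>
        ∫⁻ f, tupleWeight z f * h z (blaschkeMul z f) ∂m := by
      refine Measurable.lintegral_prod_right' (f := fun p : (Fin (n + 1) → ℂ) × AnalyticFun disc =>
        tupleWeight p.1 p.2 * h p.1 (blaschkeMul p.1 p.2)) ?_
      exact (measurable_tupleWeight _).mul
        (hh.comp (measurable_fst.prodMk (measurable_blaschkeMul _)))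
    rw [hm.lintegral_zeros hk, lintegral_polydisc_succ n hG]
    refine setLIntegral_congr_fun Metric.isOpen_ball.measurableSet fun x hx => ?_
    have h2 : ∀ f : AnalyticFun disc, campbellWeight x f * tupleSum n (zeros (affMap x 0 f))
        ({y | ∀ i, y i ≠ x}.indicator fun y => h (Fin.cons x y) (affMap x 0 f)) =
        tupleSum n (zeros f) fun y => campbellWeight x f *
          {y | ∀ i, y i ≠ x}.indicator (fun y => h (Fin.cons x y) (affMap x 0 f)) y := fun f => by
      rw [tupleSum_congr_of_avoid (zeros_affMap_sdiff hx f), tupleSum_const_mul]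
    simp_rw [h2]
    have h3 := ih (h := fun y f => campbellWeight x f *
      {y | ∀ i, y i ≠ x}.indicator (fun y => h (Fin.cons x y) (affMap x 0 f)) y) (by
        refine (measurable_campbellWeight.comp (measurable_const.prodMk measurable_snd)).mul ?_
        have h4 : Measurable fun q : (Fin n → ℂ) × AnalyticFun disc =>
            h (Fin.cons x q.1) (affMap x 0 q.2) :=
          hh.comp ((measurable_finCons measurable_const measurable_fst).prodMk
            ((measurable_affMap_left x).comp (measurable_const.prodMk measurable_snd)))
        exact h4.indicator (measurableSet_avoid measurable_const measurable_fst))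
    rw [h3]
    refine setLIntegral_congr_fun (measurableSet_polydisc n) fun y hy => ?_
    refine lintegral_congr fun f => ?_
    by_cases hxy : ∀ i, y i ≠ x
    · rw [indicator_of_mem (by exact hxy), affMap_blaschkeMul, tupleWeight_cons hx hy, mul_assoc]
    · rw [indicator_of_notMem (by exact hxy), tupleWeight_cons_eq_zero hx hy hxy, mul_zero,
        mul_zero, zero_mul]

/-- The joint intensities of the zeros. -/
theorem IsGAFLaw.lintegral_tupleSum_eq {m : Measure (AnalyticFun disc)} [IsProbabilityMeasure m]
    (hm : IsGAFLaw m) (n : ℕ) {h : (Fin n → ℂ) → ℝ≥0∞} (hh : Measurable h) :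
    ∫⁻ f, tupleSum n (zeros f) h ∂m = ∫⁻ z in polydisc n,
      ENNReal.ofReal (Matrix.det (Matrix.of fun i j => bergmanKernel (z i) (z j))).re * h z := by
  rw [hm.lintegral_tupleSum n (h := fun z _ => h z) (hh.comp measurable_fst)]
  refine setLIntegral_congr_fun (measurableSet_polydisc n) fun z hz => ?_
  have hprod : Measurable fun f : AnalyticFun disc => ∏ i, ENNReal.ofReal (‖ev f (z i)‖ ^ 2) :=
    Finset.measurable_prod _ fun i _ =>
      ((measurable_ev_apply (z i)).norm.pow_const 2).ennreal_ofReal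
  obtain ⟨p, hp0, hp, hpi⟩ := hm.lintegral_prod_ev hz
  obtain ⟨h1, h2⟩ := szegoDet_nonneg_and_ofReal z hz
  simp only [tupleWeight]
  rw [lintegral_mul_const _ (hprod.const_mul _), lintegral_const_mul _ hprod, hpi,
    ← ENNReal.ofReal_mul (by positivity), det_bergmanKernel hz, ← h2, ← hp]
  congr 2
  rw [← Complex.ofReal_re ((1 / Real.pi) ^ n * szegoDet z * p)]
  push_cast
  rw [mul_assoc]

/-- The Szegő determinant is nonnegative by its recursion. The permanent is nonnegative as the
moment E ∏|f(z_i)|², which is where `hm` enters. -/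
theorem det_bergmanKernel_re {n : ℕ} {m : Measure (AnalyticFun disc)} [IsProbabilityMeasure m]
    (hm : IsGAFLaw m) {z : Fin n → ℂ} (hz : z ∈ polydisc n) :
    0 ≤ (Matrix.det (Matrix.of fun i j => bergmanKernel (z i) (z j))).re ∧
    (((Matrix.det (Matrix.of fun i j => bergmanKernel (z i) (z j))).re : ℝ) : ℂ) =
      Matrix.det (Matrix.of fun i j => bergmanKernel (z i) (z j)) := by
  obtain ⟨p, hp0, hp, -⟩ := hm.lintegral_prod_ev hz
  obtain ⟨h1, h2⟩ := szegoDet_nonneg_and_ofReal z hz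
  have h3 : Matrix.det (Matrix.of fun i j => bergmanKernel (z i) (z j)) =
      (((1 / Real.pi) ^ n * (szegoDet z * p) : ℝ) : ℂ) := by
    rw [det_bergmanKernel hz, ← h2, ← hp]; push_cast; rfl
  rw [h3, Complex.ofReal_re]
  exact ⟨by positivity, rfl⟩

/-! ### The zeros form a determinantal process -/

theorem finite_distinctTuples_inter_support {n : ℕ} {ψ : (Fin n → ℂ) → ℝ}
    (hc : HasCompactSupport ψ) (hs : tsupport ψ ⊆ polydisc n) (f : AnalyticFun disc) :
    (distinctTuples n (zeros f) ∩ Function.support ψ).Finite := by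
  have h1 : ∀ i : Fin n, (zeros f ∩ (fun x : Fin n → ℂ => x i) '' tsupport ψ).Finite := fun i => by
    refine finite_zeros_inter f (IsCompact.image hc (continuous_apply i)) ?_
    rintro _ ⟨x, hx, rfl⟩
    exact hs hx i
  refine (Set.Finite.pi h1).subset ?_
  rintro x ⟨hx, hψ⟩
  exact fun i _ => ⟨hx.2 i, x, subset_tsupport ψ hψ, rfl⟩

/-- Compact support leaves finitely many nonzero terms, so the real `tsum` is a genuine finite sum
and splits into positive and negative parts. -/
theorem distinctSum_eq_toReal_sub {n : ℕ} {ψ : (Fin n → ℂ) → ℝ}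
    (hc : HasCompactSupport ψ) (hs : tsupport ψ ⊆ polydisc n) (f : AnalyticFun disc) :
    distinctSum n (zeros f) ψ =
      (tupleSum n (zeros f) fun x => ENNReal.ofReal (ψ x)).toReal -
        (tupleSum n (zeros f) fun x => ENNReal.ofReal (-ψ x)).toReal := by
  have hfin := finite_distinctTuples_inter_support hc hs f
  have hsum : ∀ φ : ℝ → ℝ, φ 0 = 0 →
      Summable fun x : distinctTuples n (zeros f) => φ (ψ x) := by
    intro φ hφ
    refine summable_of_hasFiniteSupport ((hfin.preimage Subtype.val_injective.injOn).subset ?_)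
    refine fun x hx => ⟨x.2, fun h0 => hx ?_⟩
    change φ (ψ x) = 0
    rw [h0, hφ]
  rw [tupleSum, tupleSum, ENNReal.tsum_toReal_eq fun _ => ENNReal.ofReal_ne_top,
    ENNReal.tsum_toReal_eq fun _ => ENNReal.ofReal_ne_top]
  rw [← Summable.tsum_sub (hsum (fun t => (ENNReal.ofReal t).toReal) (by simp))
    (hsum (fun t => (ENNReal.ofReal (-t)).toReal) (by simp))]
  refine tsum_congr fun x => ?_
  rw [ENNReal.toReal_ofReal', ENNReal.toReal_ofReal', max_zero_sub_max_neg_zero_eq_self]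

/-- The determinantal intensity of the Bergman kernel. -/
def bergmanDet {n : ℕ} (z : Fin n → ℂ) : ℂ :=
  Matrix.det (Matrix.of fun i j => bergmanKernel (z i) (z j))

theorem measurable_bergmanDet (n : ℕ) : Measurable fun z : Fin n → ℂ => bergmanDet z := by
  unfold bergmanDet
  simp_rw [Matrix.det_apply]
  refine Finset.measurable_sum _ fun σ _ => ?_
  refine Measurable.const_smul (Finset.measurable_prod _ fun i _ => ?_) _
  have h1 : Measurable fun z : Fin n → ℂ => z (σ i) * conj (z i) :=
    (measurable_pi_apply _).mul (measurable_conj.comp (measurable_pi_apply _))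
  exact (((h1.const_sub 1).pow_const 2).const_mul (Real.pi : ℂ)).const_div 1

theorem continuousOn_bergmanDet (n : ℕ) :
    ContinuousOn (fun z : Fin n → ℂ => bergmanDet z) (polydisc n) := by
  unfold bergmanDet
  simp_rw [Matrix.det_apply]
  refine continuousOn_finsetSum _ fun σ _ => ?_
  refine ContinuousOn.const_smul (continuousOn_finsetProd _ fun i _ => ?_) _
  refine ContinuousOn.div continuousOn_const ?_ fun z hz => ?_
  · have : Continuous fun z : Fin n → ℂ => (Real.pi : ℂ) * (1 - z (σ i) * conj (z i)) ^ 2 := by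
      fun_prop
    exact this.continuousOn
  · exact mul_ne_zero (Complex.ofReal_ne_zero.2 Real.pi_ne_zero)
      (pow_ne_zero 2 (one_sub_mul_conj_ne_zero (hz _) (hz _)))

theorem integrableOn_bergmanDet_mul {n : ℕ} {ψ : (Fin n → ℂ) → ℝ} (hψ : Measurable ψ)
    (hb : ∃ M, ∀ x, |ψ x| ≤ M) (hc : HasCompactSupport ψ) (hs : tsupport ψ ⊆ polydisc n) :
    IntegrableOn (fun z => (bergmanDet z).re * ψ z) (polydisc n) := by
  obtain ⟨M, hM⟩ := hb
  obtain ⟨C, hC⟩ := IsCompact.exists_bound_of_continuousOn hc ((continuousOn_bergmanDet n).mono hs)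
  have hK : MeasurableSet (tsupport ψ) := (isClosed_tsupport ψ).measurableSet
  have h1 : Integrable ((tsupport ψ).indicator fun _ => C * M) (volume : Measure (Fin n → ℂ)) :=
    (integrable_indicator_iff hK).2 (integrableOn_const (IsCompact.measure_ne_top hc))
  refine Integrable.mono' h1.restrict ?_ (Filter.Eventually.of_forall fun z => ?_)
  · exact ((Complex.measurable_re.comp (measurable_bergmanDet n)).mul hψ).aestronglyMeasurable
  · by_cases hz : z ∈ tsupport ψ
    · rw [indicator_of_mem hz, norm_mul, Real.norm_eq_abs, Real.norm_eq_abs]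
      exact mul_le_mul ((Complex.abs_re_le_norm _).trans (hC z hz)) (hM z) (abs_nonneg _)
        ((norm_nonneg _).trans (hC z hz))
    · rw [indicator_of_notMem hz, image_eq_zero_of_notMem_tsupport hz, mul_zero, norm_zero]

/-- The intensity formula in [0, ∞] is applied to the positive and negative parts of ψ. Both sides
are finite because the determinant is bounded on the compact support of ψ. -/
theorem IsGAFLaw.intensity {m : Measure (AnalyticFun disc)} [IsProbabilityMeasure m]
    (hm : IsGAFLaw m) {n : ℕ} {ψ : (Fin n → ℂ) → ℝ} (hψ : Measurable ψ)
    (hb : ∃ M, ∀ x, |ψ x| ≤ M) (hc : HasCompactSupport ψ) (hs : tsupport ψ ⊆ polydisc n) :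
    Integrable (fun f => distinctSum n (zeros f) ψ) m ∧
      ((∫ f, distinctSum n (zeros f) ψ ∂m : ℝ) : ℂ) =
        ∫ x in polydisc n, (ψ x : ℂ) * bergmanDet x := by
  have hF := integrableOn_bergmanDet_mul hψ hb hc hs
  have hpart : ∀ φ : (Fin n → ℂ) → ℝ, Measurable φ →
      IntegrableOn (fun z => (bergmanDet z).re * φ z) (polydisc n) →
      Measurable (fun f => tupleSum n (zeros f) fun x => ENNReal.ofReal (φ x)) ∧
      ∫⁻ f, (tupleSum n (zeros f) fun x => ENNReal.ofReal (φ x)) ∂m =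
        ∫⁻ z in polydisc n, ENNReal.ofReal ((bergmanDet z).re * φ z) ∧
      ∫⁻ f, (tupleSum n (zeros f) fun x => ENNReal.ofReal (φ x)) ∂m ≠ ⊤ := by
    intro φ hφ hφi
    have h1 : ∫⁻ f, (tupleSum n (zeros f) fun x => ENNReal.ofReal (φ x)) ∂m =
        ∫⁻ z in polydisc n, ENNReal.ofReal ((bergmanDet z).re * φ z) := by
      rw [hm.lintegral_tupleSum_eq n hφ.ennreal_ofReal]
      refine setLIntegral_congr_fun (measurableSet_polydisc n) fun z hz => ?_
      rw [bergmanDet, ENNReal.ofReal_mul (det_bergmanKernel_re hm hz).1]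
    refine ⟨measurable_tupleSum n (F := id) (h := fun _ x => ENNReal.ofReal (φ x)) measurable_id
      (hφ.ennreal_ofReal.comp measurable_snd), h1, ?_⟩
    rw [h1]
    exact hφi.lintegral_lt_top.ne
  obtain ⟨hpm, hpe, hpt⟩ := hpart ψ hψ hF
  obtain ⟨hnm, hne, hnt⟩ := hpart (fun x => -ψ x) hψ.neg (by simp_rw [mul_neg]; exact hF.neg)
  simp_rw [distinctSum_eq_toReal_sub hc hs]
  have hip := integrable_toReal_of_lintegral_ne_top hpm.aemeasurable hpt
  have hin := integrable_toReal_of_lintegral_ne_top hnm.aemeasurable hnt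
  refine ⟨hip.sub hin, ?_⟩
  rw [integral_sub hip hin, integral_toReal hpm.aemeasurable (ae_lt_top hpm hpt),
    integral_toReal hnm.aemeasurable (ae_lt_top hnm hnt), hpe, hne]
  have h1 := integral_eq_lintegral_pos_part_sub_lintegral_neg_part hF
  simp only [← mul_neg] at h1
  rw [← h1, ← integral_complex_ofReal]
  refine setIntegral_congr_fun (measurableSet_polydisc n) fun z hz => ?_
  have h2 : (((bergmanDet z).re : ℝ) : ℂ) = bergmanDet z := (det_bergmanKernel_re hm hz).2
  rw [Complex.ofReal_mul, h2, mul_comm]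

/-- Almost surely G is not identically zero, and then `zeroSet` and `zeros` agree; every property is
transferred from the law of G. -/
theorem isDeterminantalProcess_zeroSet {Ω : Type*} [MeasurableSpace Ω] {P : Measure Ω}
    [IsProbabilityMeasure P] {G : Ω → AnalyticFun disc} (hG : Measurable G)
    (hm : IsGAFLaw (P.map G)) :
    IsDeterminantalProcess P disc bergmanKernel fun ω => zeroSet (G ω) := by
  have := Measure.isProbabilityMeasure_map (μ := P) hG.aemeasurable
  have hae : ∀ᵐ ω ∂P, zeroSet (G ω) = zeros (G ω) :=
    (ae_of_ae_map hG.aemeasurable hm.ae_isNontrivial).mono fun ω h => zeroSet_eq_zeros h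
  refine ⟨hae.mono fun ω h => h ▸ zeros_subset _, hae.mono fun ω h C hC hCd => ?_, fun B hB => ?_,
    fun n _ ψ hψ hb hc hs => ?_⟩
  · rw [h]
    exact finite_zeros_inter _ hC hCd
  · exact ⟨_, (measurable_encard_zeros_inter hB).comp hG,
      hae.mono fun ω h => by simp only [h, Function.comp_apply]⟩
  · obtain ⟨h1, h2⟩ := hm.intensity hψ hb hc hs
    have h3 : (fun ω => distinctSum n (zeroSet (G ω)) ψ) =ᵐ[P]
        fun ω => distinctSum n (zeros (G ω)) ψ := hae.mono fun ω h => by simp only [h]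
    refine ⟨(h1.comp_measurable hG).congr h3.symm, ?_⟩
    rw [integral_congr_ae h3, ← integral_map hG.aemeasurable h1.aestronglyMeasurable
      (f := fun f => distinctSum n (zeros f) ψ)]
    exact h2

/-! ### The transform of white noise -/

/-- The Taylor coefficients are conj ξ_{n+N}; an injective reindexing and conjugation both preserve
i.i.d. standard complex Gaussians. -/
theorem isHyperbolicGAF_extTransformMap (N : ℕ) {Ω : Type*} [MeasurableSpace Ω] {P : Measure Ω}
    {ξ : Ω → Theta} (hξ : IsWhiteNoise P ξ) :
    IsHyperbolicGAF 0 P fun ω => extTransformMap N (ξ ω) := by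
  obtain ⟨hm, g, hg, hsum⟩ := hξ
  have hinj : Function.Injective fun n : ℕ => (n : ℤ) + N := fun a b h => by simpa using h
  refine ⟨(continuous_extTransformMap N).measurable.comp hm, _, (hg.precomp hinj).conj, ?_⟩
  filter_upwards [hsum] with ω hω z
  convert! hasSum_extTransformMap_of_hasSum N hω z using 1
  funext k
  rw [add_zero, Real.Gamma_nat_eq_factorial, div_self (by positivity), Real.sqrt_one,
    Complex.ofReal_one, mul_one]

end PerGAF

end

theorem mainTheorem6 (N : ℕ) :
    (∀ k : ℤ, ∀ z ∈ PerGAF.disc, PerGAF.perTransform N (PerGAF.fourierVec k) z =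
      if (N : ℤ) ≤ k then z ^ (k - N) else 0) ∧
    (∃! L : PerGAF.Theta → PerGAF.AnalyticFun PerGAF.disc,
      PerGAF.IsExtensionOfPerTransform N L) ∧
    ∀ L : PerGAF.Theta → PerGAF.AnalyticFun PerGAF.disc, PerGAF.IsExtensionOfPerTransform N L →
      ∀ {Ω : Type*} [MeasurableSpace Ω] (P : Measure Ω) [IsProbabilityMeasure P]
        (ξ : Ω → PerGAF.Theta), PerGAF.IsWhiteNoise P ξ →
        PerGAF.IsHyperbolicGAF 0 P (fun ω => L (ξ ω)) ∧
        (∀ {Ω' : Type*} [MeasurableSpace Ω'] (P' : Measure Ω') [IsProbabilityMeasure P']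
          (G : Ω' → PerGAF.AnalyticFun PerGAF.disc), PerGAF.IsHyperbolicGAF 0 P' G →
          IdentDistrib (fun ω => L (ξ ω)) G P P') ∧
        PerGAF.IsDeterminantalProcess P PerGAF.disc PerGAF.bergmanKernel
          (fun ω => PerGAF.zeroSet (L (ξ ω))) := by
  refine ⟨fun k z hz => PerGAF.perTransform_fourierVec N k hz,
    ⟨PerGAF.extTransformMap N, PerGAF.isExtension_extTransformMap N, fun L hL => hL.eq⟩, ?_⟩
  intro L hL Ω _ P _ ξ hξ
  obtain rfl := hL.eq
  have hGAF := PerGAF.isHyperbolicGAF_extTransformMap N hξ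
  refine ⟨hGAF, fun P' _ G hG => ⟨hGAF.1.aemeasurable, hG.1.aemeasurable, ?_⟩,
    PerGAF.isDeterminantalProcess_zeroSet hGAF.1 hGAF.isGAFLaw⟩
  have := Measure.isProbabilityMeasure_map (μ := P) hGAF.1.aemeasurable
  have := Measure.isProbabilityMeasure_map (μ := P') hG.1.aemeasurable
  exact PerGAF.IsGAFLaw.eq hGAF.isGAFLaw hG.isGAFLaw
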